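/- **Existence and uniqueness of the solution by transposition.** Let $a\in C[0,1]$ with $a(0)=0$, $a>0$ on $(0,1]$, and set $K:=\sup_{x\in(0,1]}\frac{x|a'(x)|}{a(x)}$. Assume that $a$ is weakly degenerate at $0$ ($a\in C^1(0,1]$ and $K\in(0,1)$) or strongly degenerate at $0$ ($a\in C^1[0,1]$ and $K\in[1,2)$). Let $L^2_{1/a}=\{u\in L^2(0,1):\int_0^1 u^2/a\,dx<\infty\}$ with $\|u\|^2_{L^2_{1/a}}=\int_0^1u^2/a\,dx$, let $H^2_{1/a}=L^2_{1/a}\cap H^2_0(0,1)$ with $\|u\|^2_{H^2_{1/a}}=\|u\|^2_{L^2_{1/a}}+\|u'\|^2_{L^2}+\|u''\|^2_{L^2}$, let $(H^2_{1/a})^*$ be its dual with $L^2_{1/a}$ as pivot space, let $\mathcal H_0=H^2_{1/a}\times L^2_{1/a}$, and let $Au=au''''$ with $D(A)=\{u\in H^2_{1/a}: au''''\in L^2_{1/a}\}$. For $T>0$ and $(v^0_T,v^1_T)\in\mathcal H_0$ let $v\in C([0,\infty);H^2_{1/a})\cap C^1([0,\infty);L^2_{1/a})$ be the mild solution of $$v_{tt}+a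 v_{xxxx}=0,\quad v(t,0)=v_x(t,0)=v(t,1)=v_x(t,1)=0,\quad v(T)=v^0_T,\ v_t(T)=v^1_T ,$$ that is, $V=(v,v_t)$ satisfies $V(t)=V(T)+\mathcal A\int_T^tV(s)\,ds$ for all $t\ge0$, where $\mathcal A(p,q)=(q,-Ap)$ with $D(\mathcal A)=D(A)\times H^2_{1/a}$. Let $v_{xx}(\cdot,1)\in L^2(0,T)$ be its boundary trace, defined pointwise for classical solutions and, in general, as the limit in $L^2(0,T)$ of the traces of classical solutions whose data at time $T$ converge to $(v^0_T,v^1_T)$ in $\mathcal H_0$. Let $f\in L^2_{loc}[0,\infty)$ and $(u_0,u_1)\in L^2_{1/a}\times(H^2_{1/a})^*$. A solution by transposition of $$u_{tt}+au_{xxxx}=0,\quad u(t,0)=u_x(t,0)=u(t,1)=0,\ u_x(t,1)=f(t),\quad u(0)=u_0,\ u_t(0)=u_1,\qquad (P)$$ is a function $u\in C([0,\infty);L^2_{1/a})\cap C^1([0,\infty);(H^2_{1/a})^*)$ such that, for all $T>0$ and all $(v^0_T,v^1_T)\in\mathcal H_0$, with $v$ as above, $$\langle u_t(T),v^0_T\rangle-\int_0^1\frac{u(T)\,v^1_T}{a}\,dx=\langle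 u_1,v(0)\rangle-\int_0^1\frac{u_0\,v_t(0,x)}{a}\,dx-\int_0^Tf(t)\,v_{xx}(t,1)\,dt ,$$ where $\langle\cdot,\cdot\rangle$ is the duality of $(H^2_{1/a})^*$ and $H^2_{1/a}$. Then, for every such $f$, $u_0$, $u_1$, problem $(P)$ has a unique solution by transposition on $[0,\infty)$. -/

import Mathlib

open MeasureTheory Set Filter Topology
open scoped ContDiff

namespace DegenerateBeam

/-- Coefficients `a` of the degenerate beam: `a` is continuous on `[0,1]`, vanishes at `0` and is
positive on `(0,1]`.  Only the values on `[0,1]` matter. -/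
structure Coefficient where
  toFun : ℝ → ℝ
  continuousOn : ContinuousOn toFun (Icc 0 1)
  map_zero : toFun 0 = 0
  pos : ∀ x ∈ Ioc (0 : ℝ) 1, 0 < toFun x

instance : CoeFun Coefficient (fun _ => ℝ → ℝ) := ⟨Coefficient.toFun⟩

/-- `K = sup_{x ∈ (0,1]} x |a'(x)| / a(x)` (and this supremum is finite). -/
def IsDegeneracyConstant (a : Coefficient) (K : ℝ) : Prop :=
  IsLUB ((fun x : ℝ => x * |derivWithin a (Icc 0 1) x| / a x) '' Ioc 0 1) K

/-- (WD): `a ∈ C[0,1] ∩ C¹(0,1]`, `a(0) = 0`, `a > 0` on `(0,1]`, and `K ∈ (0,1)`. -/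
def IsWeaklyDegenerate (a : Coefficient) : Prop :=
  ContDiffOn ℝ 1 a (Ioc 0 1) ∧ ∃ K ∈ Ioo (0 : ℝ) 1, IsDegeneracyConstant a K

/-- (SD): `a ∈ C¹[0,1]`, `a(0) = 0`, `a > 0` on `(0,1]`, and `K ∈ [1,2)`. -/
def IsStronglyDegenerate (a : Coefficient) : Prop :=
  ContDiffOn ℝ 1 a (Icc 0 1) ∧ ∃ K ∈ Ico (1 : ℝ) 2, IsDegeneracyConstant a K

/-- Lebesgue measure on `(0,1)`. -/
noncomputable abbrev lebesgue01 : Measure ℝ := volume.restrict (Ioo 0 1)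

/-- The measure `dx / a(x)` on `(0,1)`. -/
noncomputable def weightedMeasure (a : Coefficient) : Measure ℝ :=
  lebesgue01.withDensity (fun x => ENNReal.ofReal (a x)⁻¹)

/-- `L²(0,1)`. -/
noncomputable abbrev L2 : Type := Lp ℝ 2 lebesgue01

/-- `L²_{1/a}(0,1)`, a Hilbert space with `‖u‖² = ∫₀¹ u² / a dx`.  As `a` is bounded on `(0,1)`,
finiteness of this integral implies `u ∈ L²(0,1)`. -/
noncomputable abbrev L2w (a : Coefficient) : Type := Lp ℝ 2 (weightedMeasure a)

/-- Test functions: `C_c^∞(0,1)`. -/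
def IsTestFunction (φ : ℝ → ℝ) : Prop :=
  ContDiff ℝ ∞ φ ∧ HasCompactSupport φ ∧ tsupport φ ⊆ Ioo 0 1

/-- `w` is the weak derivative of `u` on `(0,1)`. -/
def HasWeakDeriv (u w : ℝ → ℝ) : Prop :=
  ∀ φ : ℝ → ℝ, IsTestFunction φ →
    ∫ x in Ioo (0 : ℝ) 1, u x * deriv φ x = -∫ x in Ioo (0 : ℝ) 1, w x * φ x

/-- The continuous representative of `u` on `[0,1]` exists and vanishes at `0` and at `1`. -/
def VanishesAtEndpoints (u : ℝ → ℝ) : Prop :=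
  ∃ w : ℝ → ℝ, ContinuousOn w (Icc 0 1) ∧ u =ᵐ[lebesgue01] w ∧ w 0 = 0 ∧ w 1 = 0

/-! ### Facts used to see that `H²_{1/a}` is a linear space -/

theorem Coefficient.aemeasurable_density (a : Coefficient) :
    AEMeasurable (fun x => ENNReal.ofReal (a x)⁻¹) lebesgue01 := by
  have h : AEMeasurable a lebesgue01 :=
    (a.continuousOn.mono Ioo_subset_Icc_self).aemeasurable measurableSet_Ioo
  exact h.inv.ennreal_ofReal

theorem lebesgue01_absolutelyContinuous (a : Coefficient) :
    lebesgue01 ≪ weightedMeasure a := by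
  refine withDensity_absolutelyContinuous' a.aemeasurable_density ?_
  filter_upwards [ae_restrict_mem measurableSet_Ioo] with x hx
  have := a.pos x ⟨hx.1, hx.2.le⟩
  simpa using this

theorem exists_lebesgue01_le (a : Coefficient) :
    ∃ c : ENNReal, c ≠ ⊤ ∧ lebesgue01 ≤ c • weightedMeasure a := by
  obtain ⟨M, hM⟩ := isCompact_Icc.exists_bound_of_continuousOn a.continuousOn
  refine ⟨ENNReal.ofReal M, ENNReal.ofReal_ne_top, ?_⟩
  have h1 : lebesgue01 = lebesgue01.withDensity 1 := withDensity_one.symm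
  rw [weightedMeasure, ← withDensity_smul' _ _ ENNReal.ofReal_ne_top]
  conv_lhs => rw [h1]
  refine withDensity_mono ?_
  filter_upwards [ae_restrict_mem measurableSet_Ioo] with x hx
  have hp := a.pos x ⟨hx.1, hx.2.le⟩
  have hb := hM x ⟨hx.1.le, hx.2.le⟩
  rw [Real.norm_eq_abs, abs_of_pos hp] at hb
  simp only [Pi.one_apply, Pi.smul_apply, smul_eq_mul]
  rw [← ENNReal.ofReal_mul (hp.le.trans hb), ← ENNReal.ofReal_one]
  refine ENNReal.ofReal_le_ofReal ?_
  rw [← div_eq_mul_inv, le_div_iff₀ hp]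
  linarith

theorem L2.integrable (u : L2) : Integrable u lebesgue01 :=
  (Lp.memLp u).integrable (by norm_num)

theorem L2w.integrable {a : Coefficient} (u : L2w a) : Integrable u lebesgue01 := by
  obtain ⟨c, hc, hle⟩ := exists_lebesgue01_le a
  exact ((Lp.memLp u).of_measure_le_smul hc hle).integrable (by norm_num)

theorem integrable_mul_of_test {u ψ : ℝ → ℝ} (hu : Integrable u lebesgue01)
    (hψ : Continuous ψ) (hc : HasCompactSupport ψ) :
    Integrable (fun x => u x * ψ x) lebesgue01 := by
  obtain ⟨C, hC⟩ := hψ.bounded_above_of_compact_support hc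
  exact hu.mul_bdd hψ.aestronglyMeasurable (Eventually.of_forall hC)

theorem HasWeakDeriv.add {u₁ u₂ w₁ w₂ : ℝ → ℝ} (h₁ : HasWeakDeriv u₁ w₁)
    (h₂ : HasWeakDeriv u₂ w₂) (iu₁ : Integrable u₁ lebesgue01) (iu₂ : Integrable u₂ lebesgue01)
    (iw₁ : Integrable w₁ lebesgue01) (iw₂ : Integrable w₂ lebesgue01) :
    HasWeakDeriv (u₁ + u₂) (w₁ + w₂) := by
  intro φ hφ
  have hd : Continuous (deriv φ) := hφ.1.continuous_deriv (by simp)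
  have hdc : HasCompactSupport (deriv φ) := hφ.2.1.deriv
  simp only [Pi.add_apply, add_mul]
  rw [integral_add (integrable_mul_of_test iu₁ hd hdc) (integrable_mul_of_test iu₂ hd hdc),
    integral_add (integrable_mul_of_test iw₁ hφ.1.continuous hφ.2.1)
      (integrable_mul_of_test iw₂ hφ.1.continuous hφ.2.1), h₁ φ hφ, h₂ φ hφ]
  ring

theorem HasWeakDeriv.smul {u w : ℝ → ℝ} (h : HasWeakDeriv u w) (c : ℝ) :
    HasWeakDeriv (c • u) (c • w) := by
  intro φ hφ
  simp only [Pi.smul_apply, smul_eq_mul, mul_assoc]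
  rw [integral_const_mul, integral_const_mul, h φ hφ, mul_neg]

theorem HasWeakDeriv.congr {u u' w w' : ℝ → ℝ} (h : HasWeakDeriv u w)
    (hu : u' =ᵐ[lebesgue01] u) (hw : w' =ᵐ[lebesgue01] w) : HasWeakDeriv u' w' := by
  intro φ hφ
  have e1 : ∫ x in Ioo (0 : ℝ) 1, u' x * deriv φ x = ∫ x in Ioo (0 : ℝ) 1, u x * deriv φ x :=
    integral_congr_ae (by filter_upwards [hu] with x hx; rw [hx])
  have e2 : ∫ x in Ioo (0 : ℝ) 1, w' x * φ x = ∫ x in Ioo (0 : ℝ) 1, w x * φ x :=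
    integral_congr_ae (by filter_upwards [hw] with x hx; rw [hx])
  rw [e1, e2, h φ hφ]

theorem HasWeakDeriv.zero : HasWeakDeriv 0 0 := by
  intro φ _
  simp

theorem VanishesAtEndpoints.add {u₁ u₂ : ℝ → ℝ} (h₁ : VanishesAtEndpoints u₁)
    (h₂ : VanishesAtEndpoints u₂) : VanishesAtEndpoints (u₁ + u₂) := by
  obtain ⟨w₁, c₁, e₁, z₁, o₁⟩ := h₁
  obtain ⟨w₂, c₂, e₂, z₂, o₂⟩ := h₂
  exact ⟨w₁ + w₂, c₁.add c₂, e₁.add e₂, by simp [z₁, z₂], by simp [o₁, o₂]⟩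

theorem VanishesAtEndpoints.smul {u : ℝ → ℝ} (h : VanishesAtEndpoints u) (c : ℝ) :
    VanishesAtEndpoints (c • u) := by
  obtain ⟨w, hc, e, z, o⟩ := h
  exact ⟨c • w, hc.const_smul c, e.const_smul c, by simp [z], by simp [o]⟩

theorem VanishesAtEndpoints.congr {u u' : ℝ → ℝ} (h : VanishesAtEndpoints u)
    (hu : u' =ᵐ[lebesgue01] u) : VanishesAtEndpoints u' := by
  obtain ⟨w, hc, e, z, o⟩ := h
  exact ⟨w, hc, hu.trans e, z, o⟩

theorem VanishesAtEndpoints.zero : VanishesAtEndpoints 0 :=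
  ⟨0, continuousOn_const, ae_eq_refl _, rfl, rfl⟩

/-! ### The space `H²_{1/a}(0,1) = L²_{1/a}(0,1) ∩ H²_0(0,1)` -/

/-- The ambient space of triples `(u, u', u'')`, with
`‖(u, u', u'')‖² = ‖u‖²_{L²_{1/a}} + ‖u'‖²_{L²} + ‖u''‖²_{L²}`. -/
noncomputable abbrev Jet (a : Coefficient) : Type := WithLp 2 (L2w a × WithLp 2 (L2 × L2))

/-- `H²_{1/a}(0,1)`, realised as the set of triples `(u, u', u'')` where `u ∈ L²_{1/a}(0,1)` has the
weak derivatives `u', u'' ∈ L²(0,1)` and `u`, `u'` vanish at `0` and `1`.  The norm inherited from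
`Jet a` is `‖u‖² = ‖u‖²_{L²_{1/a}} + ‖u'‖²_{L²} + ‖u''‖²_{L²}`. -/
noncomputable def H2w (a : Coefficient) : Submodule ℝ (Jet a) where
  carrier := {p | HasWeakDeriv p.fst p.snd.fst ∧ HasWeakDeriv p.snd.fst p.snd.snd ∧
    VanishesAtEndpoints p.fst ∧ VanishesAtEndpoints p.snd.fst}
  add_mem' := by
    rintro p q ⟨p1, p2, p3, p4⟩ ⟨q1, q2, q3, q4⟩
    have e0 : ((p + q).fst : ℝ → ℝ) =ᵐ[lebesgue01] p.fst + q.fst :=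
      (lebesgue01_absolutelyContinuous a).ae_eq (Lp.coeFn_add p.fst q.fst)
    have e1 : ((p + q).snd.fst : ℝ → ℝ) =ᵐ[lebesgue01] p.snd.fst + q.snd.fst :=
      Lp.coeFn_add p.snd.fst q.snd.fst
    have e2 : ((p + q).snd.snd : ℝ → ℝ) =ᵐ[lebesgue01] p.snd.snd + q.snd.snd :=
      Lp.coeFn_add p.snd.snd q.snd.snd
    exact ⟨(p1.add q1 (L2w.integrable _) (L2w.integrable _) (L2.integrable _)
        (L2.integrable _)).congr e0 e1,
      (p2.add q2 (L2.integrable _) (L2.integrable _) (L2.integrable _)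
        (L2.integrable _)).congr e1 e2, (p3.add q3).congr e0, (p4.add q4).congr e1⟩
  zero_mem' := by
    have e0 : ((0 : Jet a).fst : ℝ → ℝ) =ᵐ[lebesgue01] 0 :=
      (lebesgue01_absolutelyContinuous a).ae_eq (Lp.coeFn_zero ℝ 2 (weightedMeasure a))
    have e1 : ((0 : Jet a).snd.fst : ℝ → ℝ) =ᵐ[lebesgue01] 0 := Lp.coeFn_zero ℝ 2 lebesgue01
    have e2 : ((0 : Jet a).snd.snd : ℝ → ℝ) =ᵐ[lebesgue01] 0 := Lp.coeFn_zero ℝ 2 lebesgue01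
    exact ⟨HasWeakDeriv.zero.congr e0 e1, HasWeakDeriv.zero.congr e1 e2,
      VanishesAtEndpoints.zero.congr e0, VanishesAtEndpoints.zero.congr e1⟩
  smul_mem' := by
    rintro c p ⟨p1, p2, p3, p4⟩
    have e0 : ((c • p).fst : ℝ → ℝ) =ᵐ[lebesgue01] c • p.fst :=
      (lebesgue01_absolutelyContinuous a).ae_eq (Lp.coeFn_smul c p.fst)
    have e1 : ((c • p).snd.fst : ℝ → ℝ) =ᵐ[lebesgue01] c • p.snd.fst :=
      Lp.coeFn_smul c p.snd.fst
    have e2 : ((c • p).snd.snd : ℝ → ℝ) =ᵐ[lebesgue01] c • p.snd.snd :=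
      Lp.coeFn_smul c p.snd.snd
    exact ⟨(p1.smul c).congr e0 e1, (p2.smul c).congr e1 e2, (p3.smul c).congr e0,
      (p4.smul c).congr e1⟩

/-- The (continuous) inclusion `H²_{1/a} ⊆ L²_{1/a}`. -/
noncomputable def incl (a : Coefficient) : H2w a →L[ℝ] L2w a :=
  (WithLp.fstL 2 ℝ (L2w a) (WithLp 2 (L2 × L2))).comp (H2w a).subtypeL

/-- The second derivative `u''` of `u ∈ H²_{1/a}`. -/
noncomputable def secondDeriv {a : Coefficient} (u : H2w a) : L2 := (u : Jet a).snd.snd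

/-- The dual space `(H²_{1/a})*`. -/
noncomputable abbrev H2wDual (a : Coefficient) : Type := StrongDual ℝ (H2w a)

/-- The inclusion `L²_{1/a} ⊆ (H²_{1/a})*` with `L²_{1/a}` as pivot space:
`u ↦ (φ ↦ ∫₀¹ u φ / a dx)`. -/
noncomputable def pivot (a : Coefficient) (u : L2w a) : H2wDual a :=
  (innerSL ℝ u).comp (incl a)

/-! ### The operator and the homogeneous problem -/

/-- `u ∈ D(A)` and `A u = w`: that is, `u ∈ H²_{1/a}`, and the fourth weak derivative of `u` is
`w / a` for `w ∈ L²_{1/a}`. -/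
def IsBeamOperator {a : Coefficient} (u : H2w a) (w : L2w a) : Prop :=
  ∀ φ : ℝ → ℝ, IsTestFunction φ →
    ∫ x in Ioo (0 : ℝ) 1, secondDeriv u x * deriv (deriv φ) x =
      ∫ x in Ioo (0 : ℝ) 1, (w x / a x) * φ x

/-- The value at `x = 1` of the second derivative of `u` is `c`: the function `u''` has a
representative that is continuous on `(0,1]` and takes the value `c` at `1`.  For `u ∈ D(A)` such a
`c` exists, because `u''` is continuous on `(0,1]`. -/
def HasSecondDerivAtOne {a : Coefficient} (u : H2w a) (c : ℝ) : Prop :=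
  ∃ w : ℝ → ℝ, ContinuousOn w (Ioc 0 1) ∧ secondDeriv u =ᵐ[lebesgue01] w ∧ w 1 = c

/-- The energy space `𝓗₀ = H²_{1/a} × L²_{1/a}` (only its topology matters). -/
noncomputable abbrev H0 (a : Coefficient) : Type := H2w a × L2w a

/-- `U = (v, w) ∈ D(𝒜) = D(A) × H²_{1/a}` and `𝒜 U = (w, -A v) = F`. -/
def IsGenerator {a : Coefficient} (U F : H0 a) : Prop :=
  U.2 = incl a F.1 ∧ IsBeamOperator U.1 (-F.2)

/-- `V = (v, v_t)` is the mild solution on `[0,∞)` of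
`v_tt + a v_xxxx = 0`, `v = v_x = 0` at `x = 0, 1`, `(v, v_t)(T) = V_T`:
`V` is continuous with values in `𝓗₀`, and `∫_T^t V ds ∈ D(𝒜)`, `V(t) = V_T + 𝒜 ∫_T^t V ds`. -/
structure IsMildSolution {a : Coefficient} (T : ℝ) (VT : H0 a) (V : ℝ → H0 a) : Prop where
  continuousOn : ContinuousOn V (Ici 0)
  integrated : ∀ t, 0 ≤ t → IsGenerator (∫ s in T..t, V s) (V t - VT)

/-- `V = (v, v_t)` is a classical solution on `[0,∞)` of the same problem:
`V ∈ C¹([0,∞); 𝓗₀) ∩ C([0,∞); D(𝒜))`, `V' = 𝒜 V` on `[0,∞)`, and `V(T) = V_T`.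
(Continuity with values in `D(𝒜)` means that `𝒜 V = V'` is continuous too.) -/
structure IsClassicalSolution {a : Coefficient} (T : ℝ) (VT : H0 a) (V : ℝ → H0 a) : Prop where
  contDiffOn : ContDiffOn ℝ 1 V (Ici 0)
  equation : ∀ t, 0 ≤ t → IsGenerator (V t) (derivWithin V (Ici 0) t)
  final : V T = VT

/-- `g ∈ L²(0,T)` is the boundary trace `t ↦ v_xx(t,1)` of the solution with data `V_T` at time `T`.
For classical solutions the trace is taken pointwise in `t`; for general `V_T ∈ 𝓗₀` it is
defined by density, as the limit in `L²(0,T)` of the traces of classical solutions whose data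
at time `T` converge to `V_T` in `𝓗₀`. -/
def IsBoundaryTrace {a : Coefficient} (T : ℝ) (VT : H0 a) (g : ℝ → ℝ) : Prop :=
  MemLp g 2 (volume.restrict (Ioo 0 T)) ∧
    ∃ (D : ℕ → H0 a) (V : ℕ → ℝ → H0 a) (h : ℕ → ℝ → ℝ),
      Tendsto D atTop (𝓝 VT) ∧
      (∀ n, IsClassicalSolution T (D n) (V n)) ∧
      (∀ n, MemLp (h n) 2 (volume.restrict (Ioo 0 T))) ∧
      (∀ n, ∀ t ∈ Icc 0 T, HasSecondDerivAtOne (V n t).1 (h n t)) ∧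
      Tendsto (fun n => eLpNorm (h n - g) 2 (volume.restrict (Ioo 0 T))) atTop (𝓝 0)

/-! ### Solutions by transposition -/

/-- `u` (only its values on `[0,∞)` matter) is a solution by transposition of
`u_tt + a u_xxxx = 0`, `u(t,0) = u_x(t,0) = 0`, `u(t,1) = 0`, `u_x(t,1) = f(t)`,
`u(0) = u₀`, `u_t(0) = u₁`.  Here `u_t` is the derivative of `u` as an `(H²_{1/a})*`-valued
function on `[0,∞)`. -/
structure IsTranspositionSolution (a : Coefficient) (f : ℝ → ℝ) (u₀ : L2w a) (u₁ : H2wDual a)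
    (u : ℝ → L2w a) : Prop where
  continuousOn : ContinuousOn u (Ici 0)
  contDiffOn : ContDiffOn ℝ 1 (fun t => pivot a (u t)) (Ici 0)
  identity : ∀ T : ℝ, 0 < T → ∀ VT : H0 a, ∃ (V : ℝ → H0 a) (g : ℝ → ℝ),
    IsMildSolution T VT V ∧ IsBoundaryTrace T VT g ∧
      derivWithin (fun t => pivot a (u t)) (Ici 0) T VT.1 - inner ℝ (u T) VT.2 =
        u₁ (V 0).1 - inner ℝ u₀ (V 0).2 - ∫ t in (0 : ℝ)..T, f t * g t

end DegenerateBeam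

/-!
# Solutions by transposition of the degenerate beam equation

The homogeneous problem is solved in the energy space of pairs `(p, q)`, where `p ∈ L²(0,1)` is
orthogonal to the affine functions and stands for `v''`, and `q ∈ L²_{1/a}` stands for `v_t`.  This
is `𝓗₀` up to an equivalent norm (`toEnergy`): integrating twice from `0` gives `|v| ≤ x ‖v''‖`, and
degeneracy gives `x |a'| ≤ 2 a`, hence `x² a(1) ≤ a(x)`, so that `v ∈ L²_{1/a}`.  Write `j` for the
resulting bounded map `v'' ↦ v`.  Then `A v = w` means `v'' = j* w` (`isBeamOperator_iff`), and the
generator `𝒜` is the inverse of the bounded injective operator `B (p, q) = (-j* q, j p)`, which is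
skew-adjoint for the energy norm.  Such a `B` determines a strongly continuous unitary group `S`
with generator `B⁻¹` (`exists_isUnitaryGroup`), and everything about the unbounded operator `𝒜` is
phrased through `B`.  Mild solutions are exactly the orbits of `S` (`IsUnitaryGroup.eq_of_mild`).

If `𝒜 U = F`, the second derivative of the first component of `U` is continuous on `(0,1]`, and
integrating by parts against a cubic lift supported in `[1/2, 1]` shows that its value at `1` is
`⟪ℓ, F⟫` for a fixed vector `ℓ` (`traceVector`, `hasSecondDerivAtOne_iff`).  The multiplier `m v_x`
with `m = (2x-1)²` on `[1/2, 1]` and `m = 0` on `[0, 1/2]` avoids the degenerate endpoint and yields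
the hidden regularity `∫₀ᴿ ⟪ℓ, S(t) Y⟫² dt ≤ C ‖B Y‖²` (`isAdmissible_traceVector`).  Therefore the
boundary trace exists as an `L²` limit.

By duality (the Hahn-Banach and Riesz theorems) the same estimate puts the integrals
`-∫₀ᵗ f(τ) S(-τ) ℓ dτ` into the range of `B`, with continuous preimages `z(t)`
(`IsUnitaryGroup.exists_input_response`), and `⟪S(T) z(T), V_T⟫ = ∫₀ᵀ f(t) v_xx(t,1) dt`.  If `y₀`
represents the functional `(p, q) ↦ ⟨u₁, p⟩ - ∫ u₀ q / a`, then `y(t) = S(t)(y₀ - z(t))` represents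
the right-hand side of the transposition identity, as a functional of the data at time `t`.  So
`u = -y₂` and `u_t = y₁` is the only possible choice.  That `y₁` is the derivative of `-y₂` in
`(H²_{1/a})*` follows from the first component of the integrated equation
`B y(t) = B y₀ + ∫₀ᵗ y + (∫₀ᵗ f) ℓ`, because the first component of `ℓ` is zero.
-/

namespace DegenerateBeam

/-! ### The unitary group generated by the inverse of a skew-adjoint operator -/

section UnitaryGroup

open ContinuousLinearMap

variable {X : Type*} [NormedAddCommGroup X] [InnerProductSpace ℝ X]

/-- `S` is the strongly continuous group of isometries whose generator is `B⁻¹`, described through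
`B` alone. -/
structure IsUnitaryGroup (B : X →L[ℝ] X) (S : ℝ → X →L[ℝ] X) : Prop where
  zero : S 0 = 1
  add : ∀ s t, S (s + t) = S s * S t
  norm_apply : ∀ t x, ‖S t x‖ = ‖x‖
  continuous : ∀ x, Continuous fun t => S t x
  commute : ∀ t x, B (S t x) = S t (B x)
  integral : ∀ t x, B (S t x - x) = ∫ s in (0 : ℝ)..t, S s x

namespace IsUnitaryGroup

variable {B : X →L[ℝ] X} {S : ℝ → X →L[ℝ] X}

theorem neg_apply_apply (hS : IsUnitaryGroup B S) (t : ℝ) (x : X) : S (-t) (S t x) = x := by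
  rw [← mul_apply_eq_comp, ← hS.add, neg_add_cancel, hS.zero, one_apply_eq_self]

theorem apply_neg_apply (hS : IsUnitaryGroup B S) (t : ℝ) (x : X) : S t (S (-t) x) = x := by
  simpa using hS.neg_apply_apply (-t) x

theorem inner_apply_right (hS : IsUnitaryGroup B S) (t : ℝ) (x y : X) :
    inner ℝ x (S t y) = inner ℝ (S (-t) x) y := by
  have h : ∀ x y, inner ℝ (S t x) (S t y) = inner ℝ x y := fun x y => by
    rw [real_inner_eq_norm_add_mul_self_sub_norm_mul_self_sub_norm_mul_self_div_two,
      real_inner_eq_norm_add_mul_self_sub_norm_mul_self_sub_norm_mul_self_div_two,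
      ← map_add, hS.norm_apply, hS.norm_apply, hS.norm_apply]
  rw [← h (S (-t) x) y, hS.apply_neg_apply]

/-- Joint continuity of the group, along a path. -/
theorem continuousOn_comp (hS : IsUnitaryGroup B S) {s : Set ℝ} {τ : ℝ → ℝ} {z : ℝ → X}
    (hτ : ContinuousOn τ s) (hz : ContinuousOn z s) : ContinuousOn (fun t => S (τ t) (z t)) s := by
  intro t ht
  have h1 : Tendsto (fun r => S (τ r) (z t)) (𝓝[s] t) (𝓝 (S (τ t) (z t))) :=
    ((hS.continuous (z t)).tendsto _).comp (hτ t ht)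
  have h2 : Tendsto (fun r => S (τ r) (z r - z t)) (𝓝[s] t) (𝓝 0) := by
    rw [tendsto_zero_iff_norm_tendsto_zero]
    simp_rw [hS.norm_apply]
    have : Tendsto z (𝓝[s] t) (𝓝 (z t)) := hz t ht
    simpa using (this.sub_const (z t)).norm
  simpa [ContinuousWithinAt] using h1.add h2

theorem continuous_neg_apply (hS : IsUnitaryGroup B S) (x : X) : Continuous fun t => S (-t) x :=
  (hS.continuous x).comp continuous_neg

theorem integral_translate (hS : IsUnitaryGroup B S) (x : X) (T t : ℝ) :
    B (S (t - T) x - x) = ∫ s in T..t, S (s - T) x := by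
  rw [intervalIntegral.integral_comp_sub_right (fun s => S s x), sub_self, hS.integral]

end IsUnitaryGroup

variable [CompleteSpace X]

/-- The orthogonal complement of the range of a skew-adjoint operator is its kernel. -/
theorem denseRange_of_skew {B : X →L[ℝ] X} (hB : adjoint B = -B) (hi : Function.Injective B) :
    DenseRange B := by
  have h : (LinearMap.range (B : X →ₗ[ℝ] X)).topologicalClosure = ⊤ := by
    rw [Submodule.topologicalClosure_eq_top_iff, Submodule.eq_bot_iff]
    intro x hx
    have : B x = 0 := by
      rw [← inner_self_eq_zero (𝕜 := ℝ)]
      have h1 := hx (B (B x)) ⟨B x, rfl⟩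
      have h2 : inner ℝ (B (B x)) x = inner ℝ (B x) (adjoint B x) :=
        (adjoint_inner_right B _ _).symm
      rw [hB, h1] at h2
      simpa using h2.symm
    exact hi (by simpa using this)
  intro x
  have : x ∈ (LinearMap.range (B : X →ₗ[ℝ] X)).topologicalClosure := h ▸ Submodule.mem_top
  rw [← SetLike.mem_coe, Submodule.topologicalClosure_coe] at this
  exact this

theorem norm_exp_apply_of_skew {D : X →L[ℝ] X} (hD : D ∈ skewAdjoint (X →L[ℝ] X)) (t : ℝ) (x : X) :
    ‖NormedSpace.exp (t • D) x‖ = ‖x‖ := by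
  have h : t • D ∈ skewAdjoint (X →L[ℝ] X) := skewAdjoint.smul_mem t hD
  let := NormedAlgebra.restrictScalars ℚ ℝ (X →L[ℝ] X)
  have h1 := NormedSpace.exp_mem_unitary_of_mem_skewAdjoint h
  exact ContinuousLinearMap.norm_map_of_mem_unitary h1 x

theorem norm_exp_sub_le_of_skew {D : X →L[ℝ] X} (hD : D ∈ skewAdjoint (X →L[ℝ] X)) (t : ℝ)
    (x : X) : ‖NormedSpace.exp (t • D) x - x‖ ≤ |t| * ‖D x‖ := by
  have hd : ∀ s : ℝ, HasDerivAt (fun s : ℝ => NormedSpace.exp (s • D) x)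
      (NormedSpace.exp (s • D) (D x)) s := fun s => by
    have := (hasDerivAt_exp_smul_const D s).clm_apply (hasDerivAt_const s x)
    simpa using this
  have := Convex.norm_image_sub_le_of_norm_hasDerivWithin_le (s := univ) (x := 0) (y := t)
    (C := ‖D x‖) (fun s _ => (hd s).hasDerivWithinAt)
    (fun s _ => (norm_exp_apply_of_skew hD s _).le) convex_univ (mem_univ _) (mem_univ _)
  simpa [mul_comm] using this

/-- If `‖B‖ ≤ 1`, then `1 - B†B` is a firmly nonexpansive self-adjoint operator. -/
theorem norm_one_sub_adjoint_mul_self {B : X →L[ℝ] X} (h1 : ‖B‖ ≤ 1) (x : X) :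
    ‖x - (1 - adjoint B * B) x‖ ^ 2 ≤ ‖x‖ ^ 2 - ‖(1 - adjoint B * B) x‖ ^ 2 := by
  set y := adjoint B (B x) with hy
  have e : (1 - adjoint B * B) x = x - y := by simp [hy]
  have h2 : inner ℝ x y = ‖B x‖ ^ 2 := by
    rw [hy, adjoint_inner_right, real_inner_self_eq_norm_sq]
  have h3 : ‖y‖ ≤ ‖B x‖ := by
    calc ‖y‖ ≤ ‖adjoint B‖ * ‖B x‖ := le_opNorm _ _
      _ ≤ 1 * ‖B x‖ := by gcongr; simpa using h1
      _ = _ := one_mul _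
  have h4 : ‖y‖ ^ 2 ≤ ‖B x‖ ^ 2 := by gcongr
  rw [e, sub_sub_cancel, norm_sub_sq_real, h2]
  linarith

theorem norm_pow_one_sub_le {B : X →L[ℝ] X} (h1 : ‖B‖ ≤ 1) (n : ℕ) (x : X) :
    ‖((1 - adjoint B * B) ^ n) x‖ ≤ ‖x‖ := by
  induction n with
  | zero => simp
  | succ n ih =>
    refine le_trans ?_ ih
    rw [pow_succ', mul_apply_eq_comp]
    have := norm_one_sub_adjoint_mul_self h1 (((1 - adjoint B * B) ^ n) x)
    refine le_of_sq_le_sq ?_ (norm_nonneg _)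
    nlinarith [sq_nonneg ‖((1 - adjoint B * B) ^ n) x -
      (1 - adjoint B * B) (((1 - adjoint B * B) ^ n) x)‖]

theorem tendsto_zero_of_denseRange {X : Type*} [NormedAddCommGroup X] [NormedSpace ℝ X]
    {f : ℕ → X →L[ℝ] X} {D : X →L[ℝ] X} {c : ℝ}
    (hc : ∀ n x, ‖f n x‖ ≤ c * ‖x‖) (hD : DenseRange D)
    (h : ∀ z, Tendsto (fun n => f n (D z)) atTop (𝓝 0)) (x : X) :
    Tendsto (fun n => f n x) atTop (𝓝 0) := by
  rw [Metric.tendsto_atTop]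
  intro ε hε
  have hc0 : 0 < |c| + 1 := by positivity
  obtain ⟨z, hz⟩ := hD.exists_dist_lt x (show 0 < ε / (2 * (|c| + 1)) by positivity)
  obtain ⟨N, hN⟩ := Metric.tendsto_atTop.1 (h z) (ε / 2) (by positivity)
  refine ⟨N, fun n hn => ?_⟩
  have h1 := hN n hn
  rw [dist_zero_right] at h1 ⊢
  rw [dist_eq_norm, lt_div_iff₀ (by positivity)] at hz
  have h2 := hc n (x - D z)
  have h3 : f n x = f n (x - D z) + f n (D z) := by rw [map_sub, sub_add_cancel]
  have h4 : c * ‖x - D z‖ ≤ (|c| + 1) * ‖x - D z‖ := by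
    gcongr
    linarith [le_abs_self c]
  rw [h3]
  have h5 := norm_add_le (f n (x - D z)) (f n (D z))
  linarith

/-- Powers of a firmly nonexpansive operator `T` converge strongly to `0` when `1 - T` has dense
range: `‖Tⁿz‖²` decreases, and `‖Tⁿz - Tⁿ⁺¹z‖²` is at most its decrement. -/
theorem tendsto_pow_one_sub {B : X →L[ℝ] X} (h1 : ‖B‖ ≤ 1) (hd : DenseRange (adjoint B * B))
    (x : X) : Tendsto (fun n : ℕ => ((1 - adjoint B * B) ^ n) x) atTop (𝓝 0) := by
  refine tendsto_zero_of_denseRange (f := fun n => (1 - adjoint B * B) ^ n) (c := 1)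
    (fun n x => ?_) hd (fun z => ?_) x
  · simpa using norm_pow_one_sub_le h1 n x
  set T := 1 - adjoint B * B with hT
  have e : ∀ n, (T ^ n) ((adjoint B * B) z) = (T ^ n) z - T ((T ^ n) z) := fun n => by
    have : adjoint B * B = 1 - T := by simp [hT]
    rw [this, ← mul_apply_eq_comp T, ← pow_succ', pow_succ]
    simp
  have hmono : Antitone fun n => ‖(T ^ n) z‖ ^ 2 := antitone_nat_of_succ_le fun n => by
    have := norm_one_sub_adjoint_mul_self h1 ((T ^ n) z)
    rw [pow_succ' T, mul_apply_eq_comp]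
    nlinarith [sq_nonneg ‖(T ^ n) z - T ((T ^ n) z)‖]
  obtain ⟨l, hl⟩ : ∃ l, Tendsto (fun n => ‖(T ^ n) z‖ ^ 2) atTop (𝓝 l) :=
    ⟨_, tendsto_atTop_ciInf hmono ⟨0, by rintro _ ⟨n, rfl⟩; positivity⟩⟩
  have hdiff : Tendsto (fun n => ‖(T ^ n) z‖ ^ 2 - ‖(T ^ (n + 1)) z‖ ^ 2) atTop (𝓝 0) := by
    simpa using hl.sub (hl.comp (tendsto_add_atTop_nat 1))
  have hsq : Tendsto (fun n => ‖(T ^ n) z - T ((T ^ n) z)‖ ^ 2) atTop (𝓝 0) :=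
    squeeze_zero (fun _ => sq_nonneg _) (fun n => by
      rw [pow_succ' T, mul_apply_eq_comp]
      exact norm_one_sub_adjoint_mul_self h1 ((T ^ n) z)) hdiff
  simp_rw [e]
  rw [tendsto_zero_iff_norm_tendsto_zero]
  have := hsq.sqrt
  simpa [Real.sqrt_sq] using this

/-- Bounded skew-adjoint approximations of `B⁻¹`: with `T = 1 - R` and `R = -c²B²`, they are
`-c² B (1 + T + ⋯ + Tⁿ⁻¹)`, and `B` times this is `1 - Tⁿ`. -/
theorem exists_skew_approx_inverse {B : X →L[ℝ] X} (hB : adjoint B = -B)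
    (hi : Function.Injective B) :
    ∃ A : ℕ → X →L[ℝ] X, (∀ n, A n ∈ skewAdjoint (X →L[ℝ] X)) ∧ (∀ n m, Commute (A n) (A m)) ∧
      (∀ n, Commute (A n) B) ∧ (∀ n x, ‖B (A n x)‖ ≤ 2 * ‖x‖) ∧
      ∀ x, Tendsto (fun n => B (A n x)) atTop (𝓝 x) := by
  -- rescale `B` to a contraction `B₁`, so that `R = B₁† B₁` satisfies `0 ≤ R ≤ 1`
  set c : ℝ := (‖B‖ + 1)⁻¹ with hc
  have hc0 : 0 < c := by positivity
  set B₁ := c • B with hB₁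
  have h1 : ‖B₁‖ ≤ 1 := by
    rw [hB₁, norm_smul, Real.norm_of_nonneg hc0.le, hc, inv_mul_le_iff₀ (by positivity)]
    linarith
  have hadj : adjoint B₁ = -B₁ := by
    rw [hB₁, map_smulₛₗ, hB]
    simp
  have hi₁ : Function.Injective B₁ := fun x y h => by
    refine hi (smul_right_injective X hc0.ne' ?_)
    simpa [hB₁] using h
  have hden : DenseRange (adjoint B₁ * B₁) := by
    have h := denseRange_of_skew hadj hi₁
    have h2 : DenseRange (adjoint B₁) := by
      have : adjoint B₁ = B₁ ∘L (-1) := by rw [hadj]; ext; simp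
      rw [this]
      exact h.comp (Function.Surjective.denseRange fun x => ⟨-x, by simp⟩) B₁.continuous
    exact h2.comp h (adjoint B₁).continuous
  set T := 1 - adjoint B₁ * B₁ with hT
  have hTB : Commute T B := by
    rw [hT, hadj, hB₁]
    have h := Commute.refl B
    exact (Commute.one_left B).sub_left (((h.smul_left c).neg_left).mul_left (h.smul_left c))
  set q : ℕ → X →L[ℝ] X := fun n => ∑ k ∈ Finset.range n, T ^ k with hq
  have hqB : ∀ n, Commute (q n) B := fun n =>
    Commute.sum_left _ _ _ fun k _ => hTB.pow_left k
  have hqq : ∀ n m, Commute (q n) (q m) := fun n m =>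
    Commute.sum_left _ _ _ fun k _ => Commute.sum_right _ _ _ fun l _ =>
      (Commute.refl T).pow_pow k l
  have hTs : IsSelfAdjoint T := by
    rw [hT]
    exact (IsSelfAdjoint.one _).sub (IsSelfAdjoint.star_mul_self B₁)
  have hqs : ∀ n, IsSelfAdjoint (q n) := fun n => by
    rw [hq]
    exact isSelfAdjoint_sum _ fun k _ => hTs.pow k
  have hBA : ∀ n, B * (-(c ^ 2) • (B * q n)) = 1 - T ^ n := fun n => by
    have h : 1 - T = -(c ^ 2) • (B * B) := by
      rw [hT, sub_sub_cancel, hadj, hB₁, pow_two]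
      simp only [neg_mul, smul_mul_assoc, mul_smul_comm, smul_smul, neg_smul, smul_neg]
    rw [← mul_neg_geom_sum, h, smul_mul_assoc, mul_smul_comm, mul_assoc]
  refine ⟨fun n => -(c ^ 2) • (B * q n), fun n => ?_, fun n m => ?_, fun n => ?_,
    fun n x => ?_, fun x => ?_⟩
  · refine skewAdjoint.smul_mem _ ?_
    rw [skewAdjoint.mem_iff, star_mul, (hqs n).star_eq, star_eq_adjoint, hB, mul_neg, (hqB n).eq]
  · refine Commute.smul_left (Commute.smul_right ?_ _) _
    exact ((Commute.refl B).mul_right (hqB m).symm).mul_left ((hqB n).mul_right (hqq n m))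
  · exact Commute.smul_left ((Commute.refl B).mul_left (hqB n)) _
  · rw [← mul_apply_eq_comp, hBA, _root_.sub_apply, one_apply_eq_self]
    calc ‖x - (T ^ n) x‖ ≤ ‖x‖ + ‖(T ^ n) x‖ := norm_sub_le _ _
      _ ≤ ‖x‖ + ‖x‖ := by gcongr; exact norm_pow_one_sub_le h1 n x
      _ = _ := (two_mul _).symm
  · have := (tendsto_pow_one_sub h1 hden x).const_sub x
    simp_rw [← mul_apply_eq_comp, hBA, _root_.sub_apply, one_apply_eq_self]
    rwa [sub_zero] at this

/-- The group is the strong limit of `exp (t A n)`, with the approximations `A n` of `B⁻¹` from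
`exists_skew_approx_inverse`.  These exponentials are isometries, so it suffices to have convergence
on the range of `B`, where `exp (t A n) (B y)` and `exp (t A m) (B y)` differ by at most
`|t| ‖A n B y - A m B y‖`, and `A n B y → y`. -/
theorem exists_isUnitaryGroup {B : X →L[ℝ] X} (hB : adjoint B = -B)
    (hi : Function.Injective B) : ∃ S, IsUnitaryGroup B S := by
  obtain ⟨A, hA, hcomm, hAB, hbd, hlim⟩ := exists_skew_approx_inverse hB hi
  have hd := denseRange_of_skew hB hi
  let := NormedAlgebra.restrictScalars ℚ ℝ (X →L[ℝ] X)
  set E : ℕ → ℝ → X →L[ℝ] X := fun n t => NormedSpace.exp (t • A n) with hE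
  have hEn : ∀ n t x, ‖E n t x‖ = ‖x‖ := fun n t x => norm_exp_apply_of_skew (hA n) t x
  have hEadd : ∀ n s t, E n (s + t) = E n s * E n t := fun n s t => by
    rw [hE]
    simp only [add_smul]
    exact NormedSpace.exp_add_of_commute ((Commute.refl (A n)).smul_left s |>.smul_right t)
  have hEB : ∀ n t, Commute (E n t) B := fun n t => ((hAB n).smul_left t).exp_left
  have hAB' : ∀ n y, A n (B y) = B (A n y) := fun n y => DFunLike.congr_fun (hAB n).eq y
  have hdiff : ∀ n m t y, ‖E n t (B y) - E m t (B y)‖ ≤ |t| * ‖B (A n y) - B (A m y)‖ := by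
    intro n m t y
    have hs : A n - A m ∈ skewAdjoint (X →L[ℝ] X) := sub_mem (hA n) (hA m)
    have e : E n t = E m t * NormedSpace.exp (t • (A n - A m)) := by
      rw [hE]
      simp only
      rw [← NormedSpace.exp_add_of_commute, ← smul_add, add_sub_cancel]
      exact (((hcomm m n).sub_right (Commute.refl _)).smul_left t).smul_right t
    rw [e, mul_apply_eq_comp, ← map_sub, hEn]
    refine (norm_exp_sub_le_of_skew hs t (B y)).trans_eq ?_
    rw [_root_.sub_apply, hAB', hAB']
  have hcau : ∀ t x, CauchySeq fun n => E n t x := by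
    intro t x
    rw [Metric.cauchySeq_iff]
    intro ε hε
    obtain ⟨y, hy⟩ := hd.exists_dist_lt x (show 0 < ε / 3 by positivity)
    obtain ⟨N, hN⟩ := Metric.cauchySeq_iff.1 (hlim y).cauchySeq (ε / (3 * (|t| + 1)))
      (by positivity)
    refine ⟨N, fun n hn m hm => ?_⟩
    have h1 := hN n hn m hm
    rw [dist_eq_norm, lt_div_iff₀ (by positivity)] at h1
    have h2 := hdiff n m t y
    have h3 : E n t x - E m t x = E n t (x - B y) + (E n t (B y) - E m t (B y)) -
        E m t (x - B y) := by
      simp only [map_sub]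
      abel
    rw [dist_eq_norm] at hy ⊢
    rw [h3]
    have h4 := norm_sub_le (E n t (x - B y) + (E n t (B y) - E m t (B y))) (E m t (x - B y))
    have h5 := norm_add_le (E n t (x - B y)) (E n t (B y) - E m t (B y))
    rw [hEn] at h4 h5
    nlinarith [norm_nonneg (B (A n y) - B (A m y))]
  choose l hl using fun t x => cauchySeq_tendsto_of_complete (hcau t x)
  set S : ℝ → X →L[ℝ] X := fun t =>
    continuousLinearMapOfTendsto (f := l t) (fun n => E n t) (tendsto_pi_nhds.2 (hl t)) with hS
  have hSl : ∀ t x, Tendsto (fun n => E n t x) atTop (𝓝 (S t x)) := hl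
  have hSn : ∀ t x, ‖S t x‖ = ‖x‖ := fun t x =>
    tendsto_nhds_unique (hSl t x).norm (by simp [hEn])
  have hE2 : ∀ t x (y : ℕ → X), Tendsto y atTop (𝓝 x) →
      Tendsto (fun n => E n t (y n)) atTop (𝓝 (S t x)) := by
    intro t x y hy
    have h0 : Tendsto (fun n => E n t (y n - x)) atTop (𝓝 0) := by
      rw [tendsto_zero_iff_norm_tendsto_zero]
      simp_rw [hEn]
      simpa using (hy.sub_const x).norm
    simpa using h0.add (hSl t x)
  have hadd : ∀ s t, S (s + t) = S s * S t := by
    intro s t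
    ext x
    refine tendsto_nhds_unique (hSl (s + t) x) ?_
    simp_rw [hEadd]
    exact hE2 s _ _ (hSl t x)
  have hzero : S 0 = 1 := by
    ext x
    refine tendsto_nhds_unique (hSl 0 x) ?_
    simp [hE]
  have hcom : ∀ t x, B (S t x) = S t (B x) := fun t x =>
    tendsto_nhds_unique ((B.continuous.tendsto _).comp (hSl t x))
      ((hSl t (B x)).congr fun n => DFunLike.congr_fun (hEB n t).eq x)
  have hlip : ∀ t y, ‖S t (B y) - B y‖ ≤ |t| * ‖y‖ := by
    intro t y
    refine le_of_tendsto_of_tendsto ((hSl t (B y)).sub_const (B y)).norm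
      (((hlim y).norm).const_mul |t|) (Eventually.of_forall fun n => ?_)
    simp only [← hAB']
    exact norm_exp_sub_le_of_skew (hA n) t (B y)
  have hcont : ∀ x, Continuous fun t => S t x := by
    intro x
    have h0 : Tendsto (fun t => S t x) (𝓝 0) (𝓝 x) := by
      rw [Metric.tendsto_nhds]
      intro ε hε
      obtain ⟨y, hy⟩ := hd.exists_dist_lt x (show 0 < ε / 3 by positivity)
      have : Tendsto (fun t : ℝ => |t| * ‖y‖) (𝓝 0) (𝓝 0) := by
        have : Continuous fun t : ℝ => |t| * ‖y‖ := by fun_prop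
        simpa using this.tendsto 0
      filter_upwards [this.eventually (gt_mem_nhds (show 0 < ε / 3 by positivity))] with t ht
      have h1 := hlip t y
      have h3 : S t x - x = S t (x - B y) + (S t (B y) - B y) - (x - B y) := by
        simp only [map_sub]
        abel
      rw [dist_eq_norm] at hy ⊢
      rw [h3]
      have h4 := norm_sub_le (S t (x - B y) + (S t (B y) - B y)) (x - B y)
      have h5 := norm_add_le (S t (x - B y)) (S t (B y) - B y)
      rw [hSn] at h5
      linarith
    rw [continuous_iff_continuousAt]
    intro t
    have h1 : Tendsto (fun s => S t (S (s - t) x)) (𝓝 t) (𝓝 (S t x)) :=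
      ((S t).continuous.tendsto x).comp
        (h0.comp (by simpa using (continuous_sub_right t).tendsto t))
    refine h1.congr fun s => ?_
    rw [← mul_apply_eq_comp, ← hadd, add_sub_cancel]
  refine ⟨S, hzero, hadd, hSn, hcont, hcom, fun t x => ?_⟩
  -- integrate `d/dt E n t x = E n t (A n x)` and pass to the limit after applying `B`
  have hder : ∀ n s, HasDerivAt (fun s => B (E n s x)) (E n s (B (A n x))) s := fun n s => by
    have h := (hasDerivAt_exp_smul_const (A n) s).clm_apply (hasDerivAt_const s x)
    have h2 := B.hasFDerivAt.comp_hasDerivAt s h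
    refine h2.congr_deriv ?_
    have := DFunLike.congr_fun (hEB n s).eq (A n x)
    simpa using this.symm
  have hEc : ∀ n y, Continuous fun s => E n s y := fun n y =>
    continuous_iff_continuousAt.2 fun s =>
      ((hasDerivAt_exp_smul_const (A n) s).clm_apply (hasDerivAt_const s y)).continuousAt
  have hint : ∀ n, ∫ s in (0 : ℝ)..t, E n s (B (A n x)) = B (E n t x) - B x := fun n => by
    rw [intervalIntegral.integral_eq_sub_of_hasDerivAt (fun s _ => hder n s)
      ((hEc n _).intervalIntegrable _ _)]
    simp [hE]
  have hleft : Tendsto (fun n => B (E n t x) - B x) atTop (𝓝 (B (S t x - x))) := by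
    rw [map_sub]
    exact ((B.continuous.tendsto _).comp (hSl t x)).sub_const _
  refine tendsto_nhds_unique hleft ?_
  simp_rw [← hint]
  refine intervalIntegral.tendsto_integral_filter_of_dominated_convergence (fun _ => 2 * ‖x‖)
    (Eventually.of_forall fun n => (hEc n _).aestronglyMeasurable)
    (Eventually.of_forall fun n => Eventually.of_forall fun s _ => ?_)
    intervalIntegrable_const (Eventually.of_forall fun s _ => hE2 s x _ (hlim x))
  rw [hEn]
  exact hbd n x

namespace IsUnitaryGroup

variable {B : X →L[ℝ] X} {S : ℝ → X →L[ℝ] X}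

/-- The range of `B` is the domain of the generator. -/
theorem hasDerivAt (hS : IsUnitaryGroup B S) (x : X) (t : ℝ) :
    HasDerivAt (fun s => S s (B x)) (S t x) t := by
  have e : (fun s => S s (B x)) = fun s => B x + ∫ r in (0 : ℝ)..s, S r x := by
    ext s
    rw [← hS.integral, map_sub, ← hS.commute]
    abel
  rw [e]
  exact ((hS.continuous x).integral_hasStrictDerivAt 0 t).hasDerivAt.const_add _

/-- A mild solution is the orbit of its value at time `T`: if `W` is the difference of the two and
`Z = ∫ W = B W`, then `Z' = W` is orthogonal to `Z`. -/
theorem eq_of_mild (hS : IsUnitaryGroup B S) (hB : adjoint B = -B) (hi : Function.Injective B)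
    {T : ℝ} (hT : 0 ≤ T) {x : X} {V : ℝ → X} (hV : ContinuousOn V (Ici 0))
    (h : ∀ t, 0 ≤ t → B (V t - x) = ∫ s in T..t, V s) {t : ℝ} (ht : 0 ≤ t) :
    V t = S (t - T) x := by
  set W : ℝ → X := fun s => V (max s 0) - S (max s 0 - T) x with hW
  have hWc : Continuous W := by
    refine Continuous.sub ?_ ((hS.continuous x).comp (by fun_prop))
    exact hV.comp_continuous (by fun_prop) fun s => mem_Ici.2 (le_max_right _ _)
  set Z : ℝ → X := fun s => ∫ r in T..s, W r with hZ
  have hZd : ∀ s, HasDerivAt Z (W s) s := fun s =>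
    (hWc.integral_hasStrictDerivAt T s).hasDerivAt
  have hBW : ∀ s, 0 ≤ s → B (W s) = Z s := by
    intro s hs
    have h1 : Z s = (∫ r in T..s, V r) - ∫ r in T..s, S (r - T) x := by
      have hsub : uIcc T s ⊆ Ici 0 := fun r hr => (le_min hT hs).trans hr.1
      have hc : Continuous fun r => S (r - T) x := (hS.continuous x).comp (continuous_sub_right T)
      rw [← intervalIntegral.integral_sub ((hV.mono hsub).intervalIntegrable)
        (hc.intervalIntegrable _ _)]
      refine intervalIntegral.integral_congr fun r hr => ?_
      simp [hW, max_eq_left (mem_Ici.1 (hsub hr))]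
    rw [h1, ← h s hs, ← hS.integral_translate, hW]
    simp [max_eq_left hs]
  have horth : ∀ y, inner ℝ (B y) y = 0 := fun y => by
    have h1 : inner ℝ (B y) y = inner ℝ y (adjoint B y) := (adjoint_inner_right B _ _).symm
    rw [hB, _root_.neg_apply, inner_neg_right] at h1
    linarith [real_inner_comm y (B y)]
  have hconst : ∀ s, 0 ≤ s → ‖Z s‖ ^ 2 = ‖Z 0‖ ^ 2 := fun s hs =>
    constant_of_has_deriv_right_zero (f := fun s => ‖Z s‖ ^ 2) (a := 0) (b := s)
      (fun r _ => ((hZd r).norm_sq).continuousAt.continuousWithinAt)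
      (fun r hr => by
        have := (hZd r).norm_sq.hasDerivWithinAt (s := Ici r)
        rwa [← hBW r hr.1, horth, mul_zero] at this) s ⟨hs, le_rfl⟩
  have hZT : Z T = 0 := intervalIntegral.integral_same
  have hZt : Z t = 0 := by
    have := hconst t ht
    rw [← hconst T hT, hZT] at this
    simpa using this
  have : W t = 0 := hi (by rw [hBW t ht, hZt, map_zero])
  rw [hW] at this
  simpa [max_eq_left ht, sub_eq_zero] using this

end IsUnitaryGroup

end UnitaryGroup

/-! ### Integration lemmas -/

theorem inner_toLp_toLp {α : Type*} [MeasurableSpace α] {μ : Measure α} {f g : α → ℝ}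
    (hf : MemLp f 2 μ) (hg : MemLp g 2 μ) :
    inner ℝ (hf.toLp f) (hg.toLp g) = ∫ x, f x * g x ∂μ := by
  rw [L2.inner_def]
  refine integral_congr_ae ?_
  filter_upwards [hf.coeFn_toLp, hg.coeFn_toLp] with x h1 h2
  rw [h1, h2, RCLike.inner_apply, conj_trivial, mul_comm]

theorem sq_integral_mul_le {α : Type*} [MeasurableSpace α] {μ : Measure α} {f g : α → ℝ}
    (hf : MemLp f 2 μ) (hg : MemLp g 2 μ) :
    (∫ x, f x * g x ∂μ) ^ 2 ≤ (∫ x, f x ^ 2 ∂μ) * ∫ x, g x ^ 2 ∂μ := by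
  have := real_inner_mul_inner_self_le (hf.toLp f) (hg.toLp g)
  rw [inner_toLp_toLp, inner_toLp_toLp, inner_toLp_toLp] at this
  simpa [pow_two] using this

theorem norm_toLp_sq {α : Type*} [MeasurableSpace α] {μ : Measure α} {f : α → ℝ}
    (hf : MemLp f 2 μ) : ‖hf.toLp f‖ ^ 2 = ∫ x, f x ^ 2 ∂μ := by
  simp_rw [← real_inner_self_eq_norm_sq, inner_toLp_toLp, pow_two]

/-- Fubini's theorem on the triangle `a < x ≤ y ≤ b`. -/
theorem integral_triangle_swap {E : Type*} [NormedAddCommGroup E] [NormedSpace ℝ E]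
    {F : ℝ → ℝ → E} {a b : ℝ} (hab : a ≤ b)
    (hF : Integrable ({p : ℝ × ℝ | p.1 ≤ p.2}.indicator (Function.uncurry F))
      ((volume.restrict (Ioc a b)).prod (volume.restrict (Ioc a b)))) :
    ∫ x in a..b, ∫ y in x..b, F x y = ∫ y in a..b, ∫ x in a..y, F x y := by
  have h := integral_integral_swap
    (f := fun x y => {p : ℝ × ℝ | p.1 ≤ p.2}.indicator (Function.uncurry F) (x, y)) hF
  rw [intervalIntegral.integral_of_le hab, intervalIntegral.integral_of_le hab]
  refine Eq.trans (setIntegral_congr_fun measurableSet_Ioc fun x hx => ?_)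
    (h.trans (setIntegral_congr_fun measurableSet_Ioc fun y hy => ?_))
  · have e : (fun y => {p : ℝ × ℝ | p.1 ≤ p.2}.indicator (Function.uncurry F) (x, y)) =
        (Ici x).indicator (F x) := by
      ext y
      simp [indicator, Function.uncurry]
    simp only [e]
    rw [setIntegral_indicator measurableSet_Ici, intervalIntegral.integral_of_le hx.2,
      ← integral_Icc_eq_integral_Ioc]
    congr 2
    ext y
    simp only [mem_inter_iff, mem_Ioc, mem_Ici, mem_Icc]
    exact ⟨fun h => ⟨⟨hx.1.trans_le h.1, h.2⟩, h.1⟩, fun h => ⟨h.2, h.1.2⟩⟩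
  · have e : (fun x => {p : ℝ × ℝ | p.1 ≤ p.2}.indicator (Function.uncurry F) (x, y)) =
        (Iic y).indicator (fun x => F x y) := by
      ext x
      simp [indicator, Function.uncurry]
    simp only [e]
    rw [setIntegral_indicator measurableSet_Iic, intervalIntegral.integral_of_le hy.1.le]
    congr 2
    ext x
    simp only [mem_inter_iff, mem_Ioc, mem_Iic]
    exact ⟨fun h => ⟨h.1.1, h.2⟩, fun h => ⟨⟨h.1, h.2.trans hy.2⟩, h.2⟩⟩

theorem MemLp.intervalIntegrable_of_Ioo {f : ℝ → ℝ} {T : ℝ} (hT : 0 ≤ T)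
    (hf : MemLp f 2 (volume.restrict (Ioo 0 T))) : IntervalIntegrable f volume 0 T := by
  rw [intervalIntegrable_iff_integrableOn_Ioo_of_le hT]
  exact hf.integrable (by norm_num)

/-! ### An admissible input for the unitary group -/

section Input

open ContinuousLinearMap

variable {X : Type*} [NormedAddCommGroup X] [InnerProductSpace ℝ X] [CompleteSpace X]
  {B : X →L[ℝ] X} {S : ℝ → X →L[ℝ] X}

theorem inner_apply_of_skew (hB : adjoint B = -B) (x y : X) :
    inner ℝ (B x) y = -inner ℝ x (B y) := by
  rw [← adjoint_inner_right, hB, _root_.neg_apply, inner_neg_right]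

/-- By the Hahn-Banach and Riesz theorems, an estimate against `‖B Y‖` puts a vector into the range
of the skew-adjoint operator `B`. -/
theorem exists_apply_eq_of_abs_inner_le (hB : adjoint B = -B) (hi : Function.Injective B)
    {v : X} {K : ℝ} (hK : 0 ≤ K) (h : ∀ Y, |inner ℝ v Y| ≤ K * ‖B Y‖) :
    ∃ u, B u = v ∧ ‖u‖ ≤ K := by
  let e := LinearEquiv.ofInjective (B : X →ₗ[ℝ] X) hi
  let φ : StrongDual ℝ (LinearMap.range (B : X →ₗ[ℝ] X)) :=
    ((innerSL ℝ v : X →ₗ[ℝ] ℝ) ∘ₗ (e.symm : _ →ₗ[ℝ] X)).mkContinuous K fun y => by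
      have h1 := h (e.symm y)
      have h2 : B (e.symm y) = y := LinearEquiv.ofInjective_symm_apply (B : X →ₗ[ℝ] X) y
      rw [h2] at h1
      simpa using h1
  obtain ⟨g, hg, hgn⟩ := exists_extension_norm_eq _ φ
  refine ⟨-(InnerProductSpace.toDual ℝ X).symm g, ?_, ?_⟩
  · refine ext_inner_right ℝ fun Y => ?_
    have h1 := hg (e Y)
    have h2 : φ (e Y) = inner ℝ v Y := by
      simp [φ]
    rw [h2] at h1
    rw [inner_apply_of_skew hB, inner_neg_left, neg_neg, InnerProductSpace.toDual_symm_apply]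
    exact h1
  · rw [norm_neg, LinearIsometryEquiv.norm_map, hgn]
    exact LinearMap.mkContinuous_norm_le _ hK _

/-- The observation `⟪ℓ, S(t) Y⟫` of the orbit of `B Y` is controlled in `L²(0,R)` by `‖B Y‖`. -/
def IsAdmissible (B : X →L[ℝ] X) (S : ℝ → X →L[ℝ] X) (ℓ : X) : Prop :=
  ∀ R : ℝ, 0 < R → ∃ C : ℝ, 0 ≤ C ∧
    ∀ Y, ∫ t in (0 : ℝ)..R, inner ℝ ℓ (S t Y) ^ 2 ≤ C * ‖B Y‖ ^ 2

variable {ℓ : X} {f : ℝ → ℝ}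

theorem intervalIntegrable_of_memLp (hf : ∀ T : ℝ, 0 < T → MemLp f 2 (volume.restrict (Ioo 0 T)))
    {s t : ℝ} (hs : 0 ≤ s) (ht : 0 ≤ t) : IntervalIntegrable f volume s t := by
  have h : ∀ t, 0 ≤ t → IntervalIntegrable f volume 0 t := fun t ht => by
    rcases ht.eq_or_lt with rfl | ht'
    · exact IntervalIntegrable.refl
    · exact MemLp.intervalIntegrable_of_Ioo ht (hf t ht')
  exact (h s hs).symm.trans (h t ht)

theorem intervalIntegrable_sq_of_memLp
    (hf : ∀ T : ℝ, 0 < T → MemLp f 2 (volume.restrict (Ioo 0 T)))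
    {s t : ℝ} (hs : 0 ≤ s) (ht : 0 ≤ t) : IntervalIntegrable (fun x => f x ^ 2) volume s t := by
  have h : ∀ t, 0 ≤ t → IntervalIntegrable (fun x => f x ^ 2) volume 0 t := fun t ht => by
    rcases ht.eq_or_lt with rfl | ht'
    · exact IntervalIntegrable.refl
    · rw [intervalIntegrable_iff_integrableOn_Ioo_of_le ht]
      exact (hf t ht').integrable_sq
  exact (h s hs).symm.trans (h t ht)

theorem memLp_Ioo_of_continuousOn {E : Type*} [NormedAddCommGroup E] {h : ℝ → E} {s t : ℝ}
    (hh : ContinuousOn h (Icc s t)) :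
    MemLp h 2 (volume.restrict (Ioo s t)) := by
  obtain ⟨C, hC⟩ := isCompact_Icc.exists_bound_of_continuousOn hh
  refine MemLp.of_bound ((hh.mono Ioo_subset_Icc_self).aestronglyMeasurable measurableSet_Ioo) C ?_
  filter_upwards [ae_restrict_mem measurableSet_Ioo] with x hx
  exact hC x (Ioo_subset_Icc_self hx)

namespace IsUnitaryGroup

theorem inner_integral_smul (hS : IsUnitaryGroup B S)
    (hf : ∀ T : ℝ, 0 < T → MemLp f 2 (volume.restrict (Ioo 0 T))) {s t : ℝ}
    (hs : 0 ≤ s) (ht : 0 ≤ t) (Y : X) :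
    inner ℝ (∫ τ in s..t, f τ • S (-τ) ℓ) Y = ∫ τ in s..t, f τ * inner ℝ ℓ (S τ Y) := by
  have hint : IntervalIntegrable (fun τ => f τ • S (-τ) ℓ) volume s t :=
    (intervalIntegrable_of_memLp hf hs ht).smul_continuousOn
      (hS.continuous_neg_apply ℓ).continuousOn
  have h := (innerSL ℝ Y).intervalIntegral_comp_comm hint
  rw [real_inner_comm]
  refine h.symm.trans (intervalIntegral.integral_congr fun τ _ => ?_)
  simp only [innerSL_apply_apply, inner_smul_right]
  rw [real_inner_comm, hS.inner_apply_right]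

/-- The response to the input `f`, seen in the moving frame: there is a continuous `z` with
`B z(t) = -∫₀ᵗ f(τ) S(-τ) ℓ dτ`. -/
theorem exists_input_response (hS : IsUnitaryGroup B S) (hB : adjoint B = -B)
    (hi : Function.Injective B) (hℓ : IsAdmissible B S ℓ)
    (hf : ∀ T : ℝ, 0 < T → MemLp f 2 (volume.restrict (Ioo 0 T))) :
    ∃ z : ℝ → X, ContinuousOn z (Ici 0) ∧
      ∀ t, 0 ≤ t → B (z t) = -∫ τ in (0 : ℝ)..t, f τ • S (-τ) ℓ := by
  set F : ℝ → ℝ := fun t => ∫ τ in (0 : ℝ)..t, f τ ^ 2 with hF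
  set p : ℝ → X := fun t => ∫ τ in (0 : ℝ)..t, f τ • S (-τ) ℓ with hp
  have hpint : ∀ s t, 0 ≤ s → 0 ≤ t →
      IntervalIntegrable (fun τ => f τ • S (-τ) ℓ) volume s t := fun s t hs ht =>
    (intervalIntegrable_of_memLp hf hs ht).smul_continuousOn
      (hS.continuous_neg_apply ℓ).continuousOn
  -- by Cauchy-Schwarz and admissibility, increments of `p` are in the range of `B`, with preimages
  -- controlled by `∫ f²`; this also gives the continuity of `z`
  have key : ∀ R, 0 < R → ∃ C : ℝ, 0 ≤ C ∧ ∀ s t, 0 ≤ s → s ≤ t → t ≤ R →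
      ∃ u, B u = -(p t - p s) ∧ ‖u‖ ≤ √(C * |F t - F s|) := by
    intro R hR
    obtain ⟨C, hC, hCY⟩ := hℓ R hR
    refine ⟨C, hC, fun s t hs hst htR => ?_⟩
    have ht := hs.trans hst
    have hFd : F t - F s = ∫ τ in s..t, f τ ^ 2 :=
      intervalIntegral.integral_interval_sub_left (intervalIntegrable_sq_of_memLp hf le_rfl ht)
        (intervalIntegrable_sq_of_memLp hf le_rfl hs)
    have hpd : p t - p s = ∫ τ in s..t, f τ • S (-τ) ℓ :=
      intervalIntegral.integral_interval_sub_left (hpint _ _ le_rfl ht) (hpint _ _ le_rfl hs)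
    have hF0 : 0 ≤ F t - F s := by
      rw [hFd]
      exact intervalIntegral.integral_nonneg hst fun _ _ => sq_nonneg _
    refine exists_apply_eq_of_abs_inner_le hB hi (Real.sqrt_nonneg _) fun Y => ?_
    rw [inner_neg_left, abs_neg]
    refine abs_le_of_sq_le_sq ?_ (by positivity)
    have hcont : Continuous fun τ => inner ℝ ℓ (S τ Y) := continuous_const.inner (hS.continuous Y)
    have hm : MemLp f 2 (volume.restrict (Ioo s t)) := by
      refine (hf R hR).mono_measure (Measure.restrict_mono (Ioo_subset_Ioo hs htR) le_rfl)
    have hcs := sq_integral_mul_le hm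
      (memLp_Ioo_of_continuousOn (hcont.continuousOn (s := Icc s t)))
    have hmono : ∫ τ in s..t, inner ℝ ℓ (S τ Y) ^ 2 ≤ C * ‖B Y‖ ^ 2 := by
      refine le_trans ?_ (hCY Y)
      exact intervalIntegral.integral_mono_interval hs hst htR
        (Eventually.of_forall fun _ => sq_nonneg _) ((hcont.pow 2).intervalIntegrable _ _)
    rw [hpd, hS.inner_integral_smul hf hs ht, mul_pow, Real.sq_sqrt (by positivity),
      abs_of_nonneg hF0, hFd]
    simp only [intervalIntegral.integral_of_le hst, integral_Ioc_eq_integral_Ioo] at hmono ⊢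
    refine hcs.trans ?_
    have : 0 ≤ ∫ τ in Ioo s t, f τ ^ 2 := integral_nonneg fun _ => sq_nonneg _
    nlinarith
  have hex : ∀ t, ∃ u, 0 ≤ t → B u = -p t := by
    intro t
    by_cases ht : 0 ≤ t
    · obtain ⟨C, hC, h⟩ := key (t + 1) (by positivity)
      obtain ⟨u, hu, -⟩ := h 0 t le_rfl ht (by linarith)
      refine ⟨u, fun _ => ?_⟩
      rw [hu, hp]
      simp
    · exact ⟨0, fun h => absurd h ht⟩
  choose z hz using hex
  refine ⟨z, fun t₀ ht₀ => ?_, hz⟩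
  have ht₀' : (0 : ℝ) ≤ t₀ := ht₀
  obtain ⟨C, hC, h⟩ := key (t₀ + 1) (by positivity)
  have hle : ∀ s t, 0 ≤ s → s ≤ t → t ≤ t₀ + 1 → ‖z t - z s‖ ≤ √(C * |F t - F s|) := by
    intro s t hs hst ht
    obtain ⟨u, hu, hun⟩ := h s t hs hst ht
    have : z t - z s = u := hi (by
      rw [map_sub, hz t (hs.trans hst), hz s hs, hu]
      abel)
    rwa [this]
  have hFc : ContinuousOn F (Icc 0 (t₀ + 1)) := by
    have := intervalIntegral.continuousOn_primitive_interval (a := 0) (b := t₀ + 1) (μ := volume)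
      (f := fun τ => f τ ^ 2) ?_
    · rwa [uIcc_of_le (by positivity)] at this
    · rw [uIcc_of_le (by positivity), integrableOn_Icc_iff_integrableOn_Ioo]
      exact (hf _ (by positivity)).integrable_sq
  have hmem : Icc 0 (t₀ + 1) ∈ 𝓝[Ici 0] t₀ := by
    rw [← Ici_inter_Iic]
    exact inter_mem self_mem_nhdsWithin (mem_nhdsWithin_of_mem_nhds (Iic_mem_nhds (by linarith)))
  have hlim : Tendsto (fun t => √(C * |F t - F t₀|)) (𝓝[Ici 0] t₀) (𝓝 0) := by
    have h1 : Tendsto F (𝓝[Icc 0 (t₀ + 1)] t₀) (𝓝 (F t₀)) := hFc t₀ ⟨ht₀', by linarith⟩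
    have h2 := (((h1.sub_const (F t₀)).abs.const_mul C).sqrt).mono_left
      (nhdsWithin_le_of_mem hmem)
    simpa using h2
  rw [ContinuousWithinAt, tendsto_iff_norm_sub_tendsto_zero]
  refine squeeze_zero' (Eventually.of_forall fun _ => norm_nonneg _) ?_ hlim
  filter_upwards [hmem] with t ht
  rcases le_total t t₀ with h1 | h1
  · rw [norm_sub_rev, abs_sub_comm]
    exact hle t t₀ ht.1 h1 (by linarith)
  · exact hle t₀ t ht₀' h1 ht.2

/-- Variation of constants: `y(t) = S(t)(y₀ - z(t))` satisfies
`B y(t) = B y₀ + ∫₀ᵗ y + (∫₀ᵗ f) ℓ`, which is the integrated form of `(B y)' = y + f ℓ`. -/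
theorem apply_input_response (hS : IsUnitaryGroup B S)
    (hi : Function.Injective B)
    (hf : ∀ T : ℝ, 0 < T → MemLp f 2 (volume.restrict (Ioo 0 T)))
    {z : ℝ → X} (hzc : ContinuousOn z (Ici 0))
    (hz : ∀ t, 0 ≤ t → B (z t) = -∫ τ in (0 : ℝ)..t, f τ • S (-τ) ℓ) (y₀ : X) {t : ℝ}
    (ht : 0 ≤ t) :
    B (S t (y₀ - z t)) =
      B y₀ + (∫ s in (0 : ℝ)..t, S s (y₀ - z s)) + (∫ τ in (0 : ℝ)..t, f τ) • ℓ := by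
  have hfi := intervalIntegrable_of_memLp hf le_rfl ht
  have hsub : uIcc 0 t ⊆ Ici 0 := fun r hr => (le_min le_rfl ht).trans hr.1
  have hSz : ContinuousOn (fun s => S s (z s)) (Ici 0) :=
    hS.continuousOn_comp continuousOn_id hzc
  have hpS : ∀ s, 0 ≤ s → S s (B (z s)) = -∫ τ in (0 : ℝ)..s, f τ • S (s - τ) ℓ := by
    intro s hs
    rw [hz s hs, map_neg, ← (S s).intervalIntegral_comp_comm]
    · congr 1
      refine intervalIntegral.integral_congr fun τ _ => ?_
      simp only [map_smul]
      rw [← mul_apply_eq_comp, ← hS.add, sub_eq_add_neg]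
    · exact (intervalIntegrable_of_memLp hf le_rfl hs).smul_continuousOn
        (hS.continuous_neg_apply ℓ).continuousOn
  have hjoint : Continuous fun q : ℝ × ℝ => S (q.2 - q.1) ℓ :=
    (hS.continuous ℓ).comp (continuous_snd.sub continuous_fst)
  have hswap : ∫ τ in (0 : ℝ)..t, ∫ σ in τ..t, f τ • S (σ - τ) ℓ =
      ∫ σ in (0 : ℝ)..t, ∫ τ in (0 : ℝ)..σ, f τ • S (σ - τ) ℓ := by
    refine integral_triangle_swap ht ?_
    refine Integrable.indicator ?_ (measurableSet_le measurable_fst measurable_snd)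
    have h1 : Integrable (fun q : ℝ × ℝ => f q.1 * ‖ℓ‖)
        ((volume.restrict (Ioc 0 t)).prod (volume.restrict (Ioc 0 t))) :=
      Integrable.mul_const (Integrable.comp_fst hfi.1 _) _
    refine h1.mono ?_ (Eventually.of_forall fun q => ?_)
    · exact (Integrable.comp_fst hfi.1 _).aestronglyMeasurable.smul hjoint.aestronglyMeasurable
    · simp only [Function.uncurry, norm_smul, hS.norm_apply, norm_mul, norm_norm, le_refl]
  -- the inner integral `∫ S(σ - τ) ℓ dσ` is `B (S(t - τ) ℓ - ℓ)`; cancel one `B`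
  have hmain : S t (B (z t)) = -((∫ τ in (0 : ℝ)..t, f τ) • ℓ) + ∫ s in (0 : ℝ)..t, S s (z s) := by
    refine hi ?_
    have hc1 : IntervalIntegrable (fun τ => f τ • S (t - τ) ℓ) volume 0 t :=
      hfi.smul_continuousOn ((hS.continuous ℓ).comp (by fun_prop)).continuousOn
    rw [map_add, map_neg, map_smul, ← B.intervalIntegral_comp_comm
      ((hSz.mono hsub).intervalIntegrable)]
    have e1 : ∫ s in (0 : ℝ)..t, B (S s (z s)) =
        -∫ s in (0 : ℝ)..t, ∫ τ in (0 : ℝ)..s, f τ • S (s - τ) ℓ := by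
      rw [← intervalIntegral.integral_neg]
      refine intervalIntegral.integral_congr fun s hs => ?_
      rw [hS.commute, hpS s (hsub hs)]
    rw [e1, hpS t ht, map_neg, ← B.intervalIntegral_comp_comm hc1, ← hswap, ← neg_add, neg_inj,
      ← intervalIntegral.integral_smul_const, ← intervalIntegral.integral_add]
    · refine intervalIntegral.integral_congr fun τ _ => ?_
      rw [map_smul, intervalIntegral.integral_smul, ← hS.integral_translate, map_sub, ← smul_add]
      abel_nf
    · exact hfi.smul_continuousOn continuousOn_const
    · have h2 : IntervalIntegrable (fun τ => f τ • (B (S (t - τ) ℓ) - B ℓ)) volume 0 t := by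
        refine hfi.smul_continuousOn (Continuous.continuousOn ?_)
        exact (B.continuous.comp ((hS.continuous ℓ).comp (continuous_sub_left t))).sub
          continuous_const
      refine h2.congr fun τ _ => ?_
      rw [intervalIntegral.integral_smul, ← hS.integral_translate, map_sub]
  have hS0 : IntervalIntegrable (fun s => S s y₀) volume 0 t :=
    (hS.continuous y₀).intervalIntegrable _ _
  have e2 : ∫ s in (0 : ℝ)..t, S s (y₀ - z s) =
      (∫ s in (0 : ℝ)..t, S s y₀) - ∫ s in (0 : ℝ)..t, S s (z s) := by
    rw [← intervalIntegral.integral_sub hS0 ((hSz.mono hsub).intervalIntegrable)]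
    simp
  rw [e2, ← hS.integral, map_sub, map_sub, hS.commute t (z t), hmain, map_sub]
  abel

/-- The pairing of the input response with `x` is the pairing of the input with any `L²`-limit of
observations of orbits whose data converge to `x`. -/
theorem inner_input_response (hS : IsUnitaryGroup B S) (hB : adjoint B = -B)
    (hf : ∀ T : ℝ, 0 < T → MemLp f 2 (volume.restrict (Ioo 0 T)))
    {z : ℝ → X} (hz : ∀ t, 0 ≤ t → B (z t) = -∫ τ in (0 : ℝ)..t, f τ • S (-τ) ℓ)
    {T : ℝ} (hT : 0 < T) {x : X} {Y : ℕ → X} (hY : Tendsto (fun n => B (Y n)) atTop (𝓝 x))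
    {h : ℕ → ℝ → ℝ} (hh : ∀ n, ∀ t ∈ Icc 0 T, h n t = inner ℝ ℓ (S (t - T) (Y n)))
    (hm : ∀ n, MemLp (h n) 2 (volume.restrict (Ioo 0 T)))
    {g : ℝ → ℝ} (hg : MemLp g 2 (volume.restrict (Ioo 0 T)))
    (hlim : Tendsto (fun n => eLpNorm (h n - g) 2 (volume.restrict (Ioo 0 T))) atTop (𝓝 0)) :
    inner ℝ (S T (z T)) x = ∫ t in (0 : ℝ)..T, f t * g t := by
  have e : ∀ n, inner ℝ (S T (z T)) (B (Y n)) = ∫ t in Ioo 0 T, f t * h n t := by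
    intro n
    have h1 : inner ℝ (S T (z T)) (B (Y n)) =
        inner ℝ (∫ τ in (0 : ℝ)..T, f τ • S (-τ) ℓ) (S (-T) (Y n)) := by
      have h2 := inner_apply_of_skew hB (S T (z T)) (Y n)
      have h3 := hS.inner_apply_right (-T) (B (z T)) (Y n)
      rw [neg_neg, ← hS.commute] at h3
      rw [hz T hT.le, inner_neg_left] at h3
      linarith
    rw [h1, hS.inner_integral_smul hf le_rfl hT.le, intervalIntegral.integral_of_le hT.le,
      integral_Ioc_eq_integral_Ioo]
    refine setIntegral_congr_fun measurableSet_Ioo fun t ht => ?_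
    rw [hh n t (Ioo_subset_Icc_self ht), ← mul_apply_eq_comp, ← hS.add, sub_eq_add_neg]
  have hLp := (Lp.tendsto_Lp_iff_tendsto_eLpNorm'' h hm g hg).2 hlim
  have l1 := (tendsto_const_nhds (x := (hf T hT).toLp f)).inner (𝕜 := ℝ) hLp
  have l2 := (tendsto_const_nhds (x := S T (z T))).inner (𝕜 := ℝ) hY
  rw [intervalIntegral.integral_of_le hT.le, integral_Ioc_eq_integral_Ioo]
  refine tendsto_nhds_unique l2 ?_
  simp_rw [e]
  simpa only [inner_toLp_toLp] using l1

omit [CompleteSpace X] in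
/-- The observations of orbits with converging data have a limit in `L²(0,T)`. -/
theorem exists_trace (hS : IsUnitaryGroup B S) (hℓ : IsAdmissible B S ℓ)
    {T : ℝ} (hT : 0 < T) {x : X} {Y : ℕ → X} (hY : Tendsto (fun n => B (Y n)) atTop (𝓝 x)) :
    ∃ g : ℝ → ℝ, MemLp g 2 (volume.restrict (Ioo 0 T)) ∧
      Tendsto (fun n => eLpNorm ((fun t => inner ℝ ℓ (S (t - T) (Y n))) - g) 2
        (volume.restrict (Ioo 0 T))) atTop (𝓝 0) := by
  have hc : ∀ Y, Continuous fun t => inner ℝ ℓ (S (t - T) Y) := fun Y =>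
    continuous_const.inner ((hS.continuous Y).comp (continuous_sub_right T))
  have hm : ∀ Y, MemLp (fun t => inner ℝ ℓ (S (t - T) Y)) 2 (volume.restrict (Ioo 0 T)) :=
    fun Y => memLp_Ioo_of_continuousOn (hc Y).continuousOn
  obtain ⟨C, hC, hCY⟩ := hℓ T hT
  have hbd : ∀ Y, ‖(hm Y).toLp _‖ ≤ √C * ‖B Y‖ := by
    intro Y
    refine le_of_sq_le_sq ?_ (by positivity)
    rw [norm_toLp_sq, mul_pow, Real.sq_sqrt hC, ← integral_Ioc_eq_integral_Ioo,
      ← intervalIntegral.integral_of_le hT.le]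
    have h1 := hCY (S (-T) Y)
    rw [hS.commute, hS.norm_apply] at h1
    refine le_trans (le_of_eq (intervalIntegral.integral_congr fun t _ => ?_)) h1
    rw [← mul_apply_eq_comp, ← hS.add, sub_eq_add_neg]
  have hcau : CauchySeq fun n => (hm (Y n)).toLp _ := by
    rw [Metric.cauchySeq_iff]
    intro ε hε
    obtain ⟨N, hN⟩ := Metric.cauchySeq_iff.1 hY.cauchySeq (ε / (√C + 1)) (by positivity)
    refine ⟨N, fun n hn m hm' => ?_⟩
    have h1 := hN n hn m hm'
    rw [dist_eq_norm, lt_div_iff₀ (by positivity), ← map_sub] at h1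
    have h2 := hbd (Y n - Y m)
    have h3 : (hm (Y n)).toLp _ - (hm (Y m)).toLp _ = (hm (Y n - Y m)).toLp _ := by
      rw [← MemLp.toLp_sub]
      congr 1
      ext t
      simp [inner_sub_right]
    rw [dist_eq_norm, h3]
    nlinarith [norm_nonneg (B (Y n - Y m))]
  obtain ⟨G, hG⟩ := cauchySeq_tendsto_of_complete hcau
  refine ⟨G, Lp.memLp G, ?_⟩
  refine (Lp.tendsto_Lp_iff_tendsto_eLpNorm'' _ (fun n => hm (Y n)) G (Lp.memLp G)).1 ?_
  simpa using hG

end IsUnitaryGroup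

end Input

/-! ### Test functions and the du Bois-Reymond lemma -/

theorem exists_Icc_of_isCompact_subset_Ioo {K : Set ℝ} (hK : IsCompact K) (h : K ⊆ Ioo 0 1) :
    ∃ c d : ℝ, 0 < c ∧ c ≤ d ∧ d < 1 ∧ K ⊆ Icc c d := by
  rcases K.eq_empty_or_nonempty with rfl | hne
  · exact ⟨1 / 2, 1 / 2, by norm_num, le_rfl, by norm_num, empty_subset _⟩
  · obtain ⟨c, hc, hcl⟩ := hK.exists_isLeast hne
    obtain ⟨d, hd, hdu⟩ := hK.exists_isGreatest hne
    exact ⟨c, d, (h hc).1, hcl hd, (h hd).2, fun x hx => ⟨hcl hx, hdu hx⟩⟩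

namespace IsTestFunction

theorem eq_zero {φ : ℝ → ℝ} (h : IsTestFunction φ) {x : ℝ} (hx : x ∉ Ioo (0 : ℝ) 1) : φ x = 0 :=
  image_eq_zero_of_notMem_tsupport fun h' => hx (h.2.2 h')

theorem deriv {φ : ℝ → ℝ} (h : IsTestFunction φ) : IsTestFunction (deriv φ) :=
  ⟨(contDiff_infty_iff_deriv.1 h.1).2, h.2.1.deriv,
    (closure_minimal (support_deriv_subset) (isClosed_tsupport φ)).trans h.2.2⟩

theorem add {φ ψ : ℝ → ℝ} (h : IsTestFunction φ) (h' : IsTestFunction ψ) :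
    IsTestFunction (φ + ψ) :=
  ⟨h.1.add h'.1, h.2.1.add h'.2.1, (tsupport_add φ ψ).trans (union_subset h.2.2 h'.2.2)⟩

theorem const_mul {φ : ℝ → ℝ} (h : IsTestFunction φ) (c : ℝ) :
    IsTestFunction fun x => c * φ x :=
  ⟨contDiff_const.mul h.1, h.2.1.mul_left,
    (tsupport_mul_subset_right (f := fun _ => c) (g := φ)).trans h.2.2⟩

theorem memLp {φ : ℝ → ℝ} (h : IsTestFunction φ) : MemLp φ 2 lebesgue01 :=
  (h.1.continuous.memLp_of_hasCompactSupport h.2.1)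

theorem integrable {φ : ℝ → ℝ} (h : IsTestFunction φ) : Integrable φ lebesgue01 :=
  h.1.continuous.integrable_of_hasCompactSupport h.2.1

theorem intervalIntegral_deriv {φ : ℝ → ℝ} (h : IsTestFunction φ) (a b : ℝ) :
    ∫ x in a..b, _root_.deriv φ x = φ b - φ a :=
  intervalIntegral.integral_eq_sub_of_hasDerivAt
    (fun x _ => ((h.1.differentiable (by simp)).differentiableAt).hasDerivAt)
    (h.deriv.1.continuous.intervalIntegrable _ _)

theorem exists_deriv_eq {ψ : ℝ → ℝ} (h : IsTestFunction ψ) (h0 : ∫ x in Ioo (0 : ℝ) 1, ψ x = 0) :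
    ∃ φ, IsTestFunction φ ∧ _root_.deriv φ = ψ := by
  obtain ⟨c, d, hc, hcd, hd, hK⟩ := exists_Icc_of_isCompact_subset_Ioo h.2.1 h.2.2
  set φ : ℝ → ℝ := fun x => ∫ s in (0 : ℝ)..x, ψ s with hφ
  have hder : ∀ x, HasDerivAt φ (ψ x) x := fun x =>
    (h.1.continuous.integral_hasStrictDerivAt 0 x).hasDerivAt
  have hde : _root_.deriv φ = ψ := funext fun x => (hder x).deriv
  have hz : ∀ x, x ∉ Icc c d → ψ x = 0 := fun x hx =>
    image_eq_zero_of_notMem_tsupport fun h' => hx (hK h')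
  have hsupp : Function.support φ ⊆ Icc c d := by
    intro x hx
    by_contra hx'
    refine hx ?_
    rcases lt_or_ge x c with h1 | h1
    · refine intervalIntegral.integral_zero_ae (Eventually.of_forall fun s hs => hz s fun h' => ?_)
      have : s ≤ max 0 x := hs.2
      exact absurd h'.1 (not_le.2 (this.trans_lt (max_lt hc h1)))
    · have h2 : d < x := by
        by_contra h'
        exact hx' ⟨h1, not_lt.1 h'⟩
      have h3 : ∫ s in x..1, ψ s = 0 := by
        refine intervalIntegral.integral_zero_ae
          (Eventually.of_forall fun s hs => hz s fun h' => ?_)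
        have : min x 1 < s := hs.1
        exact absurd h'.2 (not_le.2 ((lt_min h2 hd).trans this))
      have h4 := intervalIntegral.integral_add_adjacent_intervals
        (h.1.continuous.intervalIntegrable 0 x (μ := volume))
        (h.1.continuous.intervalIntegrable x 1)
      rw [h3, intervalIntegral.integral_of_le zero_le_one, integral_Ioc_eq_integral_Ioo, h0,
        add_zero] at h4
      exact h4
  have hts : tsupport φ ⊆ Icc c d := closure_minimal hsupp isClosed_Icc
  refine ⟨φ, ⟨?_, ?_, ?_⟩, hde⟩
  · rw [contDiff_infty_iff_deriv, hde]
    exact ⟨fun x => (hder x).differentiableAt, h.1⟩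
  · exact isCompact_Icc.of_isClosed_subset (isClosed_tsupport φ) hts
  · exact hts.trans fun x hx => ⟨hc.trans_le hx.1, hx.2.trans_lt hd⟩

end IsTestFunction

theorem exists_isTestFunction_integral_eq_one :
    ∃ η, IsTestFunction η ∧ ∫ x in Ioo (0 : ℝ) 1, η x = 1 := by
  let b : ContDiffBump (1 / 2 : ℝ) := ⟨1 / 8, 1 / 4, by norm_num, by norm_num⟩
  have hts : tsupport (b.normed volume) ⊆ Ioo (0 : ℝ) 1 := by
    rw [b.tsupport_normed_eq, Real.closedBall_eq_Icc]
    intro x hx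
    constructor
    · have := hx.1
      norm_num [b] at this
      linarith
    · have := hx.2
      norm_num [b] at this
      linarith
  refine ⟨b.normed volume, ⟨b.contDiff_normed, b.hasCompactSupport_normed, hts⟩, ?_⟩
  rw [setIntegral_eq_integral_of_forall_compl_eq_zero, b.integral_normed]
  exact fun x hx => image_eq_zero_of_notMem_tsupport fun h' => hx (hts h')

theorem ae_eq_zero_of_test {f : ℝ → ℝ} (hf : LocallyIntegrableOn f (Ioo 0 1))
    (h : ∀ φ, IsTestFunction φ → ∫ x in Ioo (0 : ℝ) 1, f x * φ x = 0) : f =ᵐ[lebesgue01] 0 := by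
  have := isOpen_Ioo.ae_eq_zero_of_integral_contDiff_smul_eq_zero hf fun φ h1 h2 h3 => by
    have ht : IsTestFunction φ := ⟨h1, h2, h3⟩
    rw [← h φ ht, setIntegral_eq_integral_of_forall_compl_eq_zero fun x hx => by
      rw [ht.eq_zero hx, mul_zero]]
    simp [mul_comm]
  exact (ae_restrict_iff' measurableSet_Ioo).2 this

/-- A function whose weak derivative vanishes is constant. -/
theorem HasWeakDeriv.ae_eq_const {f : ℝ → ℝ} (hf : Integrable f lebesgue01)
    (h : HasWeakDeriv f 0) : ∃ c : ℝ, f =ᵐ[lebesgue01] fun _ => c := by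
  obtain ⟨η, hη, hη1⟩ := exists_isTestFunction_integral_eq_one
  refine ⟨∫ x in Ioo (0 : ℝ) 1, f x * η x, ?_⟩
  set c := ∫ x in Ioo (0 : ℝ) 1, f x * η x with hc
  have hfc : Integrable (fun x => f x - c) lebesgue01 := hf.sub (integrable_const c)
  have : (fun x => f x - c) =ᵐ[lebesgue01] 0 := by
    have hloc : IntegrableOn (fun x => f x - c) (Ioo 0 1) volume := hfc
    refine ae_eq_zero_of_test hloc.locallyIntegrableOn fun ψ hψ => ?_
    set m := ∫ x in Ioo (0 : ℝ) 1, ψ x with hm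
    have ht : IsTestFunction (ψ + fun x => -m * η x) := hψ.add (hη.const_mul _)
    obtain ⟨φ, hφ, hφd⟩ := ht.exists_deriv_eq (by
      simp only [Pi.add_apply]
      rw [integral_add hψ.integrable (hη.const_mul _).integrable, integral_const_mul, hη1, ← hm]
      ring)
    have h1 := h φ hφ
    rw [hφd] at h1
    simp only [Pi.add_apply, Pi.zero_apply, zero_mul, integral_zero, neg_zero] at h1
    have i1 : Integrable (fun x => f x * ψ x) lebesgue01 :=
      integrable_mul_of_test hf hψ.1.continuous hψ.2.1
    have i2 : Integrable (fun x => f x * η x) lebesgue01 :=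
      integrable_mul_of_test hf hη.1.continuous hη.2.1
    have e1 : ∫ x in Ioo (0 : ℝ) 1, f x * (ψ x + -m * η x) =
        (∫ x in Ioo (0 : ℝ) 1, f x * ψ x) - m * c := by
      rw [hc, ← integral_const_mul, ← integral_sub i1 (i2.const_mul m)]
      exact integral_congr_ae (Eventually.of_forall fun x => by ring)
    have e2 : ∫ x in Ioo (0 : ℝ) 1, (f x - c) * ψ x =
        (∫ x in Ioo (0 : ℝ) 1, f x * ψ x) - c * m := by
      rw [hm, ← integral_const_mul, ← integral_sub i1 (hψ.integrable.const_mul c)]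
      exact integral_congr_ae (Eventually.of_forall fun x => by ring)
    rw [e2]
    rw [e1] at h1
    linarith
  filter_upwards [this] with x hx
  exact sub_eq_zero.1 hx

/-! ### Primitives -/

/-- The primitive of `g` on `[0,1]` that vanishes at `0`; it is constant outside `[0,1]`. -/
noncomputable def primitive (g : ℝ → ℝ) (x : ℝ) : ℝ := ∫ s in (0 : ℝ)..x, g s ∂lebesgue01

theorem primitive_eq (g : ℝ → ℝ) {x : ℝ} (hx : x ∈ Icc (0 : ℝ) 1) :
    primitive g x = ∫ s in (0 : ℝ)..x, g s := by
  rw [primitive, intervalIntegral.integral_of_le hx.1, intervalIntegral.integral_of_le hx.1,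
    integral_Ioc_eq_integral_Ioo, integral_Ioc_eq_integral_Ioo,
    Measure.restrict_restrict measurableSet_Ioo, inter_eq_left.2 (Ioo_subset_Ioo le_rfl hx.2)]

theorem primitive_zero (g : ℝ → ℝ) : primitive g 0 = 0 := intervalIntegral.integral_same

theorem primitive_one (g : ℝ → ℝ) : primitive g 1 = ∫ x in Ioo (0 : ℝ) 1, g x := by
  rw [primitive_eq g ⟨zero_le_one, le_rfl⟩, intervalIntegral.integral_of_le zero_le_one,
    integral_Ioc_eq_integral_Ioo]

theorem primitive_congr {g h : ℝ → ℝ} (e : g =ᵐ[lebesgue01] h) : primitive g = primitive h := by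
  ext x
  exact intervalIntegral.integral_congr_ae (e.mono fun _ h _ => h)

theorem primitive_add {g h : ℝ → ℝ} (hg : Integrable g lebesgue01) (hh : Integrable h lebesgue01) :
    primitive (g + h) = primitive g + primitive h := by
  ext x
  exact intervalIntegral.integral_add hg.intervalIntegrable hh.intervalIntegrable

theorem primitive_smul (c : ℝ) (g : ℝ → ℝ) : primitive (c • g) = c • primitive g := by
  ext x
  exact intervalIntegral.integral_smul c g

theorem continuous_primitive {g : ℝ → ℝ} (hg : Integrable g lebesgue01) :
    Continuous (primitive g) :=
  intervalIntegral.continuous_primitive (fun _ _ => hg.intervalIntegrable) 0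

theorem integrable_iff_intervalIntegrable {g : ℝ → ℝ} :
    Integrable g lebesgue01 ↔ IntervalIntegrable g volume 0 1 :=
  (intervalIntegrable_iff_integrableOn_Ioo_of_le zero_le_one).symm

theorem integral_Ioo_eq (g : ℝ → ℝ) : ∫ x in Ioo (0 : ℝ) 1, g x = ∫ x in (0 : ℝ)..1, g x := by
  rw [intervalIntegral.integral_of_le zero_le_one, integral_Ioc_eq_integral_Ioo]

theorem integrable_of_continuous {g : ℝ → ℝ} (hg : Continuous g) : Integrable g lebesgue01 :=
  integrable_iff_intervalIntegrable.2 (hg.intervalIntegrable _ _)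

theorem integral_primitive_mul {g χ : ℝ → ℝ} (hg : Integrable g lebesgue01)
    (hχ : Integrable χ lebesgue01) :
    ∫ x in Ioo (0 : ℝ) 1, primitive g x * χ x =
      ∫ x in Ioo (0 : ℝ) 1, g x * ∫ s in x..1, χ s := by
  rw [integral_Ioo_eq, integral_Ioo_eq]
  have h := integral_triangle_swap (F := fun x y => g x * χ y) (zero_le_one (α := ℝ)) (by
    refine Integrable.indicator ?_ (measurableSet_le measurable_fst measurable_snd)
    exact Integrable.mul_prod (integrable_iff_intervalIntegrable.1 hg).1
      (integrable_iff_intervalIntegrable.1 hχ).1)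
  simp only [intervalIntegral.integral_const_mul, intervalIntegral.integral_mul_const] at h
  rw [h]
  refine intervalIntegral.integral_congr fun x hx => ?_
  rw [uIcc_of_le zero_le_one] at hx
  simp only [primitive_eq g hx]

theorem hasWeakDeriv_primitive {g : ℝ → ℝ} (hg : Integrable g lebesgue01) :
    HasWeakDeriv (primitive g) g := by
  intro φ hφ
  rw [integral_primitive_mul hg hφ.deriv.integrable, ← integral_neg]
  refine integral_congr_ae (Eventually.of_forall fun x => ?_)
  simp only
  rw [hφ.intervalIntegral_deriv, hφ.eq_zero (x := 1) (by simp)]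
  ring

theorem HasWeakDeriv.sub {u₁ u₂ w₁ w₂ : ℝ → ℝ} (h₁ : HasWeakDeriv u₁ w₁)
    (h₂ : HasWeakDeriv u₂ w₂) (iu₁ : Integrable u₁ lebesgue01) (iu₂ : Integrable u₂ lebesgue01)
    (iw₁ : Integrable w₁ lebesgue01) (iw₂ : Integrable w₂ lebesgue01) :
    HasWeakDeriv (u₁ - u₂) (w₁ - w₂) := by
  have := h₁.add (h₂.smul (-1)) iu₁ (iu₂.smul (-1)) iw₁ (iw₂.smul (-1))
  simpa [sub_eq_add_neg] using this

theorem HasWeakDeriv.ae_eq_primitive_add_const {u w : ℝ → ℝ} (hu : Integrable u lebesgue01)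
    (hw : Integrable w lebesgue01) (h : HasWeakDeriv u w) :
    ∃ c : ℝ, u =ᵐ[lebesgue01] fun x => primitive w x + c := by
  have hP := integrable_of_continuous (continuous_primitive hw)
  have h0 := h.sub (hasWeakDeriv_primitive hw) hu hP hw hw
  rw [sub_self] at h0
  obtain ⟨c, hc⟩ := h0.ae_eq_const (hu.sub hP)
  refine ⟨c, ?_⟩
  filter_upwards [hc] with x hx
  simp only [Pi.sub_apply] at hx
  linarith

theorem eqOn_of_ae_eq {v w : ℝ → ℝ} (hv : ContinuousOn v (Icc 0 1)) (hw : ContinuousOn w (Icc 0 1))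
    (h : v =ᵐ[lebesgue01] w) : EqOn v w (Icc 0 1) := by
  refine Measure.eqOn_Icc_of_ae_eq volume zero_ne_one ?_ hv hw
  rwa [lebesgue01, restrict_Ioo_eq_restrict_Icc] at h

/-- A function with a weak derivative that vanishes at both endpoints is the primitive of its weak
derivative, which has integral zero. -/
theorem HasWeakDeriv.ae_eq_primitive {u w : ℝ → ℝ} (hu : Integrable u lebesgue01)
    (hw : Integrable w lebesgue01) (h : HasWeakDeriv u w) (h0 : VanishesAtEndpoints u) :
    u =ᵐ[lebesgue01] primitive w ∧ primitive w 1 = 0 := by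
  obtain ⟨c, hc⟩ := h.ae_eq_primitive_add_const hu hw
  obtain ⟨v, hv, huv, hv0, hv1⟩ := h0
  have he := eqOn_of_ae_eq hv ((continuous_primitive hw).add_const c).continuousOn
    (huv.symm.trans hc)
  have hc0 : c = 0 := by
    have := he (left_mem_Icc.2 zero_le_one)
    simp only [primitive_zero, hv0] at this
    linarith
  have h1 := he (right_mem_Icc.2 zero_le_one)
  simp only [hv1, hc0] at h1
  refine ⟨?_, by linarith⟩
  simpa [hc0] using hc

/-- A function whose second weak derivative vanishes is affine. -/
theorem ae_eq_affine_of_test {f : ℝ → ℝ} (hf : Integrable f lebesgue01)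
    (h : ∀ φ, IsTestFunction φ → ∫ x in Ioo (0 : ℝ) 1, f x * deriv (deriv φ) x = 0) :
    ∃ α β : ℝ, f =ᵐ[lebesgue01] fun x => α + β * x := by
  obtain ⟨η, hη, hη1⟩ := exists_isTestFunction_integral_eq_one
  set b := ∫ x in Ioo (0 : ℝ) 1, f x * deriv η x with hb
  have hw : HasWeakDeriv f (fun _ => -b) := by
    intro ψ hψ
    set m := ∫ x in Ioo (0 : ℝ) 1, ψ x with hm
    have ht : IsTestFunction (ψ + fun x => -m * η x) := hψ.add (hη.const_mul _)
    obtain ⟨φ, hφ, hφd⟩ := ht.exists_deriv_eq (by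
      simp only [Pi.add_apply]
      rw [integral_add hψ.integrable (hη.const_mul _).integrable, integral_const_mul, hη1, ← hm]
      ring)
    have h1 := h φ hφ
    have hd : deriv (deriv φ) = fun x => deriv ψ x + -m * deriv η x := by
      rw [hφd]
      ext x
      have d1 : DifferentiableAt ℝ ψ x := (hψ.1.differentiable (by simp)).differentiableAt
      have d2 : DifferentiableAt ℝ η x := (hη.1.differentiable (by simp)).differentiableAt
      rw [deriv_add d1 (d2.const_mul _), deriv_const_mul _ d2]
    have i1 : Integrable (fun x => f x * deriv ψ x) lebesgue01 :=
      integrable_mul_of_test hf hψ.deriv.1.continuous hψ.deriv.2.1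
    have i2 : Integrable (fun x => f x * deriv η x) lebesgue01 :=
      integrable_mul_of_test hf hη.deriv.1.continuous hη.deriv.2.1
    have e1 : ∫ x in Ioo (0 : ℝ) 1, f x * (deriv ψ x + -m * deriv η x) =
        (∫ x in Ioo (0 : ℝ) 1, f x * deriv ψ x) - m * b := by
      rw [hb, ← integral_const_mul, ← integral_sub i1 (i2.const_mul m)]
      exact integral_congr_ae (Eventually.of_forall fun x => by ring)
    rw [hd] at h1
    simp only at h1
    rw [e1] at h1
    rw [integral_const_mul, ← hm]
    linarith
  obtain ⟨c, hc⟩ := hw.ae_eq_primitive_add_const hf (integrable_const _)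
  refine ⟨c, -b, ?_⟩
  filter_upwards [hc, ae_restrict_mem measurableSet_Ioo] with x hx hx'
  rw [hx, primitive_eq _ (Ioo_subset_Icc_self hx'), intervalIntegral.integral_const]
  simp only [smul_eq_mul]
  ring

/-! ### The weight and the weighted space -/

/-- The consequences of degeneracy that matter: `a` is `C¹` away from `0`, and `x |a'| ≤ 2 a`. -/
structure Coefficient.IsDegenerate (a : Coefficient) : Prop where
  contDiffOn : ContDiffOn ℝ 1 a (Ioc 0 1)
  mul_deriv_le : ∀ x ∈ Ioo (0 : ℝ) 1, x * |deriv a x| ≤ 2 * a x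

theorem Coefficient.isDegenerate {a : Coefficient}
    (ha : IsWeaklyDegenerate a ∨ IsStronglyDegenerate a) : a.IsDegenerate := by
  have key : ContDiffOn ℝ 1 a (Ioc 0 1) → (∃ K : ℝ, K < 2 ∧ IsDegeneracyConstant a K) →
      a.IsDegenerate := by
    rintro h ⟨K, hK, hlub⟩
    refine ⟨h, fun x hx => ?_⟩
    have h1 := hlub.1 (mem_image_of_mem _ (Ioo_subset_Ioc_self hx))
    have hp := a.pos x (Ioo_subset_Ioc_self hx)
    rw [derivWithin_of_mem_nhds (Icc_mem_nhds hx.1 hx.2), div_le_iff₀ hp] at h1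
    nlinarith
  rcases ha with ⟨h, K, hK, hl⟩ | ⟨h, K, hK, hl⟩
  · exact key h ⟨K, hK.2.trans one_lt_two, hl⟩
  · exact key (h.mono Ioc_subset_Icc_self) ⟨K, hK.2, hl⟩

section Weight

variable {a : Coefficient}

theorem Coefficient.IsDegenerate.hasDerivAt (ha : a.IsDegenerate) {x : ℝ} (hx : x ∈ Ioo (0 : ℝ) 1) :
    HasDerivAt a (deriv a x) x :=
  ((ha.contDiffOn.differentiableOn (by simp)).differentiableAt
    (Ioc_mem_nhds hx.1 hx.2)).hasDerivAt

/-- Since `x |a'| ≤ 2 a`, the quotient `a / x²` is nonincreasing. -/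
theorem Coefficient.IsDegenerate.sq_mul_le (ha : a.IsDegenerate) {x : ℝ} (hx : x ∈ Ioc (0 : ℝ) 1) :
    x ^ 2 * a 1 ≤ a x := by
  have hcont : ContinuousOn (fun y => y ^ 2 / a y) (Icc x 1) :=
    (continuous_pow 2).continuousOn.div
      (a.continuousOn.mono (Icc_subset_Icc_left hx.1.le))
      fun y hy => (a.pos y ⟨hx.1.trans_le hy.1, hy.2⟩).ne'
  have hd : ∀ y ∈ Ioo x 1, HasDerivAt (fun y => y ^ 2 / a y)
      ((2 * y * a y - y ^ 2 * deriv a y) / a y ^ 2) y := fun y hy => by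
    have hy' : y ∈ Ioo (0 : ℝ) 1 := ⟨hx.1.trans hy.1, hy.2⟩
    exact ((hasDerivAt_pow 2 y).div (ha.hasDerivAt hy')
      (a.pos y (Ioo_subset_Ioc_self hy')).ne').congr_deriv (by simp)
  have hmono : MonotoneOn (fun y => y ^ 2 / a y) (Icc x 1) := by
    refine monotoneOn_of_deriv_nonneg (convex_Icc _ _) hcont ?_ ?_
    · rw [interior_Icc]
      exact fun y hy => (hd y hy).differentiableAt.differentiableWithinAt
    · rw [interior_Icc]
      intro y hy
      rw [(hd y hy).deriv]
      have hy' : y ∈ Ioo (0 : ℝ) 1 := ⟨hx.1.trans hy.1, hy.2⟩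
      have h1 := ha.mul_deriv_le y hy'
      have h2 := le_abs_self (deriv a y)
      have h3 : y * deriv a y ≤ 2 * a y := (mul_le_mul_of_nonneg_left h2 hy'.1.le).trans h1
      refine div_nonneg ?_ (sq_nonneg _)
      nlinarith [hy'.1]
  have h1 := hmono (left_mem_Icc.2 hx.2) (right_mem_Icc.2 hx.2) hx.2
  simp only [one_pow] at h1
  rwa [div_le_div_iff₀ (a.pos x hx) (a.pos 1 ⟨one_pos, le_rfl⟩), one_mul] at h1

/-- The measures `dx / a` and `dx` on `(0,1)` have the same null sets. -/
theorem ae_weighted_iff {p : ℝ → Prop} :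
    (∀ᵐ x ∂weightedMeasure a, p x) ↔ ∀ᵐ x ∂lebesgue01, p x :=
  ⟨fun h => (lebesgue01_absolutelyContinuous a).ae_le h,
    fun h => (withDensity_absolutelyContinuous _ _).ae_le h⟩

theorem toReal_density_ae :
    ∀ᵐ x ∂lebesgue01, (ENNReal.ofReal (a x)⁻¹).toReal = (a x)⁻¹ := by
  filter_upwards [ae_restrict_mem measurableSet_Ioo] with x hx
  exact ENNReal.toReal_ofReal (inv_nonneg.2 (a.pos x (Ioo_subset_Ioc_self hx)).le)

theorem integral_weighted (F : ℝ → ℝ) :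
    ∫ x, F x ∂weightedMeasure a = ∫ x in Ioo (0 : ℝ) 1, F x / a x := by
  rw [weightedMeasure, integral_withDensity_eq_integral_toReal_smul₀ a.aemeasurable_density
    (Eventually.of_forall fun _ => ENNReal.ofReal_lt_top)]
  refine integral_congr_ae ?_
  filter_upwards [toReal_density_ae (a := a)] with x hx
  rw [hx, smul_eq_mul, div_eq_inv_mul]

theorem integrable_weighted_iff {F : ℝ → ℝ} :
    Integrable F (weightedMeasure a) ↔ Integrable (fun x => F x / a x) lebesgue01 := by
  rw [weightedMeasure, integrable_withDensity_iff_integrable_smul₀' a.aemeasurable_density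
    (Eventually.of_forall fun _ => ENNReal.ofReal_lt_top)]
  refine integrable_congr ?_
  filter_upwards [toReal_density_ae (a := a)] with x hx
  rw [hx, smul_eq_mul, div_eq_inv_mul]

theorem L2w.inner_eq (u v : L2w a) :
    inner ℝ u v = ∫ x in Ioo (0 : ℝ) 1, u x * v x / a x := by
  rw [L2.inner_def, ← integral_weighted]
  refine integral_congr_ae (Eventually.of_forall fun x => ?_)
  simp [mul_comm]

theorem L2w.integrable_mul_div (u v : L2w a) :
    Integrable (fun x => u x * v x / a x) lebesgue01 :=
  integrable_weighted_iff.1 ((Lp.memLp u).integrable_mul (Lp.memLp v))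

theorem L2.inner_eq (u v : L2) : inner ℝ u v = ∫ x in Ioo (0 : ℝ) 1, u x * v x := by
  rw [L2.inner_def]
  refine integral_congr_ae (Eventually.of_forall fun x => ?_)
  simp [mul_comm]

/-- A function of linear growth belongs to `L²_{1/a}`, because `x² / a` is bounded. -/
theorem memLp_weighted (ha : a.IsDegenerate) {w : ℝ → ℝ} (hw : Continuous w) {C : ℝ}
    (hC : ∀ x ∈ Ioo (0 : ℝ) 1, |w x| ≤ x * C) : MemLp w 2 (weightedMeasure a) ∧
      ∫ x, w x ^ 2 ∂weightedMeasure a ≤ C ^ 2 / a 1 := by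
  have ha1 : 0 < a 1 := a.pos 1 ⟨one_pos, le_rfl⟩
  have hb : ∀ x ∈ Ioo (0 : ℝ) 1, w x ^ 2 / a x ≤ C ^ 2 / a 1 := fun x hx => by
    have hp := a.pos x (Ioo_subset_Ioc_self hx)
    rw [div_le_div_iff₀ hp ha1]
    have h1 : w x ^ 2 ≤ (x * C) ^ 2 := by
      rw [← sq_abs]
      gcongr
      exact hC x hx
    have h2 := ha.sq_mul_le (Ioo_subset_Ioc_self hx)
    nlinarith [sq_nonneg C]
  have h0 : ∀ x ∈ Ioo (0 : ℝ) 1, 0 ≤ w x ^ 2 / a x := fun x hx =>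
    div_nonneg (sq_nonneg _) (a.pos x (Ioo_subset_Ioc_self hx)).le
  have hint : Integrable (fun x => w x ^ 2 / a x) lebesgue01 := by
    refine Integrable.of_bound (C := C ^ 2 / a 1) ?_ ?_
    · have : ContinuousOn (fun x => w x ^ 2 / a x) (Ioo 0 1) :=
        (hw.pow 2).continuousOn.div (a.continuousOn.mono Ioo_subset_Icc_self)
          fun x hx => (a.pos x (Ioo_subset_Ioc_self hx)).ne'
      exact this.aestronglyMeasurable measurableSet_Ioo
    · filter_upwards [ae_restrict_mem measurableSet_Ioo] with x hx
      rw [Real.norm_of_nonneg (h0 x hx)]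
      exact hb x hx
  constructor
  · rw [memLp_two_iff_integrable_sq hw.aestronglyMeasurable]
    exact integrable_weighted_iff.2 hint
  · rw [integral_weighted]
    calc ∫ x in Ioo (0 : ℝ) 1, w x ^ 2 / a x ≤ ∫ x in Ioo (0 : ℝ) 1, C ^ 2 / a 1 :=
          setIntegral_mono_on hint (integrable_const _) measurableSet_Ioo hb
      _ = C ^ 2 / a 1 := by simp

theorem L2.abs_primitive_le (g : L2) (x : ℝ) : |primitive g x| ≤ ‖g‖ := by
  have h1 : |primitive g x| ≤ ∫ s in Ioo (0 : ℝ) 1, |g s| := by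
    calc |primitive g x| ≤ ∫ s in uIoc 0 x, |g s| ∂lebesgue01 :=
          intervalIntegral.norm_integral_le_integral_norm_uIoc (f := g) (μ := lebesgue01)
      _ ≤ ∫ s, |g s| ∂lebesgue01 :=
          setIntegral_le_integral g.integrable.abs (Eventually.of_forall fun _ => abs_nonneg _)
  have h2 := sq_integral_mul_le (Lp.memLp g).norm (memLp_const (μ := lebesgue01) (1 : ℝ))
  have h3 : ∫ s, g s ^ 2 ∂lebesgue01 = ‖g‖ ^ 2 := by
    rw [← norm_toLp_sq (Lp.memLp g), Lp.toLp_coeFn]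
  simp only [Real.norm_eq_abs, mul_one, sq_abs, h3, one_pow] at h2
  have h4 : ∫ s : ℝ, (1 : ℝ) ∂lebesgue01 = 1 := by simp
  rw [h4, mul_one] at h2
  exact h1.trans (abs_le_of_sq_le_sq h2 (norm_nonneg g) |>.trans' (le_abs_self _))

theorem L2.memLp_primitive (g : L2) : MemLp (primitive g) 2 lebesgue01 :=
  MemLp.of_bound (continuous_primitive g.integrable).aestronglyMeasurable ‖g‖
    (Eventually.of_forall g.abs_primitive_le)

/-- A linear map from `L²(0,1)` to continuous functions of linear growth, as a bounded operator
into `L²_{1/a}`. -/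
noncomputable def toWeighted (ha : a.IsDegenerate) (T : L2 →ₗ[ℝ] ℝ → ℝ)
    (hc : ∀ g, Continuous (T g)) (hT : ∀ g, ∀ x ∈ Ioo (0 : ℝ) 1, |T g x| ≤ x * ‖g‖) :
    L2 →L[ℝ] L2w a :=
  LinearMap.mkContinuous
    { toFun := fun g => (memLp_weighted ha (hc g) (hT g)).1.toLp (T g)
      map_add' := fun g h => by
        rw [← MemLp.toLp_add]
        congr 1
        exact map_add T g h
      map_smul' := fun c g => by
        rw [RingHom.id_apply, ← MemLp.toLp_const_smul]
        congr 1
        exact map_smul T c g }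
    √(1 / a 1) fun g => by
      refine le_of_sq_le_sq ?_ (by positivity)
      have ha1 : 0 < a 1 := a.pos 1 ⟨one_pos, le_rfl⟩
      rw [LinearMap.coe_mk, AddHom.coe_mk, norm_toLp_sq, mul_pow, Real.sq_sqrt (by positivity)]
      refine (memLp_weighted ha (hc g) (hT g)).2.trans_eq ?_
      ring

theorem toWeighted_ae_eq (ha : a.IsDegenerate) (T : L2 →ₗ[ℝ] ℝ → ℝ)
    (hc : ∀ g, Continuous (T g)) (hT : ∀ g, ∀ x ∈ Ioo (0 : ℝ) 1, |T g x| ≤ x * ‖g‖) (g : L2) :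
    toWeighted ha T hc hT g =ᵐ[lebesgue01] T g :=
  ae_weighted_iff.1 (memLp_weighted ha (hc g) (hT g)).1.coeFn_toLp

/-- `g ↦ ∫₀ˣ g`. -/
noncomputable def primitiveₗ : L2 →ₗ[ℝ] ℝ → ℝ where
  toFun g := primitive g
  map_add' g h := by
    rw [primitive_congr (Lp.coeFn_add g h), primitive_add g.integrable h.integrable]
  map_smul' c g := by
    rw [primitive_congr (Lp.coeFn_smul c g), primitive_smul, RingHom.id_apply]

/-- `g ↦ ∫₀ˣ ∫₀ʸ g`. -/
noncomputable def secondPrimitiveₗ : L2 →ₗ[ℝ] ℝ → ℝ where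
  toFun g x := ∫ y in (0 : ℝ)..x, primitive g y
  map_add' g h := by
    ext x
    rw [primitive_congr (Lp.coeFn_add g h), primitive_add g.integrable h.integrable]
    exact intervalIntegral.integral_add ((continuous_primitive g.integrable).intervalIntegrable _ _)
      ((continuous_primitive h.integrable).intervalIntegrable _ _)
  map_smul' c g := by
    ext x
    rw [primitive_congr (Lp.coeFn_smul c g), primitive_smul]
    exact intervalIntegral.integral_smul c _

theorem hasDerivAt_secondPrimitiveₗ (g : L2) (x : ℝ) :
    HasDerivAt (secondPrimitiveₗ g) (primitive g x) x :=
  ((continuous_primitive g.integrable).integral_hasStrictDerivAt 0 x).hasDerivAt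

theorem continuous_secondPrimitiveₗ (g : L2) : Continuous (secondPrimitiveₗ g) :=
  continuous_iff_continuousAt.2 fun x => (hasDerivAt_secondPrimitiveₗ g x).continuousAt

theorem abs_secondPrimitiveₗ_le (g : L2) {x : ℝ} (hx : x ∈ Ioo (0 : ℝ) 1) :
    |secondPrimitiveₗ g x| ≤ x * ‖g‖ := by
  have := intervalIntegral.norm_integral_le_of_norm_le_const (a := 0) (b := x) (C := ‖g‖)
    (f := primitive g) fun y _ => g.abs_primitive_le y
  rw [sub_zero, abs_of_pos hx.1, mul_comm] at this
  exact this

theorem secondPrimitiveₗ_eq_primitive (g : L2) :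
    EqOn (secondPrimitiveₗ g) (primitive (primitive g)) (Icc 0 1) := fun _ hx =>
  (primitive_eq (primitive g) hx).symm

/-- The second primitive as a bounded operator `L²(0,1) → L²_{1/a}(0,1)`. -/
noncomputable def secondPrimitive (ha : a.IsDegenerate) : L2 →L[ℝ] L2w a :=
  toWeighted ha secondPrimitiveₗ continuous_secondPrimitiveₗ fun g _ hx =>
    abs_secondPrimitiveₗ_le g hx

theorem secondPrimitive_ae_eq (ha : a.IsDegenerate) (g : L2) :
    secondPrimitive ha g =ᵐ[lebesgue01] secondPrimitiveₗ g :=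
  toWeighted_ae_eq _ _ _ _ g

/-- The multiplier `m(x) = (2x-1)²` for `x ≥ 1/2`, `m(x) = 0` for `x ≤ 1/2`. -/
noncomputable def cutoff (x : ℝ) : ℝ := max 0 (2 * x - 1) ^ 2

theorem continuous_cutoff : Continuous cutoff := by
  unfold cutoff
  fun_prop

theorem cutoff_of_le {x : ℝ} (hx : x ≤ 1 / 2) : cutoff x = 0 := by
  rw [cutoff, max_eq_left (by linarith)]
  simp

theorem cutoff_of_ge {x : ℝ} (hx : 1 / 2 ≤ x) : cutoff x = (2 * x - 1) ^ 2 := by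
  rw [cutoff, max_eq_right (by linarith)]

theorem cutoff_nonneg (x : ℝ) : 0 ≤ cutoff x := sq_nonneg _

theorem cutoff_le {x : ℝ} (hx : x ∈ Ioo (0 : ℝ) 1) : cutoff x ≤ x := by
  rcases le_total x (1 / 2) with h | h
  · rw [cutoff_of_le h]
    exact hx.1.le
  · rw [cutoff_of_ge h]
    nlinarith [hx.2]

/-- The multiplier operator `g ↦ m ∫₀ˣ g`, where `m` is the cutoff; on `g = v''` it is `m v'`. -/
noncomputable def multiplier (ha : a.IsDegenerate) : L2 →L[ℝ] L2w a :=
  toWeighted ha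
    { toFun := fun g x => cutoff x * primitive g x
      map_add' := fun g h => by
        ext x
        have := congrFun (map_add primitiveₗ g h) x
        simp only [primitiveₗ, LinearMap.coe_mk, AddHom.coe_mk, Pi.add_apply] at this
        rw [this, mul_add]
        rfl
      map_smul' := fun c g => by
        ext x
        have := congrFun (map_smul primitiveₗ c g) x
        simp only [primitiveₗ, LinearMap.coe_mk, AddHom.coe_mk, Pi.smul_apply, smul_eq_mul] at this
        simp only [this, RingHom.id_apply, Pi.smul_apply, smul_eq_mul]
        ring }
    (fun g => continuous_cutoff.mul (continuous_primitive g.integrable)) fun g x hx => by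
      simp only [LinearMap.coe_mk, AddHom.coe_mk]
      rw [abs_mul, abs_of_nonneg (cutoff_nonneg x)]
      exact mul_le_mul (cutoff_le hx) (g.abs_primitive_le x) (abs_nonneg _) hx.1.le

theorem multiplier_ae_eq (ha : a.IsDegenerate) (g : L2) :
    multiplier ha g =ᵐ[lebesgue01] fun x => cutoff x * primitive g x :=
  toWeighted_ae_eq _ _ _ _ g

/-- The primitive as a bounded operator on `L²(0,1)`. -/
noncomputable def primitiveL : L2 →L[ℝ] L2 :=
  LinearMap.mkContinuous
    { toFun := fun g => g.memLp_primitive.toLp (primitive g)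
      map_add' := fun g h => by
        rw [← MemLp.toLp_add]
        congr 1
        exact map_add primitiveₗ g h
      map_smul' := fun c g => by
        rw [RingHom.id_apply, ← MemLp.toLp_const_smul]
        congr 1
        exact map_smul primitiveₗ c g }
    1 fun g => by
      refine le_of_sq_le_sq ?_ (by positivity)
      rw [LinearMap.coe_mk, AddHom.coe_mk, norm_toLp_sq, one_mul]
      calc ∫ x, primitive g x ^ 2 ∂lebesgue01 ≤ ∫ x, ‖g‖ ^ 2 ∂lebesgue01 := by
            refine integral_mono
              (integrable_of_continuous ((continuous_primitive g.integrable).pow 2))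
              (integrable_const _) fun x => ?_
            simp only
            rw [← sq_abs]
            gcongr
            exact g.abs_primitive_le x
        _ = ‖g‖ ^ 2 := by simp

theorem primitiveL_ae_eq (g : L2) : primitiveL g =ᵐ[lebesgue01] primitive g :=
  g.memLp_primitive.coeFn_toLp

end Weight

/-! ### Second derivatives of elements of `H²_{1/a}` -/

open ContinuousLinearMap

theorem memLp_one : MemLp (fun _ : ℝ => (1 : ℝ)) 2 lebesgue01 := memLp_const 1

theorem memLp_id : MemLp (fun x : ℝ => x) 2 lebesgue01 :=
  memLp_Ioo_of_continuousOn continuous_id.continuousOn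

/-- The orthogonal complement in `L²(0,1)` of the affine functions.  It consists of the second
derivatives of the elements of `H²_{1/a}(0,1)`. -/
noncomputable def curvatureSpace : Submodule ℝ L2 :=
  (ℝ ∙ (memLp_one.toLp _ : L2))ᗮ ⊓ (ℝ ∙ (memLp_id.toLp _ : L2))ᗮ

instance : CompleteSpace curvatureSpace :=
  IsClosed.completeSpace_coe (hs :=
    (Submodule.isClosed_orthogonal (ℝ ∙ (memLp_one.toLp _ : L2))).inter
      (Submodule.isClosed_orthogonal (ℝ ∙ (memLp_id.toLp _ : L2))))

theorem mem_curvatureSpace_iff_integral {g : L2} :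
    g ∈ curvatureSpace ↔ ∫ x in Ioo (0 : ℝ) 1, g x = 0 ∧ ∫ x in Ioo (0 : ℝ) 1, x * g x = 0 := by
  rw [curvatureSpace, Submodule.mem_inf, Submodule.mem_orthogonal_singleton_iff_inner_right,
    Submodule.mem_orthogonal_singleton_iff_inner_right]
  have h1 : inner ℝ (memLp_one.toLp _ : L2) g = ∫ x in Ioo (0 : ℝ) 1, g x := by
    rw [← Lp.toLp_coeFn g (Lp.memLp g), inner_toLp_toLp]
    simp
  have h2 : inner ℝ (memLp_id.toLp _ : L2) g = ∫ x in Ioo (0 : ℝ) 1, x * g x := by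
    rw [← Lp.toLp_coeFn g (Lp.memLp g), inner_toLp_toLp]
    simp
  rw [h1, h2]

theorem secondPrimitiveₗ_one (g : L2) :
    secondPrimitiveₗ g 1 = (∫ x in Ioo (0 : ℝ) 1, g x) - ∫ x in Ioo (0 : ℝ) 1, x * g x := by
  have h := integral_primitive_mul g.integrable (integrable_const (1 : ℝ))
  simp only [mul_one, intervalIntegral.integral_const, smul_eq_mul] at h
  have h2 : Integrable (fun x => x * g x) lebesgue01 := memLp_id.integrable_mul (Lp.memLp g)
  rw [← integral_sub g.integrable h2]
  refine (integral_Ioo_eq _).symm.trans (h.trans ?_)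
  exact integral_congr_ae (Eventually.of_forall fun x => by ring)

/-- Orthogonality to affine functions means that the first and second primitives vanish at `1`,
which are the boundary conditions `u'(1) = u(1) = 0`. -/
theorem mem_curvatureSpace_iff {g : L2} :
    g ∈ curvatureSpace ↔ primitive g 1 = 0 ∧ secondPrimitiveₗ g 1 = 0 := by
  rw [mem_curvatureSpace_iff_integral, secondPrimitiveₗ_one, primitive_one]
  constructor
  · rintro ⟨h1, h2⟩
    simp [h1, h2]
  · rintro ⟨h1, h2⟩
    refine ⟨h1, ?_⟩
    linarith

/-- An affine function in `curvatureSpace` vanishes. -/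
theorem eq_zero_of_ae_eq_affine {g : L2} (hg : g ∈ curvatureSpace) {α β : ℝ}
    (h : g =ᵐ[lebesgue01] fun x => α + β * x) : g = 0 := by
  obtain ⟨h1, h2⟩ := mem_curvatureSpace_iff_integral.1 hg
  rw [← inner_self_eq_zero (𝕜 := ℝ), L2.inner_eq]
  have h3 : Integrable (fun x => x * g x) lebesgue01 := memLp_id.integrable_mul (Lp.memLp g)
  have e : ∫ x in Ioo (0 : ℝ) 1, g x * g x = ∫ x in Ioo (0 : ℝ) 1, (α * g x + β * (x * g x)) := by
    refine integral_congr_ae ?_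
    filter_upwards [h] with x hx
    nth_rewrite 1 [hx]
    ring
  rw [e, integral_add (g.integrable.const_mul α) (h3.const_mul β), integral_const_mul,
    integral_const_mul, h1, h2]
  simp

section

variable {a : Coefficient}

theorem H2w.fst_ae_eq (u : H2w a) :
    (u : Jet a).snd.fst =ᵐ[lebesgue01] primitive (secondDeriv u) ∧
      (u : Jet a).fst =ᵐ[lebesgue01] secondPrimitiveₗ (secondDeriv u) ∧
      primitive (secondDeriv u) 1 = 0 ∧ secondPrimitiveₗ (secondDeriv u) 1 = 0 := by
  obtain ⟨h1, h2, h3, h4⟩ := u.2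
  obtain ⟨e1, z1⟩ := h2.ae_eq_primitive (L2.integrable _) (L2.integrable _) h4
  obtain ⟨e0, z0⟩ := h1.ae_eq_primitive (L2w.integrable _) (L2.integrable _) h3
  have e2 : primitive (u : Jet a).snd.fst = primitive (primitive (secondDeriv u)) :=
    primitive_congr e1
  rw [e2] at e0 z0
  refine ⟨e1, ?_, z1, ?_⟩
  · filter_upwards [e0, ae_restrict_mem measurableSet_Ioo] with x hx hx'
    rw [hx, secondPrimitiveₗ_eq_primitive _ (Ioo_subset_Icc_self hx')]
  · rw [secondPrimitiveₗ_eq_primitive _ (right_mem_Icc.2 zero_le_one), z0]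

theorem secondDeriv_mem (u : H2w a) : secondDeriv u ∈ curvatureSpace :=
  mem_curvatureSpace_iff.2 ⟨(H2w.fst_ae_eq u).2.2.1, (H2w.fst_ae_eq u).2.2.2⟩

variable (ha : a.IsDegenerate)

theorem incl_eq (u : H2w a) : incl a u = secondPrimitive ha (secondDeriv u) := by
  refine Lp.ext (ae_weighted_iff.2 ?_)
  exact (H2w.fst_ae_eq u).2.1.trans (secondPrimitive_ae_eq ha _).symm

/-- The triple `(∬ g, ∫ g, g)`. -/
noncomputable def jet : L2 →L[ℝ] Jet a :=
  ((WithLp.prodContinuousLinearEquiv 2 ℝ (L2w a) (WithLp 2 (L2 × L2))).symm :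
      L2w a × WithLp 2 (L2 × L2) →L[ℝ] Jet a) ∘L
    ((secondPrimitive ha).prod
      (((WithLp.prodContinuousLinearEquiv 2 ℝ L2 L2).symm : L2 × L2 →L[ℝ] WithLp 2 (L2 × L2)) ∘L
        (primitiveL.prod (ContinuousLinearMap.id ℝ L2))))

theorem jet_mem (g : curvatureSpace) : jet ha (g : L2) ∈ H2w a := by
  obtain ⟨h1, h2⟩ := mem_curvatureSpace_iff.1 g.2
  have e0 : (jet ha (g : L2)).fst =ᵐ[lebesgue01] primitive (primitive (g : L2)) := by
    filter_upwards [secondPrimitive_ae_eq ha (g : L2), ae_restrict_mem measurableSet_Ioo]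
      with x hx hx'
    rw [← secondPrimitiveₗ_eq_primitive _ (Ioo_subset_Icc_self hx'), ← hx]
    rfl
  have e1 : (jet ha (g : L2)).snd.fst =ᵐ[lebesgue01] primitive (g : L2) := primitiveL_ae_eq _
  have hc := continuous_primitive (g : L2).integrable
  refine ⟨?_, ?_, ?_, ?_⟩
  · exact (hasWeakDeriv_primitive (integrable_of_continuous hc)).congr e0 e1
  · exact (hasWeakDeriv_primitive (g : L2).integrable).congr e1 (ae_eq_refl _)
  · refine ⟨_, (continuous_primitive (integrable_of_continuous hc)).continuousOn, e0,
      primitive_zero _, ?_⟩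
    rw [← secondPrimitiveₗ_eq_primitive _ (right_mem_Icc.2 zero_le_one), h2]
  · exact ⟨_, hc.continuousOn, e1, primitive_zero _, h1⟩

/-- `H²_{1/a}` is parametrised by the second derivative. -/
noncomputable def curvatureEquiv : H2w a ≃L[ℝ] curvatureSpace :=
  ContinuousLinearEquiv.equivOfInverse
    ((WithLp.sndL 2 ℝ L2 L2 ∘L WithLp.sndL 2 ℝ (L2w a) (WithLp 2 (L2 × L2)) ∘L
      (H2w a).subtypeL).codRestrict curvatureSpace secondDeriv_mem)
    ((jet ha ∘L curvatureSpace.subtypeL).codRestrict (H2w a) (jet_mem ha))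
    (fun u => by
      have h0 := incl_eq ha u
      have h1 : (u : Jet a).snd.fst = primitiveL (secondDeriv u) :=
        Lp.ext ((H2w.fst_ae_eq u).1.trans (primitiveL_ae_eq _).symm)
      refine Subtype.ext (WithLp.ofLp_injective 2 (Prod.ext h0.symm ?_))
      exact WithLp.ofLp_injective 2 (Prod.ext h1.symm rfl))
    (fun g => Subtype.ext rfl)

theorem coe_curvatureEquiv (u : H2w a) : (curvatureEquiv ha u : L2) = secondDeriv u := rfl

/-! ### The inverse of the generator on the energy space -/

/-- The energy space `H²_{1/a} × L²_{1/a}` with the norm `‖(u,q)‖² = ‖u''‖² + ‖q‖²`, which the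
evolution preserves; `u` is represented by `u''`. -/
noncomputable abbrev EnergySpace (a : Coefficient) : Type := WithLp 2 (curvatureSpace × L2w a)

/-- The identification of `𝓗₀` with the energy space. -/
noncomputable def toEnergy : H0 a ≃L[ℝ] EnergySpace a :=
  ((curvatureEquiv ha).prodCongr (ContinuousLinearEquiv.refl ℝ (L2w a))).trans
    (WithLp.prodContinuousLinearEquiv 2 ℝ curvatureSpace (L2w a)).symm

theorem toEnergy_fst (U : H0 a) : (toEnergy ha U).fst = curvatureEquiv ha U.1 := rfl

theorem toEnergy_snd (U : H0 a) : (toEnergy ha U).snd = U.2 := rfl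

/-- The inclusion `H²_{1/a} ⊆ L²_{1/a}` in terms of the second derivative. -/
noncomputable def curvatureIncl : curvatureSpace →L[ℝ] L2w a :=
  secondPrimitive ha ∘L curvatureSpace.subtypeL

/-- The inverse of the generator `(v, w) ↦ (w, -Av)`.  With `j` the inclusion of `H²_{1/a}` into
`L²_{1/a}`, and `A⁻¹ = j*` for the inner product `∫ u'' v''`, it is `(p, q) ↦ (-j* q, j p)`. -/
noncomputable def generatorInv : EnergySpace a →L[ℝ] EnergySpace a :=
  ((WithLp.prodContinuousLinearEquiv 2 ℝ curvatureSpace (L2w a)).symm :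
      curvatureSpace × L2w a →L[ℝ] EnergySpace a) ∘L
    ((-(adjoint (curvatureIncl ha)) ∘L WithLp.sndL 2 ℝ curvatureSpace (L2w a)).prod
      (curvatureIncl ha ∘L WithLp.fstL 2 ℝ curvatureSpace (L2w a)))

theorem generatorInv_fst (x : EnergySpace a) :
    (generatorInv ha x).fst = -adjoint (curvatureIncl ha) x.snd := rfl

theorem generatorInv_snd (x : EnergySpace a) :
    (generatorInv ha x).snd = curvatureIncl ha x.fst := rfl

theorem energy_inner_eq (x y : EnergySpace a) :
    inner ℝ x y = inner ℝ x.fst y.fst + inner ℝ x.snd y.snd := WithLp.prod_inner_apply x y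

theorem adjoint_generatorInv : adjoint (generatorInv ha) = -generatorInv ha := by
  refine ((eq_adjoint_iff _ _).2 fun x y => ?_).symm
  rw [energy_inner_eq, energy_inner_eq, _root_.neg_apply, WithLp.neg_fst, WithLp.neg_snd,
    generatorInv_fst, generatorInv_snd, generatorInv_fst, generatorInv_snd]
  simp only [neg_neg, inner_neg_left, inner_neg_right, adjoint_inner_left, adjoint_inner_right]
  ring

/-- The second derivative of a test function, as an element of `L²(0,1)`. -/
noncomputable def IsTestFunction.curvature {φ : ℝ → ℝ} (h : IsTestFunction φ) : L2 :=
  h.deriv.deriv.memLp.toLp _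

theorem IsTestFunction.curvature_ae_eq {φ : ℝ → ℝ} (h : IsTestFunction φ) :
    h.curvature =ᵐ[lebesgue01] _root_.deriv (_root_.deriv φ) := MemLp.coeFn_toLp _

theorem IsTestFunction.primitive_curvature {φ : ℝ → ℝ} (h : IsTestFunction φ) :
    EqOn (primitive h.curvature) (_root_.deriv φ) (Icc 0 1) := fun x hx => by
  rw [primitive_congr h.curvature_ae_eq, primitive_eq _ hx, h.deriv.intervalIntegral_deriv,
    h.deriv.eq_zero (x := 0) (by simp), sub_zero]

theorem IsTestFunction.secondPrimitive_curvature {φ : ℝ → ℝ} (h : IsTestFunction φ) :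
    EqOn (secondPrimitiveₗ h.curvature) φ (Icc 0 1) := fun x hx => by
  have e : secondPrimitiveₗ h.curvature x = ∫ y in (0 : ℝ)..x, _root_.deriv φ y := by
    refine intervalIntegral.integral_congr fun y hy => ?_
    rw [uIcc_of_le hx.1] at hy
    exact h.primitive_curvature ⟨hy.1, hy.2.trans hx.2⟩
  rw [e, h.intervalIntegral_deriv, h.eq_zero (x := 0) (by simp), sub_zero]

theorem IsTestFunction.curvature_mem {φ : ℝ → ℝ} (h : IsTestFunction φ) :
    h.curvature ∈ curvatureSpace := by
  rw [mem_curvatureSpace_iff, h.primitive_curvature (right_mem_Icc.2 zero_le_one),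
    h.secondPrimitive_curvature (right_mem_Icc.2 zero_le_one), h.eq_zero (by simp),
    h.deriv.eq_zero (by simp)]
  exact ⟨rfl, rfl⟩

theorem inner_curvatureIncl_test {φ : ℝ → ℝ} (h : IsTestFunction φ) (w : L2w a) :
    inner ℝ w (curvatureIncl ha ⟨h.curvature, h.curvature_mem⟩) =
      ∫ x in Ioo (0 : ℝ) 1, (w x / a x) * φ x := by
  rw [L2w.inner_eq]
  refine integral_congr_ae ?_
  filter_upwards [secondPrimitive_ae_eq ha h.curvature, ae_restrict_mem measurableSet_Ioo]
    with x hx hx'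
  have : (curvatureIncl ha ⟨h.curvature, h.curvature_mem⟩ : L2w a) x = φ x := by
    rw [← h.secondPrimitive_curvature (Ioo_subset_Icc_self hx'), ← hx]
    rfl
  rw [this]
  ring

theorem inner_curvature_test {φ : ℝ → ℝ} (h : IsTestFunction φ) (g : L2) :
    inner ℝ g h.curvature = ∫ x in Ioo (0 : ℝ) 1, g x * deriv (deriv φ) x := by
  rw [L2.inner_eq]
  refine integral_congr_ae ?_
  filter_upwards [h.curvature_ae_eq] with x hx
  rw [hx]

/-- The second derivatives of test functions are dense in `curvatureSpace`. -/
theorem eq_zero_of_inner_curvature {g : curvatureSpace}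
    (h : ∀ φ (hφ : IsTestFunction φ), inner ℝ (g : L2) hφ.curvature = 0) : g = 0 := by
  obtain ⟨α, β, he⟩ := ae_eq_affine_of_test (g : L2).integrable fun φ hφ => by
    rw [← inner_curvature_test hφ]
    exact h φ hφ
  exact Subtype.ext (eq_zero_of_ae_eq_affine g.2 he)

/-- `A u = w` if and only if `u'' = j* w`. -/
theorem isBeamOperator_iff (u : H2w a) (w : L2w a) :
    IsBeamOperator u w ↔ curvatureEquiv ha u = adjoint (curvatureIncl ha) w := by
  have key : ∀ φ (hφ : IsTestFunction φ),
      inner ℝ ((curvatureEquiv ha u - adjoint (curvatureIncl ha) w : curvatureSpace) : L2)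
        hφ.curvature = (∫ x in Ioo (0 : ℝ) 1, secondDeriv u x * deriv (deriv φ) x) -
          ∫ x in Ioo (0 : ℝ) 1, (w x / a x) * φ x := by
    intro φ hφ
    rw [← inner_curvatureIncl_test ha hφ, ← inner_curvature_test hφ, ← adjoint_inner_left,
      Submodule.coe_sub, inner_sub_left]
    rfl
  constructor
  · intro h
    refine sub_eq_zero.1 (eq_zero_of_inner_curvature fun φ hφ => ?_)
    rw [key, h φ hφ, sub_self]
  · intro h φ hφ
    have := key φ hφ
    rw [h, sub_self] at this
    simp only [ZeroMemClass.coe_zero, inner_zero_left] at this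
    linarith

/-- `generatorInv` is the inverse of the generator: `𝒜 U = F` if and only if `U = 𝒜⁻¹ F`. -/
theorem isGenerator_iff (U F : H0 a) :
    IsGenerator U F ↔ toEnergy ha U = generatorInv ha (toEnergy ha F) := by
  rw [IsGenerator, isBeamOperator_iff ha, incl_eq ha, map_neg]
  constructor
  · rintro ⟨h1, h2⟩
    exact WithLp.ofLp_injective 2 (Prod.ext h2 h1)
  · intro h
    exact ⟨congrArg WithLp.snd h, congrArg WithLp.fst h⟩

theorem injective_curvatureIncl : Function.Injective (curvatureIncl ha) := by
  rw [injective_iff_map_eq_zero]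
  intro g hg
  have h0 : (secondPrimitiveₗ (g : L2)) =ᵐ[lebesgue01] 0 := by
    have h1 := secondPrimitive_ae_eq ha (g : L2)
    have h2 : secondPrimitive ha (g : L2) =ᵐ[lebesgue01] 0 := by
      have : secondPrimitive ha (g : L2) = 0 := hg
      rw [this]
      exact ae_weighted_iff.1 (Lp.coeFn_zero ℝ 2 (weightedMeasure a))
    exact h1.symm.trans h2
  have h1 : EqOn (secondPrimitiveₗ (g : L2)) 0 (Icc 0 1) :=
    eqOn_of_ae_eq (continuous_secondPrimitiveₗ _).continuousOn continuousOn_const h0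
  have h2 : EqOn (primitive (g : L2)) 0 (Ioo 0 1) := fun x hx => by
    refine (hasDerivAt_secondPrimitiveₗ (g : L2) x).unique ?_
    refine (hasDerivAt_const x (0 : ℝ)).congr_of_eventuallyEq ?_
    filter_upwards [Icc_mem_nhds hx.1 hx.2] with y hy
    exact h1 hy
  have h3 : HasWeakDeriv 0 (g : L2) :=
    (hasWeakDeriv_primitive (g : L2).integrable).congr (by
      filter_upwards [ae_restrict_mem measurableSet_Ioo] with x hx
      exact (h2 hx).symm) (ae_eq_refl _)
  have hloc : IntegrableOn (g : L2) (Ioo 0 1) volume := (g : L2).integrable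
  have h4 := ae_eq_zero_of_test hloc.locallyIntegrableOn fun φ hφ => by
    have := h3 φ hφ
    simp only [Pi.zero_apply, zero_mul, integral_zero] at this
    linarith
  exact Subtype.ext (Lp.eq_zero_iff_ae_eq_zero.2 h4)

theorem locallyIntegrableOn_div (w : L2w a) :
    LocallyIntegrableOn (fun x => w x / a x) (Ioo 0 1) := by
  have hinv : ContinuousOn (fun x => (a x)⁻¹) (Ioo 0 1) :=
    (a.continuousOn.mono Ioo_subset_Icc_self).inv₀
      fun x hx => (a.pos x (Ioo_subset_Ioc_self hx)).ne'
  have hw : IntegrableOn w (Ioo 0 1) volume := w.integrable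
  simpa only [div_eq_mul_inv] using
    hw.locallyIntegrableOn.mul_continuousOn hinv isOpen_Ioo.isLocallyClosed

/-- The range of `j` contains the test functions, which separate the points of `L²_{1/a}`. -/
theorem injective_adjoint_curvatureIncl :
    Function.Injective (adjoint (curvatureIncl ha)) := by
  rw [injective_iff_map_eq_zero]
  intro w hw
  have h0 := ae_eq_zero_of_test (locallyIntegrableOn_div w) fun φ hφ => by
    rw [← inner_curvatureIncl_test ha hφ, ← adjoint_inner_left, hw, inner_zero_left]
  refine Lp.eq_zero_iff_ae_eq_zero.2 (ae_weighted_iff.2 ?_)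
  filter_upwards [h0, ae_restrict_mem measurableSet_Ioo] with x hx hx'
  exact (div_eq_zero_iff.1 hx).resolve_right (a.pos x (Ioo_subset_Ioc_self hx')).ne'

theorem injective_generatorInv : Function.Injective (generatorInv ha) := by
  rw [injective_iff_map_eq_zero]
  intro x hx
  have h1 := congrArg WithLp.fst hx
  have h2 := congrArg WithLp.snd hx
  rw [generatorInv_fst, WithLp.zero_fst, neg_eq_zero] at h1
  rw [generatorInv_snd, WithLp.zero_snd] at h2
  exact WithLp.ofLp_injective 2 (Prod.ext
    (injective_curvatureIncl ha (h2.trans (map_zero _).symm))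
    (injective_adjoint_curvatureIncl ha (h1.trans (map_zero _).symm)))

end

/-! ### Regularity of the second derivative and its trace at `1` -/

section Potential

variable {k : ℝ → ℝ}

/-- The solution of `G'' = k`, `G(1) = G'(1) = 0`.  It is used for `k = w / a` with `w ∈ L²_{1/a}`,
where `x k` is integrable on `(0,1)` but `k` need not be. -/
noncomputable def potential (k : ℝ → ℝ) (x : ℝ) : ℝ :=
  (∫ s in x..1, s * k s) - x * ∫ s in x..1, k s

theorem intervalIntegrable_of_mul (hk : Integrable (fun x => x * k x) lebesgue01) {x y : ℝ}
    (hx : 0 < x) (hxy : x ≤ y) (hy : y ≤ 1) : IntervalIntegrable k volume x y := by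
  have h1 : IntervalIntegrable (fun x => x * k x) volume x y :=
    (integrable_iff_intervalIntegrable.1 hk).mono_set (by
      rw [uIcc_of_le hxy, uIcc_of_le zero_le_one]
      exact Icc_subset_Icc hx.le hy)
  have hpos : ∀ s ∈ uIcc x y, 0 < s := fun s hs => by
    rw [uIcc_of_le hxy] at hs
    exact hx.trans_le hs.1
  have h2 := h1.mul_continuousOn (continuousOn_id.inv₀ fun s hs => (hpos s hs).ne')
  refine h2.congr fun s hs => ?_
  have := (hpos s (uIoc_subset_uIcc hs)).ne'
  simp only [Pi.inv_apply, id]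
  field_simp

theorem continuousOn_tail (hk : Integrable (fun x => x * k x) lebesgue01) :
    ContinuousOn (fun x => ∫ s in x..1, k s) (Ioc 0 1) := by
  intro x hx
  have hx2 : 0 < x / 2 := half_pos hx.1
  have h1 : ContinuousOn (fun x => ∫ s in x..1, k s) (uIcc (x / 2) 1) := by
    refine intervalIntegral.continuousOn_primitive_interval_left ?_
    rw [← intervalIntegrable_iff']
    exact intervalIntegrable_of_mul hk hx2 (by linarith [hx.2]) le_rfl
  rw [uIcc_of_le (by linarith [hx.2])] at h1
  refine (h1 x ⟨by linarith [hx.1], hx.2⟩).mono_of_mem_nhdsWithin ?_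
  rw [← Ici_inter_Iic]
  exact inter_mem (mem_nhdsWithin_of_mem_nhds (Ici_mem_nhds (half_lt_self hx.1)))
    (mem_nhdsWithin.2 ⟨univ, isOpen_univ, trivial, fun y hy => hy.2.2⟩)

theorem continuousOn_potential (hk : Integrable (fun x => x * k x) lebesgue01) :
    ContinuousOn (potential k) (Ioc 0 1) := by
  refine ContinuousOn.sub ?_ (continuousOn_id.mul (continuousOn_tail hk))
  have : ContinuousOn (fun x => ∫ s in x..1, s * k s) (uIcc 0 1) := by
    refine intervalIntegral.continuousOn_primitive_interval_left ?_
    rw [← intervalIntegrable_iff']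
    exact integrable_iff_intervalIntegrable.1 hk
  rw [uIcc_of_le zero_le_one] at this
  exact this.mono Ioc_subset_Icc_self

theorem potential_eq (hk : Integrable (fun x => x * k x) lebesgue01) {x : ℝ}
    (hx : x ∈ Ioc (0 : ℝ) 1) :
    potential k x = ∫ s in x..1, (1 - x * s⁻¹) * (s * k s) := by
  have h1 : IntervalIntegrable (fun x => x * k x) volume x 1 :=
    (integrable_iff_intervalIntegrable.1 hk).mono_set (by
      rw [uIcc_of_le hx.2, uIcc_of_le zero_le_one]
      exact Icc_subset_Icc_left hx.1.le)
  have h2 := intervalIntegrable_of_mul hk hx.1 hx.2 le_rfl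
  rw [potential, ← intervalIntegral.integral_const_mul,
    ← intervalIntegral.integral_sub h1 (h2.const_mul x)]
  refine intervalIntegral.integral_congr fun s hs => ?_
  rw [uIcc_of_le hx.2] at hs
  have : s ≠ 0 := (hx.1.trans_le hs.1).ne'
  field_simp

theorem integrable_kernel (hk : Integrable (fun x => x * k x) lebesgue01) {χ : ℝ → ℝ}
    (hχ : Integrable χ lebesgue01) :
    Integrable ({p : ℝ × ℝ | p.1 ≤ p.2}.indicator
      (Function.uncurry fun x s => (1 - x * s⁻¹) * (χ x * (s * k s))))
      ((volume.restrict (Ioc 0 1)).prod (volume.restrict (Ioc 0 1))) := by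
  have h1 : Integrable (fun p : ℝ × ℝ => χ p.1 * (p.2 * k p.2))
      ((volume.restrict (Ioc 0 1)).prod (volume.restrict (Ioc 0 1))) :=
    Integrable.mul_prod (integrable_iff_intervalIntegrable.1 hχ).1
      (integrable_iff_intervalIntegrable.1 hk).1
  have hm : Measurable fun p : ℝ × ℝ => 1 - p.1 * p.2⁻¹ := by fun_prop
  have hset : MeasurableSet {p : ℝ × ℝ | p.1 ≤ p.2} :=
    measurableSet_le measurable_fst measurable_snd
  refine h1.mono ((hm.aestronglyMeasurable.mul h1.aestronglyMeasurable).indicator hset) ?_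
  have hae : ∀ᵐ p : ℝ × ℝ ∂(volume.restrict (Ioc (0 : ℝ) 1)).prod (volume.restrict (Ioc (0 : ℝ) 1)),
      p ∈ Ioc (0 : ℝ) 1 ×ˢ Ioc (0 : ℝ) 1 := by
    rw [Measure.prod_restrict]
    exact ae_restrict_mem (measurableSet_Ioc.prod measurableSet_Ioc)
  filter_upwards [hae] with p hp
  by_cases h : p.1 ≤ p.2
  · rw [indicator_of_mem (by exact h)]
    simp only [Function.uncurry]
    rw [norm_mul]
    refine mul_le_of_le_one_left (norm_nonneg _) ?_
    have h0 : 0 ≤ p.1 * p.2⁻¹ := mul_nonneg hp.1.1.le (inv_nonneg.2 hp.2.1.le)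
    have h2 : p.1 * p.2⁻¹ ≤ 1 := by
      rw [← div_eq_mul_inv]
      exact (div_le_one hp.2.1).2 h
    rw [Real.norm_of_nonneg (by linarith)]
    linarith
  · rw [indicator_of_notMem (by exact h), norm_zero]
    exact norm_nonneg _

/-- Two integrations by parts, moving the double integration from `k` to `χ`.  No integrability of
`k` near `0` is needed, as the kernel satisfies `0 ≤ s - x ≤ s`. -/
theorem integral_potential_mul (hk : Integrable (fun x => x * k x) lebesgue01) {χ : ℝ → ℝ}
    (hχ : Integrable χ lebesgue01) :
    ∫ x in Ioo (0 : ℝ) 1, potential k x * χ x =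
      ∫ s in Ioo (0 : ℝ) 1, k s * ∫ x in (0 : ℝ)..s, (s - x) * χ x := by
  have h := integral_triangle_swap zero_le_one (integrable_kernel hk hχ)
  rw [← integral_Ioo_eq, ← integral_Ioo_eq] at h
  refine Eq.trans (setIntegral_congr_fun measurableSet_Ioo fun x hx => ?_)
    (h.trans (setIntegral_congr_fun measurableSet_Ioo fun s hs => ?_))
  · rw [potential_eq hk (Ioo_subset_Ioc_self hx), ← intervalIntegral.integral_mul_const]
    exact intervalIntegral.integral_congr fun s _ => by ring
  · rw [← intervalIntegral.integral_const_mul]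
    refine intervalIntegral.integral_congr fun x _ => ?_
    have := hs.1.ne'
    field_simp

theorem integrable_potential (hk : Integrable (fun x => x * k x) lebesgue01) :
    Integrable (potential k) lebesgue01 := by
  have h := (integrable_kernel hk (integrable_const (1 : ℝ))).integral_prod_left
  have h' : IntegrableOn (fun x => ∫ y in Ioc (0 : ℝ) 1, {p : ℝ × ℝ | p.1 ≤ p.2}.indicator
      (Function.uncurry fun x s => (1 - x * s⁻¹) * (1 * (s * k s))) (x, y)) (Ioc 0 1) volume := h
  rw [integrableOn_Ioc_iff_integrableOn_Ioo] at h'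
  refine IntegrableOn.congr_fun h' (fun x hx => ?_) measurableSet_Ioo
  have e : (fun y => {p : ℝ × ℝ | p.1 ≤ p.2}.indicator
      (Function.uncurry fun x s => (1 - x * s⁻¹) * (1 * (s * k s))) (x, y)) =
      (Ici x).indicator fun s => (1 - x * s⁻¹) * (s * k s) := by
    ext y
    simp [indicator, Function.uncurry]
  simp only [e]
  rw [setIntegral_indicator measurableSet_Ici, potential_eq hk (Ioo_subset_Ioc_self hx),
    intervalIntegral.integral_of_le hx.2.le, ← integral_Icc_eq_integral_Ioc]
  congr 2
  ext y
  simp only [mem_inter_iff, mem_Ioc, mem_Ici, mem_Icc]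
  exact ⟨fun h => ⟨h.2, h.1.2⟩, fun h => ⟨⟨hx.1.trans_le h.1, h.2⟩, h.1⟩⟩

/-- Taylor's formula with integral remainder. -/
theorem integral_sub_mul_deriv2 {θ θ₁ θ₂ : ℝ → ℝ} (h1 : ∀ x, HasDerivAt θ (θ₁ x) x)
    (h2 : ∀ x, HasDerivAt θ₁ (θ₂ x) x) (hc : Continuous θ₂) (b s : ℝ) :
    ∫ x in b..s, (s - x) * θ₂ x = θ s - θ b - (s - b) * θ₁ b := by
  have hd : ∀ x ∈ uIcc b s, HasDerivAt (fun x => (s - x) * θ₁ x + θ x) ((s - x) * θ₂ x) x := by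
    intro x _
    have := (((hasDerivAt_id x).const_sub s).mul (h2 x)).add (h1 x)
    refine this.congr_deriv ?_
    simp
  rw [intervalIntegral.integral_eq_sub_of_hasDerivAt hd
    (((continuous_const.sub continuous_id).mul hc).intervalIntegrable _ _)]
  ring

/-- A weak solution of `g'' = k` differs from the potential of `k` by an affine function. -/
theorem ae_eq_affine_add_potential (hk : Integrable (fun x => x * k x) lebesgue01) {g : ℝ → ℝ}
    (hg : Integrable g lebesgue01)
    (h : ∀ φ, IsTestFunction φ → ∫ x in Ioo (0 : ℝ) 1, g x * deriv (deriv φ) x =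
      ∫ x in Ioo (0 : ℝ) 1, k x * φ x) :
    ∃ α β : ℝ, g =ᵐ[lebesgue01] fun x => α + β * x + potential k x := by
  obtain ⟨α, β, he⟩ := ae_eq_affine_of_test (hg.sub (integrable_potential hk)) fun φ hφ => by
    simp only [Pi.sub_apply, sub_mul]
    have i1 := integrable_mul_of_test hg hφ.deriv.deriv.1.continuous hφ.deriv.deriv.2.1
    have i2 := integrable_mul_of_test (integrable_potential hk) hφ.deriv.deriv.1.continuous
      hφ.deriv.deriv.2.1
    rw [integral_sub i1 i2, h φ hφ, integral_potential_mul hk hφ.deriv.deriv.integrable,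
      sub_eq_zero]
    refine integral_congr_ae (Eventually.of_forall fun s => ?_)
    simp only
    rw [integral_sub_mul_deriv2 (θ := φ) (θ₁ := deriv φ)
      (fun x => ((hφ.1.differentiable (by simp)).differentiableAt).hasDerivAt)
      (fun x => ((hφ.deriv.1.differentiable (by simp)).differentiableAt).hasDerivAt)
      hφ.deriv.deriv.1.continuous, hφ.eq_zero (x := 0) (by simp),
      hφ.deriv.eq_zero (x := 0) (by simp)]
    simp
  refine ⟨α, β, ?_⟩
  filter_upwards [he] with x hx
  rw [← hx, Pi.sub_apply]
  ring

/-- The lift `θ(x) = m(x) (x - 1)` of the unit slope at `1`: `θ(1) = 0` and `θ'(1) = 1`. -/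
noncomputable def lift (x : ℝ) : ℝ := cutoff x * (x - 1)

/-- The second derivative of `lift`. -/
noncomputable def lift'' : ℝ → ℝ := (Ioi (1 / 2)).indicator fun x => 24 * x - 16

theorem memLp_lift'' : MemLp lift'' 2 lebesgue01 :=
  (memLp_Ioo_of_continuousOn (by fun_prop)).indicator measurableSet_Ioi

theorem integral_indicator_half (F : ℝ → ℝ) {s : ℝ} (hs : 1 / 2 ≤ s) :
    ∫ x in (0 : ℝ)..s, (Ioi (1 / 2)).indicator F x = ∫ x in (1 / 2 : ℝ)..s, F x := by
  rw [intervalIntegral.integral_of_le (by linarith), intervalIntegral.integral_of_le hs,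
    setIntegral_indicator measurableSet_Ioi]
  congr 2
  ext x
  simp only [mem_inter_iff, mem_Ioc, mem_Ioi]
  exact ⟨fun h => ⟨h.2, h.1.2⟩, fun h => ⟨⟨by linarith [h.1], h.2⟩, h.1⟩⟩

theorem integral_sub_mul_lift'' {s : ℝ} (hs : 0 < s) :
    ∫ x in (0 : ℝ)..s, (s - x) * lift'' x = lift s := by
  have e : (fun x => (s - x) * lift'' x) =
      (Ioi (1 / 2)).indicator fun x => (s - x) * (24 * x - 16) := by
    ext x
    simp [lift'', indicator]
  simp only [e]
  rcases le_total s (1 / 2) with h | h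
  · rw [lift, cutoff_of_le h, zero_mul]
    refine intervalIntegral.integral_zero_ae (Eventually.of_forall fun x hx => ?_)
    rw [uIoc_of_le hs.le] at hx
    exact indicator_of_notMem (notMem_Ioi.2 (hx.2.trans h)) _
  · rw [integral_indicator_half _ h, integral_sub_mul_deriv2
      (θ := fun x => 4 * x ^ 3 - 8 * x ^ 2 + 5 * x - 1) (θ₁ := fun x => 12 * x ^ 2 - 16 * x + 5)
      (fun x => ?_) (fun x => ?_) (by fun_prop), lift, cutoff_of_ge h]
    · ring
    · have := ((((hasDerivAt_pow 3 x).const_mul 4).sub ((hasDerivAt_pow 2 x).const_mul 8)).add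
        ((hasDerivAt_id x).const_mul 5)).sub_const 1
      exact this.congr_deriv (by norm_num; ring)
    · have := (((hasDerivAt_pow 2 x).const_mul 12).sub ((hasDerivAt_id x).const_mul 16)).add_const 5
      exact this.congr_deriv (by norm_num; ring)

theorem integral_affine_mul_lift'' (α β : ℝ) :
    ∫ x in Ioo (0 : ℝ) 1, (α + β * x) * lift'' x = α + β := by
  have e : (fun x => (α + β * x) * lift'' x) =
      (Ioi (1 / 2)).indicator fun x => (α + β * x) * (24 * x - 16) := by
    ext x
    simp [lift'', indicator]
  simp only [e]
  have hd : ∀ x ∈ uIcc (1 / 2 : ℝ) 1, HasDerivAt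
      (fun x => α * (12 * x ^ 2 - 16 * x) + β * (8 * x ^ 3 - 8 * x ^ 2))
      ((α + β * x) * (24 * x - 16)) x := fun x _ => by
    have h1 := (((hasDerivAt_pow 2 x).const_mul 12).sub
      ((hasDerivAt_id x).const_mul 16)).const_mul α
    have h2 := (((hasDerivAt_pow 3 x).const_mul 8).sub
      ((hasDerivAt_pow 2 x).const_mul 8)).const_mul β
    exact (h1.add h2).congr_deriv (by norm_num; ring)
  rw [integral_Ioo_eq, integral_indicator_half _ (by norm_num),
    intervalIntegral.integral_eq_sub_of_hasDerivAt hd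
      ((by fun_prop : Continuous _).intervalIntegrable _ _)]
  ring

/-- Integration by parts against the lift recovers the value at `1`. -/
theorem integral_mul_lift'' (hk : Integrable (fun x => x * k x) lebesgue01) (α β : ℝ) {g : ℝ → ℝ}
    (h : g =ᵐ[lebesgue01] fun x => α + β * x + potential k x) (hg : MemLp g 2 lebesgue01) :
    (∫ x in Ioo (0 : ℝ) 1, g x * lift'' x) - ∫ x in Ioo (0 : ℝ) 1, k x * lift x = α + β := by
  have haff : MemLp (fun x : ℝ => α + β * x) 2 lebesgue01 :=
    memLp_Ioo_of_continuousOn (by fun_prop)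
  have i1 : Integrable (fun x => (α + β * x) * lift'' x) lebesgue01 :=
    haff.integrable_mul memLp_lift''
  have i0 : Integrable (fun x => g x * lift'' x) lebesgue01 := hg.integrable_mul memLp_lift''
  have e1 : ∫ x in Ioo (0 : ℝ) 1, potential k x * lift'' x =
      (∫ x in Ioo (0 : ℝ) 1, g x * lift'' x) - (α + β) := by
    rw [← integral_affine_mul_lift'' α β, ← integral_sub i0 i1]
    refine integral_congr_ae ?_
    filter_upwards [h] with x hx
    rw [hx]
    ring
  rw [integral_potential_mul hk (memLp_lift''.integrable (by norm_num))] at e1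
  have e2 : ∫ s in Ioo (0 : ℝ) 1, k s * ∫ x in (0 : ℝ)..s, (s - x) * lift'' x =
      ∫ x in Ioo (0 : ℝ) 1, k x * lift x :=
    setIntegral_congr_fun measurableSet_Ioo fun s hs => by
      rw [integral_sub_mul_lift'' hs.1]
  rw [e2] at e1
  linarith

theorem hasDerivAt_tail (hk : Integrable (fun x => x * k x) lebesgue01)
    (hc : ContinuousOn k (Ioc 0 1)) {x : ℝ} (hx : x ∈ Ioo (0 : ℝ) 1) :
    HasDerivAt (fun x => ∫ s in x..1, k s) (-k x) x := by
  have hn : Ioc (0 : ℝ) 1 ∈ 𝓝 x := Ioc_mem_nhds hx.1 hx.2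
  refine intervalIntegral.integral_hasDerivAt_left
    (intervalIntegrable_of_mul hk hx.1 hx.2.le le_rfl) ?_ (hc.continuousAt hn)
  exact hc.mono Ioo_subset_Ioc_self |>.stronglyMeasurableAtFilter isOpen_Ioo x hx

theorem hasDerivAt_potential (hk : Integrable (fun x => x * k x) lebesgue01)
    (hc : ContinuousOn k (Ioc 0 1)) {x : ℝ} (hx : x ∈ Ioo (0 : ℝ) 1) :
    HasDerivAt (potential k) (-∫ s in x..1, k s) x := by
  have hc' : ContinuousOn (fun x => x * k x) (Ioc 0 1) := continuousOn_id.mul hc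
  have hn : Ioc (0 : ℝ) 1 ∈ 𝓝 x := Ioc_mem_nhds hx.1 hx.2
  have h1 : HasDerivAt (fun x => ∫ s in x..1, s * k s) (-(x * k x)) x :=
    intervalIntegral.integral_hasDerivAt_left
      ((integrable_iff_intervalIntegrable.1 hk).mono_set (by
        rw [uIcc_of_le hx.2.le, uIcc_of_le zero_le_one]
        exact Icc_subset_Icc_left hx.1.le))
      ((hc'.mono Ioo_subset_Ioc_self).stronglyMeasurableAtFilter isOpen_Ioo x hx)
      (hc'.continuousAt hn)
  exact (h1.sub ((hasDerivAt_id x).mul (hasDerivAt_tail hk hc hx))).congr_deriv (by simp)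

end Potential

section Trace

variable {a : Coefficient} (ha : a.IsDegenerate)

theorem integrable_mul_div_coefficient {a : Coefficient} (ha : a.IsDegenerate) (w : L2w a) :
    Integrable (fun x => x * (w x / a x)) lebesgue01 := by
  have hid := (memLp_weighted ha (w := fun x => x) continuous_id (C := 1) fun x hx => by
    rw [abs_of_pos hx.1, mul_one]).1
  have := integrable_weighted_iff.1 (hid.integrable_mul (Lp.memLp w))
  refine this.congr (Eventually.of_forall fun x => ?_)
  simp only [Pi.mul_apply]
  ring

theorem continuous_lift : Continuous lift :=
  continuous_cutoff.mul (continuous_id.sub continuous_const)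

theorem memLp_lift {a : Coefficient} (ha : a.IsDegenerate) : MemLp lift 2 (weightedMeasure a) :=
  (memLp_weighted ha continuous_lift (C := 1) fun x hx => by
    rw [lift, abs_mul, abs_of_nonneg (cutoff_nonneg x), mul_one]
    refine (mul_le_of_le_one_right (cutoff_nonneg x) ?_).trans (cutoff_le hx)
    rw [abs_le]
    constructor <;> linarith [hx.1, hx.2]).1

/-- The functional `w ↦ u''(1)`, where `A u = w`. -/
noncomputable def traceFunctional : L2w a →L[ℝ] ℝ :=
  innerSL ℝ (memLp_lift''.toLp lift'' : L2) ∘L curvatureSpace.subtypeL ∘L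
    adjoint (curvatureIncl ha) - innerSL ℝ ((memLp_lift ha).toLp lift)

theorem traceFunctional_apply (w : L2w a) :
    traceFunctional ha w =
      (∫ x in Ioo (0 : ℝ) 1, (adjoint (curvatureIncl ha) w : L2) x * lift'' x) -
        ∫ x in Ioo (0 : ℝ) 1, w x / a x * lift x := by
  have h1 : inner ℝ (memLp_lift''.toLp lift'' : L2) (adjoint (curvatureIncl ha) w : L2) =
      ∫ x in Ioo (0 : ℝ) 1, (adjoint (curvatureIncl ha) w : L2) x * lift'' x := by
    rw [← Lp.toLp_coeFn (adjoint (curvatureIncl ha) w : L2) (Lp.memLp _), inner_toLp_toLp,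
      Lp.toLp_coeFn]
    exact integral_congr_ae (Eventually.of_forall fun x => mul_comm _ _)
  have h2 : inner ℝ ((memLp_lift ha).toLp lift) w = ∫ x in Ioo (0 : ℝ) 1, w x / a x * lift x := by
    nth_rewrite 1 [← Lp.toLp_coeFn w (Lp.memLp _)]
    rw [inner_toLp_toLp, integral_weighted]
    exact integral_congr_ae (Eventually.of_forall fun x => by simp only; ring)
  rw [← h1, ← h2]
  rfl

/-- The second derivative `j* w` of the solution of `A u = w`: representation by the potential, and
value at `1`. -/
theorem exists_affine_add_potential (w : L2w a) {k : ℝ → ℝ}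
    (hkw : k =ᵐ[lebesgue01] fun x => w x / a x) :
    Integrable (fun x => x * k x) lebesgue01 ∧
    ∃ α β : ℝ, (adjoint (curvatureIncl ha) w : L2) =ᵐ[lebesgue01]
      (fun x => α + β * x + potential k x) ∧ traceFunctional ha w = α + β := by
  have hk : Integrable (fun x => x * k x) lebesgue01 :=
    (integrable_mul_div_coefficient ha w).congr (hkw.mono fun x hx => by simp only [hx])
  refine ⟨hk, ?_⟩
  obtain ⟨α, β, h⟩ := ae_eq_affine_add_potential hk (adjoint (curvatureIncl ha) w : L2).integrable
    fun φ hφ => by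
      have e : ∫ x in Ioo (0 : ℝ) 1, k x * φ x = ∫ x in Ioo (0 : ℝ) 1, w x / a x * φ x :=
        integral_congr_ae (hkw.mono fun x hx => by simp only [hx])
      rw [e, ← inner_curvature_test hφ, ← inner_curvatureIncl_test ha hφ, ← adjoint_inner_left]
      rfl
  refine ⟨α, β, h, ?_⟩
  have e : ∫ x in Ioo (0 : ℝ) 1, w x / a x * lift x = ∫ x in Ioo (0 : ℝ) 1, k x * lift x :=
    integral_congr_ae (hkw.mono fun x hx => by simp only [hx])
  rw [traceFunctional_apply, e]
  exact integral_mul_lift'' hk α β h (Lp.memLp _)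

theorem hasSecondDerivAtOne_traceFunctional {u : H2w a} {w : L2w a} (h : IsBeamOperator u w) :
    HasSecondDerivAtOne u (traceFunctional ha w) := by
  obtain ⟨hk, α, β, he, ht⟩ := exists_affine_add_potential ha w (ae_eq_refl _)
  rw [← (isBeamOperator_iff ha u w).1 h, coe_curvatureEquiv] at he
  refine ⟨_, ?_, he, ?_⟩
  · exact (continuous_const.add (continuous_const.mul continuous_id)).continuousOn.add
      (continuousOn_potential hk)
  · simp [potential, ht]

theorem HasSecondDerivAtOne.unique {u : H2w a} {c d : ℝ} (h : HasSecondDerivAtOne u c)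
    (h' : HasSecondDerivAtOne u d) : c = d := by
  obtain ⟨v, hv, e, rfl⟩ := h
  obtain ⟨w, hw, e', rfl⟩ := h'
  have := e.symm.trans e'
  rw [lebesgue01, restrict_Ioo_eq_restrict_Ioc] at this
  exact Measure.eqOn_Ioc_of_ae_eq volume this hv hw (right_mem_Ioc.2 zero_lt_one)

/-- The observation vector: `⟪traceVector, F⟫` is the trace at `1` of the second derivative of the
first component of `𝒜⁻¹ F`. -/
noncomputable def traceVector : EnergySpace a :=
  WithLp.toLp 2 (0, -(InnerProductSpace.toDual ℝ (L2w a)).symm (traceFunctional ha))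

theorem inner_traceVector (x : EnergySpace a) :
    inner ℝ (traceVector ha) x = traceFunctional ha (-x.snd) := by
  rw [energy_inner_eq]
  simp [traceVector, WithLp.toLp_fst, WithLp.toLp_snd]

/-- Along `𝒜 U = F` the trace of `U` is a bounded functional of `F`; continuity of the
representative on `(0,1]` makes it unique. -/
theorem hasSecondDerivAtOne_iff {U F : H0 a} (h : IsGenerator U F) {c : ℝ} :
    HasSecondDerivAtOne U.1 c ↔ c = inner ℝ (traceVector ha) (toEnergy ha F) := by
  have h1 := hasSecondDerivAtOne_traceFunctional ha h.2
  have e : inner ℝ (traceVector ha) (toEnergy ha F) = traceFunctional ha (-F.2) := by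
    rw [inner_traceVector, toEnergy_snd]
  rw [e]
  exact ⟨fun h' => h'.unique h1, fun h' => h' ▸ h1⟩

/-! ### Hidden regularity -/

theorem L2.integral_sq (g : L2) : ∫ x in Ioo (0 : ℝ) 1, g x ^ 2 = ‖g‖ ^ 2 := by
  rw [← norm_toLp_sq (Lp.memLp g), Lp.toLp_coeFn]

theorem integral_half_le {F : ℝ → ℝ} (hF : Integrable F lebesgue01) (h0 : ∀ x, 0 ≤ F x) :
    ∫ x in (1 / 2 : ℝ)..1, F x ≤ ∫ x in Ioo (0 : ℝ) 1, F x := by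
  rw [integral_Ioo_eq]
  exact intervalIntegral.integral_mono_interval (by norm_num) (by norm_num) le_rfl
    (Eventually.of_forall h0) (integrable_iff_intervalIntegrable.1 hF)

theorem integral_cutoff_mul (F : ℝ → ℝ) :
    ∫ x in Ioo (0 : ℝ) 1, cutoff x * F x = ∫ x in (1 / 2 : ℝ)..1, (2 * x - 1) ^ 2 * F x := by
  rw [← integral_indicator_half _ (by norm_num), integral_Ioo_eq]
  refine intervalIntegral.integral_congr fun x _ => ?_
  by_cases h : x ∈ Ioi (1 / 2 : ℝ)
  · rw [indicator_of_mem h, cutoff_of_ge (le_of_lt h)]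
  · rw [indicator_of_notMem h, cutoff_of_le (not_lt.1 h), zero_mul]

theorem integral_half_congr {F G : ℝ → ℝ} (h : F =ᵐ[lebesgue01] G) :
    ∫ x in (1 / 2 : ℝ)..1, F x = ∫ x in (1 / 2 : ℝ)..1, G x := by
  rw [intervalIntegral.integral_of_le (by norm_num), intervalIntegral.integral_of_le (by norm_num),
    integral_Ioc_eq_integral_Ioo, integral_Ioc_eq_integral_Ioo]
  refine integral_congr_ae (ae_restrict_of_ae_restrict_of_subset ?_ h)
  exact Ioo_subset_Ioo_left (by norm_num)

theorem inner_multiplier (g : L2) (w : L2w a) :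
    inner ℝ (multiplier ha g) w =
      ∫ x in (1 / 2 : ℝ)..1, (2 * x - 1) ^ 2 * (primitive g x * (w x / a x)) := by
  rw [← integral_cutoff_mul, L2w.inner_eq]
  refine integral_congr_ae ?_
  filter_upwards [multiplier_ae_eq ha g] with x hx
  rw [hx]
  ring

/-- The kinetic part of the multiplier identity: `∫ m q_x q / a = -½ ∫ (m/a)' q²`, and
`|(m/a)'| ≤ 8 / a` on `[1/2, 1]` as `x |a'| ≤ 2 a`. -/
theorem inner_multiplier_kinetic (g : curvatureSpace) :
    0 ≤ 2 * inner ℝ (multiplier ha (g : L2)) (curvatureIncl ha g) +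
      8 * ‖curvatureIncl ha g‖ ^ 2 := by
  set q := secondPrimitiveₗ (g : L2) with hq
  set p := primitive (g : L2) with hp
  have hqc : Continuous q := continuous_secondPrimitiveₗ _
  have hpc : Continuous p := continuous_primitive (g : L2).integrable
  have hqe : curvatureIncl ha g =ᵐ[lebesgue01] q := secondPrimitive_ae_eq ha (g : L2)
  have hq1 : q 1 = 0 := (mem_curvatureSpace_iff.1 g.2).2
  have hsub : Icc (1 / 2 : ℝ) 1 ⊆ Icc 0 1 := Icc_subset_Icc_left (by norm_num)
  have hac : ContinuousOn a (Icc (1 / 2) 1) := a.continuousOn.mono hsub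
  have hane : ∀ x ∈ Icc (1 / 2 : ℝ) 1, a x ≠ 0 := fun x hx =>
    (a.pos x ⟨by linarith [hx.1], hx.2⟩).ne'
  have e1 : inner ℝ (multiplier ha (g : L2)) (curvatureIncl ha g) =
      ∫ x in (1 / 2 : ℝ)..1, (2 * x - 1) ^ 2 * (p x * (q x / a x)) := by
    rw [inner_multiplier]
    refine integral_half_congr ?_
    filter_upwards [hqe] with x hx
    rw [hx]
  have e2 : ∫ x in (1 / 2 : ℝ)..1, q x ^ 2 / a x ≤ ‖curvatureIncl ha g‖ ^ 2 := by
    rw [← real_inner_self_eq_norm_sq, L2w.inner_eq]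
    have e3 : ∫ x in (1 / 2 : ℝ)..1, q x ^ 2 / a x =
        ∫ x in (1 / 2 : ℝ)..1, (Ioo (0 : ℝ) 1).indicator
          (fun x => curvatureIncl ha g x * curvatureIncl ha g x / a x) x := by
      refine integral_half_congr ?_
      filter_upwards [hqe, ae_restrict_mem measurableSet_Ioo] with x hx hx'
      rw [indicator_of_mem hx', hx]
      ring
    rw [e3]
    refine (integral_half_le ((L2w.integrable_mul_div _ _).indicator measurableSet_Ioo)
      fun x => ?_).trans_eq (setIntegral_congr_fun measurableSet_Ioo fun x hx =>
        indicator_of_mem hx _)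
    refine indicator_nonneg (fun x hx => ?_) x
    exact div_nonneg (mul_self_nonneg _) (a.pos x (Ioo_subset_Ioc_self hx)).le
  have hc1 : ContinuousOn (fun x => (2 * x - 1) ^ 2 * (p x * (q x / a x))) (Icc (1 / 2) 1) :=
    (by fun_prop : Continuous fun x : ℝ => (2 * x - 1) ^ 2).continuousOn.mul
      (hpc.continuousOn.mul (hqc.continuousOn.div hac hane))
  have hc2 : ContinuousOn (fun x => q x ^ 2 / a x) (Icc (1 / 2) 1) :=
    (hqc.pow 2).continuousOn.div hac hane
  have key := intervalIntegral.sub_le_integral_of_hasDeriv_right_of_le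
    (g := fun x => (2 * x - 1) ^ 2 * (q x ^ 2 / a x))
    (g' := fun x => 2 * (2 * x - 1) * 2 * (q x ^ 2 / a x) + (2 * x - 1) ^ 2 *
      ((2 * q x * p x * a x - q x ^ 2 * deriv a x) / a x ^ 2))
    (φ := fun x => 2 * ((2 * x - 1) ^ 2 * (p x * (q x / a x))) + 8 * (q x ^ 2 / a x))
    (a := 1 / 2) (b := 1) (by norm_num)
    ((by fun_prop : Continuous fun x : ℝ => (2 * x - 1) ^ 2).continuousOn.mul hc2)
    (fun x hx => ?_)
    (((hc1.const_mul 2).add (hc2.const_mul 8)).integrableOn_Icc) (fun x hx => ?_)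
  · rw [intervalIntegral.integral_add ((hc1.const_mul 2).intervalIntegrable_of_Icc (by norm_num))
      ((hc2.const_mul 8).intervalIntegrable_of_Icc (by norm_num)),
      intervalIntegral.integral_const_mul, intervalIntegral.integral_const_mul, ← e1, hq1] at key
    norm_num at key
    linarith
  · have hx' : x ∈ Ioo (0 : ℝ) 1 := ⟨by linarith [hx.1], hx.2⟩
    have h1 : HasDerivAt (fun x : ℝ => (2 * x - 1) ^ 2) (2 * (2 * x - 1) * 2) x := by
      have := (((hasDerivAt_id x).const_mul 2).sub_const 1).pow 2
      exact this.congr_deriv (by simp)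
    have h2 : HasDerivAt (fun x => q x ^ 2) (2 * q x * p x) x :=
      ((hasDerivAt_secondPrimitiveₗ (g : L2) x).pow 2).congr_deriv (by simp [hq, hp])
    exact (h1.mul (h2.div (ha.hasDerivAt hx') (hane x (Ioo_subset_Icc_self hx)))).hasDerivWithinAt
  · have hx' : x ∈ Ioo (0 : ℝ) 1 := ⟨by linarith [hx.1], hx.2⟩
    have hpos := a.pos x (Ioo_subset_Ioc_self hx')
    have hb := ha.mul_deriv_le x hx'
    have hd : -deriv a x ≤ 4 * a x := by
      have := neg_abs_le (deriv a x)
      have h3 : 1 / 2 * |deriv a x| ≤ x * |deriv a x| := by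
        have := hx.1
        gcongr
      linarith
    have hm : (2 * x - 1) ^ 2 ≤ 1 := by nlinarith [hx.1, hx.2]
    have hQ : 0 ≤ q x ^ 2 / a x := div_nonneg (sq_nonneg _) hpos.le
    have e4 : (2 * q x * p x * a x - q x ^ 2 * deriv a x) / a x ^ 2 =
        2 * (p x * (q x / a x)) + (q x ^ 2 / a x) * (-deriv a x / a x) := by
      field_simp
      ring
    have h5 : -deriv a x / a x ≤ 4 := (div_le_iff₀ hpos).2 hd
    have h6 : (2 * x - 1) ^ 2 * ((q x ^ 2 / a x) * (-deriv a x / a x)) ≤ 4 * (q x ^ 2 / a x) := by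
      have h7 : (q x ^ 2 / a x) * (-deriv a x / a x) ≤ (q x ^ 2 / a x) * 4 := by gcongr
      have h8 : (2 * x - 1) ^ 2 * ((q x ^ 2 / a x) * 4) ≤ 1 * ((q x ^ 2 / a x) * 4) := by gcongr
      have h9 := mul_le_mul_of_nonneg_left h7 (sq_nonneg (2 * x - 1))
      linarith
    have h10 : 2 * (2 * x - 1) * 2 * (q x ^ 2 / a x) ≤ 4 * (q x ^ 2 / a x) := by
      refine mul_le_mul_of_nonneg_right ?_ hQ
      linarith [hx.2]
    rw [e4, mul_add]
    linarith

end Trace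

section HiddenRegularity

variable {a : Coefficient} (ha : a.IsDegenerate)

/-- The potential part of the multiplier identity, for `A u = -j y` with `y` in the energy space.
With `g = u''`, `p = u'` and `k = g''`, it is the integral over `[1/2, 1]` of
`(m p g' - m' p g - ½ m g²)' = m p k - m'' p g - (3/2) m' g²`. -/
theorem traceFunctional_sq_le (y : curvatureSpace) :
    traceFunctional ha (-curvatureIncl ha y) ^ 2 ≤
      2 * inner ℝ (multiplier ha (adjoint (curvatureIncl ha) (-curvatureIncl ha y) : L2))
        (curvatureIncl ha y) + 24 * ‖adjoint (curvatureIncl ha) (-curvatureIncl ha y)‖ ^ 2 := by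
  set w : L2w a := -curvatureIncl ha y with hw
  set γ : L2 := (adjoint (curvatureIncl ha) w : L2) with hγ
  set k : ℝ → ℝ := fun x => -(secondPrimitiveₗ (y : L2) x) / a x with hk
  have hwe : (w : ℝ → ℝ) =ᵐ[lebesgue01] fun x => -(secondPrimitiveₗ (y : L2) x) := by
    have h1 : (w : ℝ → ℝ) =ᵐ[lebesgue01] -(curvatureIncl ha y : ℝ → ℝ) :=
      ae_weighted_iff.1 (Lp.coeFn_neg _)
    have h2 : curvatureIncl ha y =ᵐ[lebesgue01] secondPrimitiveₗ (y : L2) :=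
      secondPrimitive_ae_eq ha (y : L2)
    filter_upwards [h1, h2] with x hx hx'
    rw [hx, Pi.neg_apply, hx']
  have hkw : k =ᵐ[lebesgue01] fun x => w x / a x := hwe.mono fun x hx => by simp only [hk, hx]
  have hkc : ContinuousOn k (Ioc 0 1) :=
    (continuous_secondPrimitiveₗ _).neg.continuousOn.div
      (a.continuousOn.mono Ioc_subset_Icc_self) fun x hx => (a.pos x hx).ne'
  obtain ⟨hki, α, β, hge, ht⟩ := exists_affine_add_potential ha w hkw
  set g : ℝ → ℝ := fun x => α + β * x + potential k x with hg
  set g₁ : ℝ → ℝ := fun x => β - ∫ s in x..1, k s with hg₁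
  set p : ℝ → ℝ := primitive γ with hp
  have hgc : ContinuousOn g (Ioc 0 1) :=
    (continuous_const.add (continuous_const.mul continuous_id)).continuousOn.add
      (continuousOn_potential hki)
  have hgi : Integrable g lebesgue01 := γ.integrable.congr hge
  have hgd : ∀ x ∈ Ioo (0 : ℝ) 1, HasDerivAt g (g₁ x) x := fun x hx => by
    have := (((hasDerivAt_id x).const_mul β).const_add α).add (hasDerivAt_potential hki hkc hx)
    exact this.congr_deriv (by simp [hg₁, sub_eq_add_neg])
  have hg₁d : ∀ x ∈ Ioo (0 : ℝ) 1, HasDerivAt g₁ (k x) x := fun x hx =>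
    ((hasDerivAt_tail hki hkc hx).const_sub β).congr_deriv (neg_neg _)
  have hpd : ∀ x ∈ Ioo (0 : ℝ) 1, HasDerivAt p (g x) x := fun x hx => by
    have h1 : IntervalIntegrable g volume 0 x :=
      (integrable_iff_intervalIntegrable.1 hgi).mono_set (by
        rw [uIcc_of_le hx.1.le, uIcc_of_le zero_le_one]
        exact Icc_subset_Icc_right hx.2.le)
    have h2 := intervalIntegral.integral_hasDerivAt_right h1
      ((hgc.mono Ioo_subset_Ioc_self).stronglyMeasurableAtFilter isOpen_Ioo x hx)
      (hgc.continuousAt (Ioc_mem_nhds hx.1 hx.2))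
    refine h2.congr_of_eventuallyEq ?_
    filter_upwards [Icc_mem_nhds hx.1 hx.2] with z hz
    rw [hp, primitive_congr hge, primitive_eq _ hz]
  have hpc : Continuous p := continuous_primitive γ.integrable
  have hp1 : p 1 = 0 := (mem_curvatureSpace_iff.1 (adjoint (curvatureIncl ha) w).2).1
  have hhalf : Icc (1 / 2 : ℝ) 1 ⊆ Ioc 0 1 := fun x hx => ⟨by linarith [hx.1], hx.2⟩
  have hm : Continuous fun x : ℝ => (2 * x - 1) ^ 2 := by fun_prop
  have hgc' := hgc.mono hhalf
  have hkc' := hkc.mono hhalf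
  have hg₁c : ContinuousOn g₁ (Icc (1 / 2) 1) :=
    continuousOn_const.sub ((continuousOn_tail hki).mono hhalf)
  have hc1 : ContinuousOn (fun x => (2 * x - 1) ^ 2 * (p x * k x)) (Icc (1 / 2) 1) :=
    hm.continuousOn.mul (hpc.continuousOn.mul hkc')
  have e1 : inner ℝ (multiplier ha γ) (curvatureIncl ha y) =
      -∫ x in (1 / 2 : ℝ)..1, (2 * x - 1) ^ 2 * (p x * k x) := by
    have h1 : curvatureIncl ha y = -w := by rw [hw, neg_neg]
    rw [h1, inner_neg_right, inner_multiplier]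
    congr 1
    refine integral_half_congr ?_
    filter_upwards [hkw] with x hx
    rw [hx]
  have e2 : ∫ x in (1 / 2 : ℝ)..1, g x ^ 2 ≤ ‖γ‖ ^ 2 := by
    have h1 : ∫ x in (1 / 2 : ℝ)..1, g x ^ 2 = ∫ x in (1 / 2 : ℝ)..1, γ x ^ 2 := by
      refine integral_half_congr ?_
      filter_upwards [hge] with x hx
      rw [hx]
    rw [h1, ← L2.integral_sq]
    exact integral_half_le (Lp.memLp γ).integrable_sq fun x => sq_nonneg _
  have i1 : IntervalIntegrable (fun x => (2 * x - 1) ^ 2 * (p x * k x)) volume (1 / 2) 1 :=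
    hc1.intervalIntegrable_of_Icc (by norm_num)
  have i2 : IntervalIntegrable (fun x => 10 * g x ^ 2) volume (1 / 2) 1 :=
    ((hgc'.pow 2).const_mul 10).intervalIntegrable_of_Icc (by norm_num)
  have key := intervalIntegral.sub_le_integral_of_hasDeriv_right_of_le
    (g := fun x => -((2 * x - 1) ^ 2 * (p x * g₁ x) - 4 * (2 * x - 1) * (p x * g x) -
      1 / 2 * ((2 * x - 1) ^ 2 * g x ^ 2)))
    (g' := fun x => -((2 * x - 1) ^ 2 * (p x * k x)) + 8 * (p x * g x) +
      6 * (2 * x - 1) * g x ^ 2)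
    (φ := fun x => -((2 * x - 1) ^ 2 * (p x * k x)) + (4 * ‖γ‖ ^ 2 + 10 * g x ^ 2))
    (a := 1 / 2) (b := 1) (by norm_num)
    (((hm.continuousOn.mul (hpc.continuousOn.mul hg₁c)).sub
      ((by fun_prop : Continuous fun x : ℝ => 4 * (2 * x - 1)).continuousOn.mul
        (hpc.continuousOn.mul hgc'))).sub
      ((hm.continuousOn.mul (hgc'.pow 2)).const_mul _)).neg
    (fun x hx => ?_)
    ((hc1.neg.add (continuousOn_const.add ((hgc'.pow 2).const_mul 10))).integrableOn_Icc)
    (fun x hx => ?_)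
  · have i1n : IntervalIntegrable (fun x => -((2 * x - 1) ^ 2 * (p x * k x))) volume (1 / 2) 1 :=
      i1.neg
    rw [intervalIntegral.integral_add i1n (intervalIntegrable_const.add i2),
      intervalIntegral.integral_add intervalIntegrable_const i2, intervalIntegral.integral_neg,
      ← e1, intervalIntegral.integral_const, intervalIntegral.integral_const_mul, hp1] at key
    have hg1 : g 1 = α + β := by simp [hg, potential]
    have hn : ‖adjoint (curvatureIncl ha) w‖ = ‖γ‖ := rfl
    rw [ht, hn, ← hg1]
    norm_num at key
    linarith
  · have hx' : x ∈ Ioo (0 : ℝ) 1 := ⟨by linarith [hx.1], hx.2⟩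
    have d0 : HasDerivAt (fun x : ℝ => 2 * x - 1) 2 x := by
      simpa using ((hasDerivAt_id x).const_mul 2).sub_const 1
    have d1 : HasDerivAt (fun x : ℝ => (2 * x - 1) ^ 2) (2 * (2 * x - 1) * 2) x :=
      (d0.pow 2).congr_deriv (by simp)
    have dg := hgd x hx'
    have dp := hpd x hx'
    have d := (((d1.mul (dp.mul (hg₁d x hx'))).sub ((d0.const_mul 4).mul (dp.mul dg))).sub
      ((d1.mul (dg.pow 2)).const_mul (1 / 2))).neg
    refine (d.congr_deriv ?_).hasDerivWithinAt
    simp only [Pi.mul_apply, Pi.pow_apply]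
    push_cast
    ring
  · have h1 : p x ^ 2 ≤ ‖γ‖ ^ 2 := by
      rw [← sq_abs]
      gcongr
      exact γ.abs_primitive_le x
    have h2 : 2 * (p x * g x) ≤ p x ^ 2 + g x ^ 2 := by nlinarith [sq_nonneg (p x - g x)]
    have h3 : (2 * x - 1) * g x ^ 2 ≤ 1 * g x ^ 2 := by
      gcongr
      linarith [hx.2]
    linarith

/-- The multiplier estimate for `U = 𝒜⁻¹ F`; the first summand on the right is the derivative of
`2 ⟪m u', u_t⟫` along the evolution. -/
theorem inner_traceVector_sq_le (F : EnergySpace a) :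
    inner ℝ (traceVector ha) F ^ 2 ≤
      2 * (inner ℝ (multiplier ha ((generatorInv ha F).fst : L2)) F.snd +
        inner ℝ (multiplier ha (F.fst : L2)) (generatorInv ha F).snd) +
      24 * ‖generatorInv ha F‖ ^ 2 := by
  have hdense := denseRange_of_skew (adjoint_generatorInv ha) (injective_generatorInv ha)
  refine hdense.induction_on (p := fun F => inner ℝ (traceVector ha) F ^ 2 ≤
      2 * (inner ℝ (multiplier ha ((generatorInv ha F).fst : L2)) F.snd +
        inner ℝ (multiplier ha (F.fst : L2)) (generatorInv ha F).snd) +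
      24 * ‖generatorInv ha F‖ ^ 2) F ?_ fun Z => ?_
  · have cf : Continuous fun x : EnergySpace a => x.fst :=
      (WithLp.fstL 2 ℝ curvatureSpace (L2w a)).continuous
    have cs : Continuous fun x : EnergySpace a => x.snd :=
      (WithLp.sndL 2 ℝ curvatureSpace (L2w a)).continuous
    have cB := (generatorInv ha).continuous
    refine isClosed_le ((continuous_const.inner continuous_id).pow 2) ?_
    refine (continuous_const.mul (Continuous.add ?_ ?_)).add (continuous_const.mul (cB.norm.pow 2))
    · exact ((multiplier ha).continuous.comp
        (continuous_subtype_val.comp (cf.comp cB))).inner cs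
    · exact ((multiplier ha).continuous.comp
        (continuous_subtype_val.comp cf)).inner (cs.comp cB)
  · set F := generatorInv ha Z with hF
    have hF2 : F.snd = curvatureIncl ha Z.fst := generatorInv_snd ha Z
    have hU1 : (generatorInv ha F).fst = adjoint (curvatureIncl ha) (-curvatureIncl ha Z.fst) := by
      rw [generatorInv_fst, hF2, map_neg]
    have h1 := traceFunctional_sq_le ha Z.fst
    have h2 := inner_multiplier_kinetic ha F.fst
    rw [inner_traceVector, WithLp.prod_norm_sq_eq_of_L2, hF2, hU1, generatorInv_snd]
    have h3 := sq_nonneg ‖curvatureIncl ha F.fst‖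
    linarith

/-- Hidden regularity: the boundary trace of a solution is bounded in `L²(0,R)` by the energy. -/
theorem isAdmissible_traceVector {S : ℝ → EnergySpace a →L[ℝ] EnergySpace a}
    (hS : IsUnitaryGroup (generatorInv ha) S) :
    IsAdmissible (generatorInv ha) S (traceVector ha) := by
  intro R hR
  set D : curvatureSpace →L[ℝ] L2w a := multiplier ha ∘L curvatureSpace.subtypeL with hD
  refine ⟨4 * ‖D‖ + 24 * R, by positivity, fun Y => ?_⟩
  set b := generatorInv ha Y with hb
  set N : EnergySpace a → ℝ := fun U => inner ℝ (D U.fst) U.snd with hN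
  have hNle : ∀ U, |N U| ≤ ‖D‖ * ‖U‖ ^ 2 := fun U => by
    have h1 : ‖U.fst‖ ≤ ‖U‖ := WithLp.norm_fst_le _ U
    have h2 : ‖U.snd‖ ≤ ‖U‖ := WithLp.norm_snd_le _ U
    calc |N U| ≤ ‖D U.fst‖ * ‖U.snd‖ := abs_real_inner_le_norm _ _
      _ ≤ (‖D‖ * ‖U‖) * ‖U‖ := by
        gcongr
        exact (D.le_opNorm _).trans (by gcongr)
      _ = _ := by ring
  have cf : Continuous fun x : EnergySpace a => x.fst :=
    (WithLp.fstL 2 ℝ curvatureSpace (L2w a)).continuous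
  have cs : Continuous fun x : EnergySpace a => x.snd :=
    (WithLp.sndL 2 ℝ curvatureSpace (L2w a)).continuous
  set N' : ℝ → ℝ := fun t => inner ℝ (D (S t b).fst) (S t Y).snd +
    inner ℝ (D (S t Y).fst) (S t b).snd with hN'
  have hd : ∀ t, HasDerivAt (fun t => N (S t b)) (N' t) t := fun t => by
    have h1 := hS.hasDerivAt Y t
    have h2 := (WithLp.fstL 2 ℝ curvatureSpace (L2w a)).hasFDerivAt.comp_hasDerivAt t h1
    have h3 := (WithLp.sndL 2 ℝ curvatureSpace (L2w a)).hasFDerivAt.comp_hasDerivAt t h1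
    exact (D.hasFDerivAt.comp_hasDerivAt t h2).inner ℝ h3
  have hN'c : Continuous N' :=
    ((D.continuous.comp (cf.comp (hS.continuous b))).inner (cs.comp (hS.continuous Y))).add
      ((D.continuous.comp (cf.comp (hS.continuous Y))).inner (cs.comp (hS.continuous b)))
  have hle : ∀ t, inner ℝ (traceVector ha) (S t Y) ^ 2 ≤ 2 * N' t + 24 * ‖b‖ ^ 2 := fun t => by
    have h := inner_traceVector_sq_le ha (S t Y)
    rw [hS.commute, hS.norm_apply] at h
    exact h
  have hint : ∫ t in (0 : ℝ)..R, inner ℝ (traceVector ha) (S t Y) ^ 2 ≤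
      ∫ t in (0 : ℝ)..R, (2 * N' t + 24 * ‖b‖ ^ 2) :=
    intervalIntegral.integral_mono_on hR.le
      (((continuous_const.inner (hS.continuous Y)).pow 2).intervalIntegrable _ _)
      (((continuous_const.mul hN'c).add continuous_const).intervalIntegrable _ _) fun t _ => hle t
  refine hint.trans ?_
  have hN'2 : Continuous fun t => 2 * N' t := continuous_const.mul hN'c
  rw [intervalIntegral.integral_add (hN'2.intervalIntegrable _ _)
    intervalIntegrable_const, intervalIntegral.integral_const_mul,
    intervalIntegral.integral_eq_sub_of_hasDerivAt (fun t _ => hd t)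
      (hN'c.intervalIntegrable _ _), intervalIntegral.integral_const]
  have h1 := abs_le.1 (hNle (S R b))
  have h2 := abs_le.1 (hNle (S 0 b))
  rw [hS.norm_apply] at h1 h2
  simp only [sub_zero, smul_eq_mul]
  linarith

end HiddenRegularity

/-! ### Mild and classical solutions as orbits -/

section Orbits

variable {a : Coefficient} (ha : a.IsDegenerate) {S : ℝ → EnergySpace a →L[ℝ] EnergySpace a}

/-- Completeness is transported from `curvatureSpace`; it is needed for Bochner integrals with
values in `𝓗₀`. -/
theorem completeSpace_H2w {a : Coefficient} (ha : a.IsDegenerate) : CompleteSpace (H2w a) :=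
  (completeSpace_congr (e := (curvatureEquiv ha).toEquiv)
    (curvatureEquiv ha).isUniformEmbedding).2 inferInstance

theorem isMildSolution_orbit (hS : IsUnitaryGroup (generatorInv ha) S) (T : ℝ) (VT : H0 a) :
    IsMildSolution T VT fun t => (toEnergy ha).symm (S (t - T) (toEnergy ha VT)) where
  continuousOn := ((toEnergy ha).symm.continuous.comp
    ((hS.continuous _).comp (continuous_sub_right T))).continuousOn
  integrated t _ := by
    have := completeSpace_H2w ha
    have hc : Continuous fun s => S (s - T) (toEnergy ha VT) :=
      (hS.continuous _).comp (continuous_sub_right T)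
    have h := ((toEnergy ha).symm : EnergySpace a →L[ℝ] H0 a).intervalIntegral_comp_comm
      (hc.intervalIntegrable (μ := volume) T t)
    simp only [ContinuousLinearEquiv.coe_coe] at h
    rw [isGenerator_iff ha, h, ContinuousLinearEquiv.apply_symm_apply, map_sub,
      ContinuousLinearEquiv.apply_symm_apply, hS.integral_translate]

theorem IsMildSolution.eq_orbit (hS : IsUnitaryGroup (generatorInv ha) S) {T : ℝ} (hT : 0 ≤ T)
    {VT : H0 a} {V : ℝ → H0 a} (h : IsMildSolution T VT V) {t : ℝ} (ht : 0 ≤ t) :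
    toEnergy ha (V t) = S (t - T) (toEnergy ha VT) := by
  have := completeSpace_H2w ha
  refine hS.eq_of_mild (V := fun t => toEnergy ha (V t)) (adjoint_generatorInv ha)
    (injective_generatorInv ha) hT
    ((toEnergy ha).continuous.comp_continuousOn h.continuousOn) (fun s hs => ?_) ht
  have hsub : uIcc T s ⊆ Ici 0 := fun r hr => (le_min hT hs).trans hr.1
  have hint : IntervalIntegrable V volume T s := (h.continuousOn.mono hsub).intervalIntegrable
  have h1 := (toEnergy ha : H0 a →L[ℝ] EnergySpace a).intervalIntegral_comp_comm hint
  simp only [ContinuousLinearEquiv.coe_coe] at h1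
  have h2 := (isGenerator_iff ha _ _).1 (h.integrated s hs)
  rw [h1, h2, map_sub, map_sub, map_sub]

theorem isClassicalSolution_orbit (hS : IsUnitaryGroup (generatorInv ha) S) (T : ℝ)
    (Y : EnergySpace a) :
    IsClassicalSolution T ((toEnergy ha).symm (generatorInv ha Y))
      (fun t => (toEnergy ha).symm (S (t - T) (generatorInv ha Y))) ∧
      ∀ t, IsGenerator ((toEnergy ha).symm (S (t - T) (generatorInv ha Y)))
        ((toEnergy ha).symm (S (t - T) Y)) := by
  have hgen : ∀ t, IsGenerator ((toEnergy ha).symm (S (t - T) (generatorInv ha Y)))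
      ((toEnergy ha).symm (S (t - T) Y)) := fun t => by
    rw [isGenerator_iff ha, ContinuousLinearEquiv.apply_symm_apply,
      ContinuousLinearEquiv.apply_symm_apply, hS.commute]
  have hd : ∀ t, HasDerivAt (fun t => (toEnergy ha).symm (S (t - T) (generatorInv ha Y)))
      ((toEnergy ha).symm (S (t - T) Y)) t := fun t => by
    have h1 := (hS.hasDerivAt Y (t - T)).comp_sub_const t T
    exact ((toEnergy ha).symm : EnergySpace a →L[ℝ] H0 a).hasFDerivAt.comp_hasDerivAt t h1
  refine ⟨⟨?_, fun t ht => ?_, ?_⟩, hgen⟩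
  · refine (contDiff_one_iff_deriv.2 ⟨fun t => (hd t).differentiableAt, ?_⟩).contDiffOn
    rw [funext fun t => (hd t).deriv]
    exact (toEnergy ha).symm.continuous.comp ((hS.continuous Y).comp (continuous_sub_right T))
  · rw [(hd t).hasDerivWithinAt.derivWithin (uniqueDiffOn_Ici 0 t ht)]
    exact hgen t
  · simp [hS.zero]

/-- The time derivative of a classical solution is an orbit too. -/
theorem IsClassicalSolution.eq_orbit (hS : IsUnitaryGroup (generatorInv ha) S) {T : ℝ}
    (hT : 0 ≤ T) {VT : H0 a} {V : ℝ → H0 a} (h : IsClassicalSolution T VT V) {t : ℝ}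
    (ht : 0 ≤ t) :
    toEnergy ha (derivWithin V (Ici 0) t) =
      S (t - T) (toEnergy ha (derivWithin V (Ici 0) T)) := by
  have := completeSpace_H2w ha
  set F := derivWithin V (Ici 0) with hF
  have hFc : ContinuousOn F (Ici 0) :=
    h.contDiffOn.continuousOn_derivWithin (uniqueDiffOn_Ici 0) le_rfl
  have hgen : ∀ t, 0 ≤ t → toEnergy ha (V t) = generatorInv ha (toEnergy ha (F t)) := fun t ht =>
    (isGenerator_iff ha _ _).1 (h.equation t ht)
  have horb : toEnergy ha (V t) = S (t - T) (toEnergy ha VT) := by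
    refine hS.eq_of_mild (V := fun t => toEnergy ha (V t)) (adjoint_generatorInv ha)
      (injective_generatorInv ha) hT
      ((toEnergy ha).continuous.comp_continuousOn h.contDiffOn.continuousOn) (fun s hs => ?_) ht
    have hsub : uIcc T s ⊆ Ici 0 := fun r hr => (le_min hT hs).trans hr.1
    have hint : IntervalIntegrable F volume T s := (hFc.mono hsub).intervalIntegrable
    have h1 : ∫ r in T..s, F r = V s - VT := by
      rw [← h.final]
      refine intervalIntegral.integral_eq_sub_of_hasDeriv_right
        (h.contDiffOn.continuousOn.mono hsub) (fun r hr => ?_) hint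
      have hr0 : 0 < r := (le_min hT hs).trans_lt hr.1
      have hdiff := (h.contDiffOn.differentiableOn (by simp)) r hr0.le
      exact hdiff.hasDerivWithinAt.mono (Ioi_subset_Ici hr0.le)
    have h2 := ContinuousLinearMap.intervalIntegral_comp_comm
      ((generatorInv ha) ∘L (toEnergy ha : H0 a →L[ℝ] EnergySpace a)) hint
    simp only [ContinuousLinearMap.comp_apply, ContinuousLinearEquiv.coe_coe] at h2
    rw [h1] at h2
    rw [← map_sub, ← h2]
    exact intervalIntegral.integral_congr fun r hr => (hgen r (hsub hr)).symm
  refine injective_generatorInv ha ?_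
  rw [← hgen t ht, horb, ← h.final, hgen T hT, hS.commute]

/-- Data in the range of `generatorInv`, which is dense, have classical solutions. -/
theorem exists_isBoundaryTrace (hS : IsUnitaryGroup (generatorInv ha) S) {T : ℝ} (hT : 0 < T)
    (VT : H0 a) : ∃ g, IsBoundaryTrace T VT g := by
  have hdense := denseRange_of_skew (adjoint_generatorInv ha) (injective_generatorInv ha)
  obtain ⟨s, hs, hslim⟩ := mem_closure_iff_seq_limit.1 (hdense (toEnergy ha VT))
  choose Y hY using hs
  have hYlim : Tendsto (fun n => generatorInv ha (Y n)) atTop (𝓝 (toEnergy ha VT)) := by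
    simpa only [hY] using hslim
  obtain ⟨g, hg, hlim⟩ := hS.exists_trace (isAdmissible_traceVector ha hS) hT hYlim
  refine ⟨g, hg, fun n => (toEnergy ha).symm (generatorInv ha (Y n)),
    fun n t => (toEnergy ha).symm (S (t - T) (generatorInv ha (Y n))),
    fun n t => inner ℝ (traceVector ha) (S (t - T) (Y n)), ?_,
    fun n => (isClassicalSolution_orbit ha hS T (Y n)).1, fun n => ?_, fun n t _ => ?_, hlim⟩
  · have h := ((toEnergy ha).symm.continuous.tendsto _).comp hYlim
    rw [ContinuousLinearEquiv.symm_apply_apply] at h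
    exact h
  · exact memLp_Ioo_of_continuousOn (continuous_const.inner
      ((hS.continuous (Y n)).comp (continuous_sub_right T))).continuousOn
  · rw [hasSecondDerivAtOne_iff ha ((isClassicalSolution_orbit ha hS T (Y n)).2 t),
      ContinuousLinearEquiv.apply_symm_apply]

/-- Whatever approximation by classical solutions is used, the boundary trace pairs with the input
as the input response does with the data. -/
theorem IsBoundaryTrace.inner_input_response (hS : IsUnitaryGroup (generatorInv ha) S) {f : ℝ → ℝ}
    (hf : ∀ T : ℝ, 0 < T → MemLp f 2 (volume.restrict (Ioo 0 T))) {z : ℝ → EnergySpace a}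
    (hz : ∀ t, 0 ≤ t →
      generatorInv ha (z t) = -∫ τ in (0 : ℝ)..t, f τ • S (-τ) (traceVector ha))
    {T : ℝ} (hT : 0 < T) {VT : H0 a} {g : ℝ → ℝ} (h : IsBoundaryTrace T VT g) :
    inner ℝ (S T (z T)) (toEnergy ha VT) = ∫ t in (0 : ℝ)..T, f t * g t := by
  obtain ⟨hg, D, V, h, hD, hV, hm, htr, hlim⟩ := h
  refine hS.inner_input_response (adjoint_generatorInv ha) hf hz hT
    (Y := fun n => toEnergy ha (derivWithin (V n) (Ici 0) T)) ?_ (fun n t ht => ?_) hm hg hlim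
  · have e : ∀ n, generatorInv ha (toEnergy ha (derivWithin (V n) (Ici 0) T)) =
        toEnergy ha (D n) := fun n => by
      rw [← (isGenerator_iff ha _ _).1 ((hV n).equation T hT.le), (hV n).final]
    simp only [e]
    exact ((toEnergy ha).continuous.tendsto _).comp hD
  · rw [← (hV n).eq_orbit ha hS hT.le ht.1]
    exact (hasSecondDerivAtOne_iff ha ((hV n).equation t ht.1)).1 (htr n t ht)

end Orbits

/-! ### The solution by transposition -/

/-- Fundamental theorem of calculus on `[0,∞)` for the image under `Φ` of a primitive. -/
theorem contDiffOn_and_derivWithin_Ici_of_eq_apply_integral {X H : Type*} [NormedAddCommGroup X]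
    [NormedSpace ℝ X] [CompleteSpace X] [NormedAddCommGroup H] [NormedSpace ℝ H]
    (Φ : X →L[ℝ] StrongDual ℝ H) {F : ℝ → StrongDual ℝ H} {ψ : ℝ → X} {c : X}
    (hψ : ContinuousOn ψ (Ici 0)) (h : ∀ t, 0 ≤ t → F t = Φ (c + ∫ s in (0 : ℝ)..t, ψ s)) :
    ContDiffOn ℝ 1 F (Ici 0) ∧ ∀ t, 0 ≤ t → derivWithin F (Ici 0) t = Φ (ψ t) := by
  have hder : ∀ t, 0 ≤ t → HasDerivWithinAt F (Φ (ψ t)) (Ici 0) t := fun t ht => by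
    -- `ψ` is extended by `ψ 0` to a continuous function on the line
    have hc : Continuous fun s => ψ (max s 0) :=
      hψ.comp_continuous (by fun_prop) fun s => mem_Ici.2 (le_max_right _ _)
    have h1 := ((hc.integral_hasStrictDerivAt 0 t).hasDerivAt.const_add c).hasDerivWithinAt
      (s := Ici 0)
    rw [max_eq_left ht] at h1
    have e : ∀ r ∈ Ici (0 : ℝ), F r = Φ (c + ∫ s in (0 : ℝ)..r, ψ (max s 0)) := fun r hr => by
      rw [h r hr]
      congr 2
      refine intervalIntegral.integral_congr fun s hs => ?_
      rw [uIcc_of_le hr] at hs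
      simp only [max_eq_left hs.1]
    exact (Φ.hasFDerivAt.comp_hasDerivWithinAt t h1).congr e (e t ht)
  have hderw : ∀ t, 0 ≤ t → derivWithin F (Ici 0) t = Φ (ψ t) := fun t ht =>
    (hder t ht).derivWithin (uniqueDiffOn_Ici 0 t ht)
  refine ⟨(contDiffOn_one_iff_derivWithin (uniqueDiffOn_Ici 0)).2
    ⟨fun t ht => (hder t ht).differentiableWithinAt, ?_⟩, hderw⟩
  exact (Φ.continuous.comp_continuousOn hψ).congr fun t ht => hderw t ht

section Transposition

variable {a : Coefficient} (ha : a.IsDegenerate)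

/-- The vector representing the initial data: `⟪·, (p, q)⟫ = ⟨u₁, p⟩ - ∫ u₀ q / a`. -/
noncomputable def dataVector (u₀ : L2w a) (u₁ : H2wDual a) : EnergySpace a :=
  (InnerProductSpace.toDual ℝ (EnergySpace a)).symm
    ((u₁ ∘L ContinuousLinearMap.fst ℝ (H2w a) (L2w a) -
      innerSL ℝ u₀ ∘L ContinuousLinearMap.snd ℝ (H2w a) (L2w a)) ∘L
      ((toEnergy ha).symm : EnergySpace a →L[ℝ] H0 a))

theorem inner_dataVector (u₀ : L2w a) (u₁ : H2wDual a) (U : H0 a) :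
    inner ℝ (dataVector ha u₀ u₁) (toEnergy ha U) = u₁ U.1 - inner ℝ u₀ U.2 := by
  rw [dataVector, InnerProductSpace.toDual_symm_apply]
  simp

/-- The functional `φ ↦ ∫ p'' φ''` on `H²_{1/a}`, for `(p, q)` in the energy space. -/
noncomputable def fstDual : EnergySpace a →L[ℝ] H2wDual a :=
  (ContinuousLinearMap.precomp ℝ (curvatureEquiv ha : H2w a →L[ℝ] curvatureSpace)) ∘L
    (innerSL ℝ : curvatureSpace →L[ℝ] StrongDual ℝ curvatureSpace) ∘L
    WithLp.fstL 2 ℝ curvatureSpace (L2w a)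

theorem fstDual_apply (x : EnergySpace a) (φ : H2w a) :
    fstDual ha x φ = inner ℝ x.fst (curvatureEquiv ha φ) := rfl

/-- The boundary input enters only the second component of the evolution.  Hence the first component
of the integrated equation is free of `f`, and `u_t` is continuous although `f` is not. -/
theorem fstDual_traceVector : fstDual ha (traceVector ha) = 0 := by
  ext φ
  rw [fstDual_apply]
  simp [traceVector, WithLp.toLp_fst]

/-- Both sides are `φ ↦ -⟪q, j φ⟫`, where `q` is the second component of `x`. -/
theorem pivot_neg_snd (x : EnergySpace a) :
    pivot a (-x.snd) = fstDual ha (generatorInv ha x) := by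
  ext φ
  rw [fstDual_apply, generatorInv_fst, inner_neg_left, adjoint_inner_left]
  have h : pivot a (-x.snd) φ = inner ℝ (-x.snd) (incl a φ) := rfl
  rw [h, incl_eq ha, inner_neg_left]
  rfl

theorem inner_energy_toEnergy (x : EnergySpace a) (U : H0 a) :
    inner ℝ x (toEnergy ha U) = fstDual ha x U.1 + inner ℝ x.snd U.2 := by
  rw [energy_inner_eq, toEnergy_fst, toEnergy_snd, fstDual_apply]

/-- The solution is `u = -y₂`, where `y(t) = S(t)(y₀ - z(t))`, `y₀` represents the initial data and
`z` is the response to the input `f`; its derivative `u_t` is `y₁`, regarded as a functional. -/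
theorem exists_unique_isTranspositionSolution {a : Coefficient} (ha : a.IsDegenerate) (f : ℝ → ℝ)
    (hf : ∀ T : ℝ, 0 < T → MemLp f 2 (volume.restrict (Ioo 0 T)))
    (u₀ : L2w a) (u₁ : H2wDual a) :
    ∃ u : ℝ → L2w a, IsTranspositionSolution a f u₀ u₁ u ∧
      ∀ w : ℝ → L2w a, IsTranspositionSolution a f u₀ u₁ w → EqOn w u (Ici 0) := by
  have hB := adjoint_generatorInv ha
  have hi := injective_generatorInv ha
  obtain ⟨S, hS⟩ := exists_isUnitaryGroup hB hi
  obtain ⟨z, hzc, hz⟩ := hS.exists_input_response hB hi (isAdmissible_traceVector ha hS) hf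
  set y₀ := dataVector ha u₀ u₁ with hy₀
  set y : ℝ → EnergySpace a := fun t => S t (y₀ - z t) with hy
  have hyc : ContinuousOn y (Ici 0) :=
    hS.continuousOn_comp continuousOn_id (continuousOn_const.sub hzc)
  set u : ℝ → L2w a := fun t => -(y t).snd with hu
  have huc : ContinuousOn u (Ici 0) :=
    ((WithLp.sndL 2 ℝ curvatureSpace (L2w a)).continuous.comp_continuousOn hyc).neg
  have hpiv : ∀ t, 0 ≤ t → pivot a (u t) =
      fstDual ha (generatorInv ha y₀ + ∫ s in (0 : ℝ)..t, y s) := fun t ht => by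
    have h1 : pivot a (u t) = fstDual ha (generatorInv ha (y t)) := pivot_neg_snd ha (y t)
    rw [h1, hS.apply_input_response hi hf hzc hz y₀ ht, map_add, map_smul,
      fstDual_traceVector, smul_zero, add_zero]
  obtain ⟨hcd, hderw⟩ := contDiffOn_and_derivWithin_Ici_of_eq_apply_integral (X := EnergySpace a)
    (H := H2w a) (fstDual ha) (F := fun t => pivot a (u t)) hyc hpiv
  have hpair : ∀ T, 0 < T → ∀ (VT : H0 a) (V : ℝ → H0 a) (g : ℝ → ℝ), IsMildSolution T VT V →
      IsBoundaryTrace T VT g → inner ℝ (y T) (toEnergy ha VT) =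
        u₁ (V 0).1 - inner ℝ u₀ (V 0).2 - ∫ t in (0 : ℝ)..T, f t * g t := by
    intro T hT VT V g hV hg
    rw [← hg.inner_input_response ha hS hf hz hT, ← inner_dataVector ha u₀ u₁ (V 0),
      hV.eq_orbit ha hS hT.le le_rfl, zero_sub, hS.inner_apply_right, neg_neg, ← inner_sub_left,
      ← map_sub]
  refine ⟨u, ⟨huc, hcd, fun T hT VT => ?_⟩, fun w hw => ?_⟩
  · obtain ⟨g, hg⟩ := exists_isBoundaryTrace ha hS hT VT
    refine ⟨_, g, isMildSolution_orbit ha hS T VT, hg, ?_⟩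
    rw [← hpair T hT VT _ g (isMildSolution_orbit ha hS T VT) hg, hderw T hT.le,
      inner_energy_toEnergy, hu, inner_neg_left, sub_neg_eq_add]
  · -- data `(0, q)` at time `T` determine `w T` for `T > 0`; continuity gives the value at `0`
    have hpos : EqOn w u (Ioi 0) := fun T hT => by
      refine ext_inner_right ℝ fun q => ?_
      obtain ⟨V, g, hV, hg, h⟩ := hw.identity T hT ((0 : H2w a), q)
      rw [← hpair T hT _ V g hV hg, inner_energy_toEnergy] at h
      simp only [map_zero, zero_sub, zero_add] at h
      rw [hu, inner_neg_left]
      linarith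
    exact hpos.of_subset_closure hw.continuousOn huc Ioi_subset_Ici_self (by rw [closure_Ioi])

end Transposition

end DegenerateBeam

open DegenerateBeam in
theorem mainTheorem10 (a : Coefficient) (ha : IsWeaklyDegenerate a ∨ IsStronglyDegenerate a)
    (f : ℝ → ℝ) (hf : ∀ T : ℝ, 0 < T → MemLp f 2 (volume.restrict (Ioo 0 T)))
    (u₀ : L2w a) (u₁ : H2wDual a) :
    ∃ u : ℝ → L2w a, IsTranspositionSolution a f u₀ u₁ u ∧
      ∀ w : ℝ → L2w a, IsTranspositionSolution a f u₀ u₁ w → EqOn w u (Ici 0) :=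
  exists_unique_isTranspositionSolution (Coefficient.isDegenerate ha) f hf u₀ u₁
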